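/- **Lemma (the weak unique continuation property implies the Runge approximation property).** Let $n\ge 1$, $s\in(0,1)$, $p=\max\{2,\tfrac{n}{2s}\}$, let $\Omega\subset\mathbb R^n$ be a bounded open set, $\Omega_e=\mathbb R^n\setminus\overline\Omega$, and let $W\subseteq\Omega_e$ be open. All function spaces consist of complex-valued functions; $a\cdot b=\sum_i a_ib_i$ is the bilinear dot product on $\mathbb C^n$. For $U\subseteq\mathbb R^n$ open, $\tilde H^s(U)$ is the closure of $C_c^\infty(U)$ in $H^s(\mathbb R^n)$. *Potentials.* Let $A:\mathbb R^n\times\mathbb R^n\to\mathbb C^n$ be measurable and $q:\mathbb R^n\to\mathbb R$, with $q$ understood to vanish outside $\Omega$. Write $A_s(x,y)=\frac{A(x,y)+A(y,x)}2$, $A_a=A-A_s$, and, for a function $V:\mathbb R^n\times\mathbb R^n\to\mathbb C^n$, $V_\parallel(x,y)=\frac{V(x,y)\cdot(x-y)}{|x-y|^2}(x-y)$ for $x\ne y$ and $V_\parallel(x,x)=V(x,x)$; let $A_{s\parallel}=(A_s)_\parallel$, $A_{a\parallel}=(A_a)_\parallel$. Assume 1. the functions $x\mapsto\big(\int_{\mathbb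 R^n}|A(y,x)|^2\,dy\big)^{1/2}$ and $x\mapsto\big(\int_{\mathbb R^n}|A(x,y)|^2\,dy\big)^{1/2}$ belong to $L^{2p}(\mathbb R^n)$; 2. $A_{s\parallel}\in H^{sp-s}(\mathbb R^{2n},\mathbb C^n)$; 3. $A_{a\parallel}(x,y)\cdot(y-x)$ is real and $\ge 0$ for almost every $(x,y)$; 4. $q\in L^p(\Omega)$. *Equation.* Let $\alpha(x,y)=\frac{\mathcal C_{n,s}^{1/2}}{\sqrt2}\,\frac{y-x}{|y-x|^{n/2+s+1}}$ with $\mathcal C_{n,s}=\frac{4^s\,\Gamma(n/2+s)}{\pi^{n/2}|\Gamma(-s)|}$, and for $u\in H^s(\mathbb R^n)$ let $$\nabla^s_Au(x,y)=(u(x)-u(y))\,\alpha(x,y)+A(x,y)\,u(x).$$ For $u,v\in H^s(\mathbb R^n)$ put $$B[u,v]=\int_{\mathbb R^n}\int_{\mathbb R^n}\nabla^s_Au\cdot\nabla^s_Av\,dy\,dx+\int_{\Omega}q\,u\,v\,dx .$$ For $U$ open, $(-\Delta)^s_Au+qu=0$ in $U$ means that $B[u,v]=0$ for all $v\in\tilde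 H^s(U)$. For $f\in H^s(\mathbb R^n)$, a function $u\in H^s(\mathbb R^n)$ solves the fractional magnetic Schrödinger equation (FMSE) with exterior value $f$ if $(-\Delta)^s_Au+qu=0$ in $\Omega$ and $u-f\in\tilde H^s(\Omega)$. Assume that $0$ is not an eigenvalue, i.e. that the only solution with exterior value $0$ is $u=0$. *Claim.* Suppose that the weak unique continuation property holds for $W$: every $u\in H^s(\mathbb R^n)$ with $u=0$ almost everywhere in $W$ and $(-\Delta)^s_Au+qu=0$ in $W$ vanishes almost everywhere in $\Omega$. Then the Runge approximation property holds for $W$: the set $$\mathcal R=\{\,u|_\Omega\;:\;u\in H^s(\mathbb R^n)\text{ solves FMSE with exterior value } f \text{ for some } f\in C_c^\infty(W)\,\}$$ is dense in $L^2(\Omega)$. -/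

import Mathlib

noncomputable section

namespace FMSE

open MeasureTheory TemperedDistribution
open scoped SchwartzMap ContDiff ENNReal

/-- The Euclidean space `ℝⁿ`. -/
abbrev E (n : ℕ) := EuclideanSpace ℝ (Fin n)

/-- The Euclidean space `ℂⁿ`. -/
abbrev EC (n : ℕ) := EuclideanSpace ℂ (Fin n)

/-- Scalar square integrable functions on `ℝⁿ` (classes modulo equality almost everywhere). -/
abbrev L2 (n : ℕ) := Lp ℂ 2 (volume : Measure (E n))

/-- The inclusion `ℝⁿ ⊆ ℂⁿ`. -/
def toComplex {n : ℕ} (x : E n) : EC n := WithLp.toLp 2 fun i => (x i : ℂ)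

/-- The bilinear dot product `a · b = ∑ aᵢ bᵢ` on `ℂⁿ` (no complex conjugation). -/
def dot {n : ℕ} (a b : EC n) : ℂ := ∑ i, a i * b i

/-! ### Bivariate vector functions -/

/-- The symmetric part `A_s`. -/
def symPart {n : ℕ} (A : E n → E n → EC n) (x y : E n) : EC n :=
  (2⁻¹ : ℂ) • (A x y + A y x)

/-- The antisymmetric part `A_a = A - A_s`. -/
def antiPart {n : ℕ} (A : E n → E n → EC n) (x y : E n) : EC n :=
  A x y - symPart A x y

open Classical in
/-- The parallel part `A_∥`. -/
def parPart {n : ℕ} (A : E n → E n → EC n) (x y : E n) : EC n :=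
  if x = y then A x y
  else (dot (A x y) (toComplex (x - y)) / ((‖x - y‖ ^ 2 : ℝ) : ℂ)) • toComplex (x - y)

/-- `𝒥₁A(x) = (∫ |A(y,x)|² dy)^{1/2}`, with values in `[0, ∞]`. -/
def J1 {n : ℕ} (A : E n → E n → EC n) (x : E n) : ℝ≥0∞ :=
  (∫⁻ y, ‖A y x‖ₑ ^ 2) ^ (2⁻¹ : ℝ)

/-- `𝒥₂A(x) = (∫ |A(x,y)|² dy)^{1/2}`, with values in `[0, ∞]`. -/
def J2 {n : ℕ} (A : E n → E n → EC n) (x : E n) : ℝ≥0∞ :=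
  (∫⁻ y, ‖A x y‖ₑ ^ 2) ^ (2⁻¹ : ℝ)

/-! ### Sobolev spaces -/

/-- The Sobolev space `Hˢ(ℝⁿ)`, for `s ≥ 0`, as a set of square integrable functions. -/
def Hs (n : ℕ) (s : ℝ) : Set (L2 n) :=
  {u | MemSobolev s 2 (u : 𝓢'(E n, ℂ))}

/-- `‖u‖_{Hˢ} < ε`, the norm being the `L²` norm of the Bessel potential of `u`. The Bessel
potential here has the symbol `(1 + |ξ|²)^{s/2}` for the Fourier transform with kernel
`e^{-2πi x·ξ}`; other normalizations of the Fourier transform give an equivalent norm. -/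
def HsNormLt {n : ℕ} (s : ℝ) (u : L2 n) (ε : ℝ) : Prop :=
  ∃ g : L2 n, besselPotential (E n) ℂ s (u : 𝓢'(E n, ℂ)) = (g : 𝓢'(E n, ℂ)) ∧ ‖g‖ < ε

/-- `C_c^∞(U)`, complex valued functions, as a set of functions on `ℝⁿ`. -/
def TestFun {n : ℕ} (U : Set (E n)) : Set (E n → ℂ) :=
  {f | ContDiff ℝ ∞ f ∧ HasCompactSupport f ∧ tsupport f ⊆ U}

/-- `C_c^∞(U)` as a set of elements of `L²(ℝⁿ)`. -/
def TestL2 {n : ℕ} (U : Set (E n)) : Set (L2 n) :=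
  {φ | ∃ f ∈ TestFun U, (φ : E n → ℂ) =ᵐ[volume] f}

/-- `H̃ˢ(U)`: the closure of `C_c^∞(U)` in `Hˢ(ℝⁿ)`. -/
def HsTilde {n : ℕ} (s : ℝ) (U : Set (E n)) : Set (L2 n) :=
  {u | u ∈ Hs n s ∧ ∀ ε > 0, ∃ φ ∈ TestL2 U, HsNormLt s (u - φ) ε}

/-! ### Potentials -/

/-- The exponent `p = max {2, n / (2s)}`. -/
def pExp (n : ℕ) (s : ℝ) : ℝ := max 2 (n / (2 * s))

/-- A vector valued function of two variables belongs to `H^r(ℝ²ⁿ, ℂⁿ)`, where `r ≥ 0`. -/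
def MemHr2 {n : ℕ} (r : ℝ) (F : E n → E n → EC n) : Prop :=
  ∃ h : MemLp (fun z : WithLp 2 (E n × E n) => F z.fst z.snd) 2 volume,
    MemSobolev r 2 ((h.toLp _ : Lp (EC n) 2 (volume : Measure (WithLp 2 (E n × E n)))) :
      𝓢'(WithLp 2 (E n × E n), EC n))

/-- The class `𝒫₀` of pairs of potentials `(A, q)`; the scalar potential `q` matters on `Ω` only,
that is, it is understood to vanish outside `Ω`. -/
structure P0 {n : ℕ} (s : ℝ) (Ω : Set (E n)) (A : E n → E n → EC n) (q : E n → ℝ) : Prop where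
  measurable_A : AEStronglyMeasurable (fun z : E n × E n => A z.1 z.2) volume
  memLp_J1 : MemLp (J1 A) (ENNReal.ofReal (2 * pExp n s)) volume
  memLp_J2 : MemLp (J2 A) (ENNReal.ofReal (2 * pExp n s)) volume
  symPar_memHr : MemHr2 (s * pExp n s - s) (parPart (symPart A))
  antiPar_nonneg : ∀ᵐ z : E n × E n,
    (dot (parPart (antiPart A) z.1 z.2) (toComplex (z.2 - z.1))).im = 0 ∧
      0 ≤ (dot (parPart (antiPart A) z.1 z.2) (toComplex (z.2 - z.1))).re
  memLp_q : MemLp q (ENNReal.ofReal (pExp n s)) (volume.restrict Ω)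

/-! ### The fractional magnetic Schrödinger equation -/

/-- The constant `C_{n,s}` for which `C_{n,s} PV ∫ (u(x) - u(y)) / |x - y|^{n+2s} dy` has the
Fourier symbol `|ξ|^{2s}`, namely `4ˢ Γ(n/2 + s) / (π^{n/2} |Γ(-s)|)`. -/
def Cns (n : ℕ) (s : ℝ) : ℝ :=
  4 ^ s * Real.Gamma (n / 2 + s) / (Real.pi ^ ((n : ℝ) / 2) * |Real.Gamma (-s)|)

/-- `α(x,y) = (C_{n,s}^{1/2} / √2) (y - x) / |y - x|^{n/2 + s + 1}`. -/
def alpha {n : ℕ} (s : ℝ) (x y : E n) : E n :=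
  (Real.sqrt (Cns n s) / Real.sqrt 2 / ‖y - x‖ ^ ((n : ℝ) / 2 + s + 1)) • (y - x)

/-- The fractional gradient `∇ˢu(x,y) = (u(x) - u(y)) α(x,y)`. -/
def fracGrad {n : ℕ} (s : ℝ) (u : E n → ℂ) (x y : E n) : EC n :=
  (u x - u y) • toComplex (alpha s x y)

/-- The magnetic fractional gradient `∇ˢ_A u(x,y) = ∇ˢu(x,y) + A(x,y) u(x)`. -/
def magGrad {n : ℕ} (s : ℝ) (A : E n → E n → EC n) (u : E n → ℂ) (x y : E n) : EC n :=
  fracGrad s u x y + u x • A x y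

/-- The bilinear form
`B[u,v] = ∫∫ ∇ˢ_A u · ∇ˢ_A v dy dx + ∫_Ω q u v dx = ⟨(-Δ)ˢ_A u, v⟩ + ⟨q u, v⟩`. -/
def bilin {n : ℕ} (s : ℝ) (Ω : Set (E n)) (A : E n → E n → EC n) (q : E n → ℝ) (u v : L2 n) : ℂ :=
  (∫ z : E n × E n, dot (magGrad s A u z.1 z.2) (magGrad s A v z.1 z.2)) +
    ∫ x in Ω, (q x : ℂ) * u x * v x

/-- `(-Δ)ˢ_A u + q u = 0` in the open set `U`, in the weak sense. -/
def SolvesIn {n : ℕ} (s : ℝ) (Ω : Set (E n)) (A : E n → E n → EC n) (q : E n → ℝ)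
    (U : Set (E n)) (u : L2 n) : Prop :=
  ∀ v ∈ HsTilde s U, bilin s Ω A q u v = 0

/-- `u ∈ Hˢ(ℝⁿ)` solves the equation in `Ω` with exterior value `f ∈ Hˢ(ℝⁿ)`. -/
def IsSolution {n : ℕ} (s : ℝ) (Ω : Set (E n)) (A : E n → E n → EC n) (q : E n → ℝ)
    (f u : L2 n) : Prop :=
  u ∈ Hs n s ∧ u - f ∈ HsTilde s Ω ∧ SolvesIn s Ω A q Ω u

/-- `0` is not an eigenvalue of the Dirichlet problem: the equation in `Ω` with exterior
value zero has only the trivial solution. -/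
def ZeroNotEigenvalue {n : ℕ} (s : ℝ) (Ω : Set (E n)) (A : E n → E n → EC n) (q : E n → ℝ) : Prop :=
  ∀ u : L2 n, IsSolution s Ω A q 0 u → u = 0

/-- The weak unique continuation property with respect to the open set `W`. -/
def WUCP {n : ℕ} (s : ℝ) (Ω : Set (E n)) (A : E n → E n → EC n) (q : E n → ℝ)
    (W : Set (E n)) : Prop :=
  ∀ u ∈ Hs n s, (∀ᵐ x ∂volume.restrict W, u x = 0) → SolvesIn s Ω A q W u →
    ∀ᵐ x ∂volume.restrict Ω, u x = 0

/-- The set `ℛ ⊆ L²(Ω)` of the restrictions to `Ω` of solutions with exterior value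
in `C_c^∞(W)`. -/
def RungeSet {n : ℕ} (s : ℝ) (Ω : Set (E n)) (A : E n → E n → EC n) (q : E n → ℝ)
    (W : Set (E n)) : Set (Lp ℂ 2 ((volume : Measure (E n)).restrict Ω)) :=
  {w | ∃ f ∈ TestL2 W, ∃ u : L2 n, IsSolution s Ω A q f u ∧
    (w : E n → ℂ) =ᵐ[volume.restrict Ω] u}

/-- The Runge approximation property with respect to the open set `W`. -/
def RAP {n : ℕ} (s : ℝ) (Ω : Set (E n)) (A : E n → E n → EC n) (q : E n → ℝ)
    (W : Set (E n)) : Prop :=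
  Dense (RungeSet s Ω A q W)

end FMSE

end

noncomputable section

namespace FMSE

open MeasureTheory TemperedDistribution FourierTransform Filter Topology
open scoped SchwartzMap ContDiff ENNReal

/-! ### The Bessel potential of negative order on square integrable functions -/

/-! The proof is a duality argument resting on solvability of the Dirichlet problem. The Runge set
is a subspace, so it suffices that a `w` in `L²(Ω)` orthogonal to it vanishes. Let `φ ∈ H̃ˢ(Ω)`
solve the dual problem `B[φ, k] = ⟨w, k⟩` for all `k ∈ H̃ˢ(Ω)`. For a test function `f` in `W`, the
solution with exterior value `f` is `f + k` with `k ∈ H̃ˢ(Ω)` and `B[k, ·] = -B[f, ·]` on `H̃ˢ(Ω)`.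
Since `f = 0` in `Ω` and `B` is symmetric, `0 = ⟨w, f + k⟩ = ⟨w, k⟩ = B[φ, k] = -B[f, φ]`. So `φ`
solves the equation in `W`, and it vanishes there because it vanishes outside `Ω`. Weak unique
continuation gives `φ = 0`, so `w` is orthogonal to all test functions in `Ω` and is zero
(`rap_of_wucp`).

Solvability (`exists_solution`) is a Fredholm alternative. `Hˢ` is identified with `L²` through `g ↦
besselInv g`, so that `B` becomes a bounded bilinear form on `L²` (`exists_bilinCLM`). Testing with
the complex conjugate of `u` gives a Gårding inequality (`exists_garding`): the principal part
controls the Gagliardo seminorm, which is a multiple of the norm of `|ξ|ˢ û`, and the potentials are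
form bounded with arbitrarily small relative bound (`exists_weight_small`), by Hölder, truncation
and the fractional Sobolev inequality (`exists_sobolev_const`).

Compactness enters as an explicit estimate: on functions supported in a bounded set, a Poincaré
inequality on small cubes bounds the `L²` norm by finitely many averages plus a small multiple of
the seminorm (`exists_finite_rank`). The resulting estimate modulo a finite rank operator, together
with the injectivity supplied by the eigenvalue hypothesis, makes the form bounded below
(`exists_le_of_finite_rank`). Symmetry then gives surjectivity (`exists_forall_eq_of_symm`). -/

theorem toTemperedDistribution_injective {n : ℕ} {u v : L2 n}
    (h : (u : 𝓢'(E n, ℂ)) = (v : 𝓢'(E n, ℂ))) : u = v := by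
  have hk := Lp.ker_toTemperedDistributionCLM_eq_bot (E := E n) (F := ℂ) (μ := volume) (p := 2)
  have h1 : u - v ∈ (Lp.toTemperedDistributionCLM ℂ (volume : Measure (E n)) 2).ker := by
    rw [LinearMap.mem_ker]
    simp only [ContinuousLinearMap.coe_coe, map_sub, Lp.toTemperedDistributionCLM_apply, h,
      sub_self]
  rw [hk, Submodule.mem_bot] at h1
  exact sub_eq_zero.mp h1

theorem toTemperedDistribution_add {n : ℕ} (u v : L2 n) :
    ((u + v : L2 n) : 𝓢'(E n, ℂ)) = (u : 𝓢'(E n, ℂ)) + (v : 𝓢'(E n, ℂ)) := by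
  simp only [← Lp.toTemperedDistributionCLM_apply, map_add]

theorem toTemperedDistribution_smul {n : ℕ} (c : ℂ) (u : L2 n) :
    ((c • u : L2 n) : 𝓢'(E n, ℂ)) = c • (u : 𝓢'(E n, ℂ)) := by
  simp only [← Lp.toTemperedDistributionCLM_apply, map_smul]

/-- The symbol `(1 + |ξ|²)^{-s/2}`. -/
def besselSymbol (n : ℕ) (s : ℝ) (ξ : E n) : ℝ := (1 + ‖ξ‖ ^ 2) ^ (-s / 2)

theorem besselSymbol_pos {n : ℕ} (s : ℝ) (ξ : E n) : 0 < besselSymbol n s ξ :=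
  Real.rpow_pos_of_pos (by positivity) _

theorem besselSymbol_le_one {n : ℕ} {s : ℝ} (hs : 0 ≤ s) (ξ : E n) : besselSymbol n s ξ ≤ 1 :=
  Real.rpow_le_one_of_one_le_of_nonpos (by simp) (by linarith)

/-- On the Fourier side the operator is multiplication by a symbol bounded by `1`, so Plancherel
gives both the `L²` representative and the contraction bound. -/
theorem exists_besselPotential_neg_eq {n : ℕ} {s : ℝ} (hs : 0 ≤ s) (g : L2 n) :
    ∃ u : L2 n, (u : 𝓢'(E n, ℂ)) = besselPotential (E n) ℂ (-s) (g : 𝓢'(E n, ℂ)) ∧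
      ‖u‖ ≤ ‖g‖ := by
  have htg : (fun x : E n => ((1 + ‖x‖ ^ 2) ^ (-s / 2) : ℝ)).HasTemperateGrowth := by fun_prop
  have htg' : (fun x : E n => (((1 + ‖x‖ ^ 2) ^ (-s / 2) : ℝ) : ℂ)).HasTemperateGrowth := by
    fun_prop
  have hb : ∀ x : E n, ‖(((1 + ‖x‖ ^ 2) ^ (-s / 2) : ℝ) : ℂ)‖ ≤ 1 := by
    intro x
    have h1 := besselSymbol_le_one hs x
    have h0 := besselSymbol_pos s x
    rw [Complex.norm_real, Real.norm_eq_abs]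
    exact abs_le.2 ⟨by unfold besselSymbol at h0; linarith, h1⟩
  set m : BoundedContinuousFunction (E n) ℂ :=
    BoundedContinuousFunction.ofNormedAddCommGroup _ htg'.1.continuous 1 hb with hm
  set m' : Lp ℂ ∞ (volume : Measure (E n)) := m.memLp_top.toLp _ with hm'
  refine ⟨𝓕⁻ (m' • (𝓕 g : L2 n) : L2 n), ?_, ?_⟩
  · rw [← Lp.fourierInv_toTemperedDistribution_eq,
      MeasureTheory.Lp.toTemperedDistribution_smul_eq (by exact htg'),
      ← Lp.fourier_toTemperedDistribution_eq, besselPotential, fourierMultiplierCLM_apply]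
    rfl
  · have h1 : ‖(𝓕⁻ (m' • (𝓕 g : L2 n) : L2 n) : L2 n)‖ = ‖(m' • (𝓕 g : L2 n) : L2 n)‖ := by
      rw [← Lp.norm_fourier_eq, fourier_fourierInv_eq]
    rw [h1]
    refine (Lp.norm_smul_le _ _).trans ?_
    rw [Lp.norm_fourier_eq]
    have h2 : ‖m'‖ ≤ 1 := by
      rw [hm', Lp.norm_toLp]
      refine ENNReal.toReal_le_of_le_ofReal zero_le_one ?_
      refine (eLpNorm_le_of_ae_bound (C := 1) (Filter.Eventually.of_forall hb)).trans ?_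
      simp
    nlinarith [norm_nonneg g]

/-- The operator `(1 + |D|²)^{-s/2}` on `L²`, for `s ≥ 0`. -/
def besselInv (n : ℕ) {s : ℝ} (hs : 0 ≤ s) : L2 n →L[ℂ] L2 n :=
  LinearMap.mkContinuous
    { toFun := fun g => (exists_besselPotential_neg_eq hs g).choose
      map_add' := by
        intro g h
        apply toTemperedDistribution_injective
        refine (exists_besselPotential_neg_eq hs _).choose_spec.1.trans ?_
        rw [toTemperedDistribution_add, toTemperedDistribution_add, map_add,
          (exists_besselPotential_neg_eq hs g).choose_spec.1,
          (exists_besselPotential_neg_eq hs h).choose_spec.1]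
      map_smul' := by
        intro c g
        apply toTemperedDistribution_injective
        refine (exists_besselPotential_neg_eq hs _).choose_spec.1.trans ?_
        rw [RingHom.id_apply, toTemperedDistribution_smul, toTemperedDistribution_smul, map_smul,
          (exists_besselPotential_neg_eq hs g).choose_spec.1] } 1
    (fun g => by
      rw [one_mul]; exact (exists_besselPotential_neg_eq hs g).choose_spec.2)

theorem besselInv_toTemperedDistribution {n : ℕ} {s : ℝ} (hs : 0 ≤ s) (g : L2 n) :
    (besselInv n hs g : 𝓢'(E n, ℂ)) = besselPotential (E n) ℂ (-s) (g : 𝓢'(E n, ℂ)) :=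
  (exists_besselPotential_neg_eq hs g).choose_spec.1

theorem norm_besselInv_le {n : ℕ} {s : ℝ} (hs : 0 ≤ s) (g : L2 n) : ‖besselInv n hs g‖ ≤ ‖g‖ :=
  (exists_besselPotential_neg_eq hs g).choose_spec.2

/-- This parametrises `Hˢ` by `L²`: from here on `u = besselInv g` is handled through `g`, and `‖g‖`
is its `Hˢ` norm. -/
theorem besselPotential_eq_iff {n : ℕ} {s : ℝ} (hs : 0 ≤ s) (u g : L2 n) :
    besselPotential (E n) ℂ s (u : 𝓢'(E n, ℂ)) = (g : 𝓢'(E n, ℂ)) ↔ u = besselInv n hs g := by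
  rw [← besselPotential_neg_apply_eq_iff, ← besselInv_toTemperedDistribution hs]
  exact ⟨fun h => (toTemperedDistribution_injective h).symm, fun h => by rw [h]⟩

theorem besselInv_injective {n : ℕ} {s : ℝ} (hs : 0 ≤ s) :
    Function.Injective (besselInv n hs) := by
  intro g h hgh
  apply toTemperedDistribution_injective
  rw [← (besselPotential_eq_iff hs (besselInv n hs g) g).2 rfl, hgh,
    (besselPotential_eq_iff hs (besselInv n hs h) h).2 rfl]

theorem mem_Hs_iff {n : ℕ} {s : ℝ} (hs : 0 ≤ s) (u : L2 n) :
    u ∈ Hs n s ↔ ∃ g, besselInv n hs g = u := by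
  simp only [Hs, MemSobolev, Set.mem_ofPred_eq, besselPotential_eq_iff hs, eq_comm]

theorem HsNormLt_iff {n : ℕ} {s : ℝ} (hs : 0 ≤ s) (u : L2 n) (ε : ℝ) :
    HsNormLt s u ε ↔ ∃ g, besselInv n hs g = u ∧ ‖g‖ < ε := by
  simp only [HsNormLt, besselPotential_eq_iff hs, eq_comm]

/-! ### Schwartz functions -/

/-- A Schwartz function as an element of `L²`. -/
def toL2 {n : ℕ} (f : 𝓢(E n, ℂ)) : L2 n := f.toLp 2 volume

theorem coeFn_toL2 {n : ℕ} (f : 𝓢(E n, ℂ)) : toL2 f =ᵐ[volume] f := f.coeFn_toLp 2 volume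

theorem toL2_smul {n : ℕ} (c : ℂ) (f : 𝓢(E n, ℂ)) : toL2 (c • f) = c • toL2 f := rfl

theorem denseRange_toL2 (n : ℕ) : DenseRange (toL2 (n := n)) :=
  SchwartzMap.denseRange_toLpCLM (E := E n) (F := ℂ) (μ := volume) (p := 2) ENNReal.ofNat_ne_top

theorem toL2_toTemperedDistribution {n : ℕ} (f : 𝓢(E n, ℂ)) :
    (toL2 f : 𝓢'(E n, ℂ)) = SchwartzMap.toTemperedDistributionCLM (E n) ℂ volume f :=
  Lp.toTemperedDistribution_toLp_eq f

theorem lintegral_enorm_fourier_sq {n : ℕ} (f : 𝓢(E n, ℂ)) :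
    ∫⁻ ξ, ‖(𝓕 f : 𝓢(E n, ℂ)) ξ‖ₑ ^ 2 = ∫⁻ x, ‖f x‖ₑ ^ 2 := by
  have key : ∀ h : 𝓢(E n, ℂ), ∫⁻ x, ‖h x‖ₑ ^ 2 = ENNReal.ofReal (∫ x, ‖h x‖ ^ 2) := by
    intro h
    have hi := (h.memLp 2 (volume : Measure (E n))).integrable_norm_pow (by norm_num)
    rw [ofReal_integral_eq_lintegral_ofReal hi (Filter.Eventually.of_forall fun _ => by positivity)]
    refine lintegral_congr fun x => ?_
    rw [ENNReal.ofReal_pow (norm_nonneg _), ofReal_norm]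
  rw [key, key, SchwartzMap.integral_norm_sq_fourier]

theorem enorm_toL2_sq {n : ℕ} (f : 𝓢(E n, ℂ)) :
    ‖toL2 f‖ₑ ^ 2 = ∫⁻ x, ‖f x‖ₑ ^ 2 := by
  rw [toL2, SchwartzMap.toLp, Lp.enorm_toLp]
  have := eLpNorm_nnreal_pow_eq_lintegral (f := f) (μ := (volume : Measure (E n))) (p := 2)
    (by norm_num)
  simpa using this

theorem enorm_L2_sq {α F : Type*} [MeasurableSpace α] {μ : Measure α} [NormedAddCommGroup F]
    (u : Lp F 2 μ) : ‖u‖ₑ ^ 2 = ∫⁻ x, ‖u x‖ₑ ^ 2 ∂μ := by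
  rw [Lp.enorm_def]
  have := eLpNorm_nnreal_pow_eq_lintegral (f := u) (μ := μ) (p := 2)
    (by norm_num)
  simpa using this

/-- For Schwartz functions the Bessel potential is a pointwise identity between Fourier transforms,
which is what the norm comparisons below integrate. -/
theorem exists_besselInv_schwartz {n : ℕ} {s : ℝ} (hs : 0 ≤ s) (g : 𝓢(E n, ℂ)) :
    ∃ φ : 𝓢(E n, ℂ), besselInv n hs (toL2 g) = toL2 φ ∧
      ∀ ξ, (𝓕 φ : 𝓢(E n, ℂ)) ξ = (besselSymbol n s ξ : ℂ) * (𝓕 g : 𝓢(E n, ℂ)) ξ := by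
  have htg : (fun x : E n => ((1 + ‖x‖ ^ 2) ^ (-s / 2) : ℝ)).HasTemperateGrowth := by fun_prop
  refine ⟨SchwartzMap.fourierMultiplierCLM ℂ (fun x => ((1 + ‖x‖ ^ 2) ^ (-s / 2) : ℝ)) g, ?_, ?_⟩
  · apply toTemperedDistribution_injective
    rw [besselInv_toTemperedDistribution, besselPotential, toL2_toTemperedDistribution,
      toL2_toTemperedDistribution,
      fourierMultiplierCLM_toTemperedDistributionCLM_eq (by fun_prop)]
    congr 1
    exact SchwartzMap.fourierMultiplierCLM_ofReal ℂ htg g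
  · intro ξ
    rw [SchwartzMap.fourierMultiplierCLM_apply, fourier_fourierInv_eq,
      SchwartzMap.smulLeftCLM_apply_apply htg]
    simp [besselSymbol]

theorem exists_schwartz_besselInv_eq {n : ℕ} {s : ℝ} (hs : 0 ≤ s) (φ : 𝓢(E n, ℂ)) :
    ∃ g : 𝓢(E n, ℂ), besselInv n hs (toL2 g) = toL2 φ := by
  obtain ⟨g, hg⟩ : ∃ g : 𝓢(E n, ℂ), besselPotential (E n) ℂ s
      ((toL2 φ) : 𝓢'(E n, ℂ)) = ((toL2 g) : 𝓢'(E n, ℂ)) := by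
    use SchwartzMap.fourierMultiplierCLM ℂ (fun x ↦ ((1 + ‖x‖ ^ 2) ^ (s / 2) : ℝ)) φ
    rw [besselPotential, toL2_toTemperedDistribution, toL2_toTemperedDistribution,
      fourierMultiplierCLM_toTemperedDistributionCLM_eq (by fun_prop)]
    congr 1
    apply SchwartzMap.fourierMultiplierCLM_ofReal ℂ
      (Function.hasTemperateGrowth_one_add_norm_sq_rpow (E n) (s / 2))
  exact ⟨g, ((besselPotential_eq_iff hs _ _).1 hg).symm⟩

end FMSE

end

noncomputable section

namespace FMSE

open MeasureTheory TemperedDistribution FourierTransform Filter Topology Module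
open scoped SchwartzMap ENNReal RealInnerProductSpace

/-! ### Radial integrals -/

theorem lintegral_comp_smul_pos {n : ℕ} (f : E n → ℝ≥0∞) {t : ℝ} (ht : 0 < t) :
    ∫⁻ x, f (t • x) = ENNReal.ofReal (t ^ (-(n : ℝ))) * ∫⁻ x, f x := by
  have h1 : ∫⁻ x, f (t • x) = ∫⁻ x, f x ∂(Measure.map (t • ·) (volume : Measure (E n))) :=
    ((Homeomorph.smulOfNeZero t ht.ne').measurableEmbedding.lintegral_map f).symm
  rw [h1, Measure.map_addHaar_smul _ ht.ne', lintegral_smul_measure, smul_eq_mul]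
  congr 2
  rw [finrank_euclideanSpace, Fintype.card_fin, Real.rpow_neg ht.le, Real.rpow_natCast,
    abs_of_pos (by positivity)]

theorem lintegral_comp_isometry {n : ℕ} (f : E n → ℝ≥0∞) (R : E n ≃ₗᵢ[ℝ] E n) :
    ∫⁻ x, f (R x) = ∫⁻ x, f x :=
  R.measurePreserving.lintegral_comp_emb R.toHomeomorph.measurableEmbedding f

theorem lintegral_ball_rpow_norm_lt_top {n : ℕ} (hn : 1 ≤ n) {a : ℝ} (ha : -(n : ℝ) < a) :
    ∫⁻ x in Metric.ball (0 : E n) 1, ENNReal.ofReal (‖x‖ ^ a) < ∞ := by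
  have : Nonempty (Fin n) := ⟨⟨0, hn⟩⟩
  have h : IntegrableOn (fun x : E n => ‖x‖ ^ a) (Metric.ball (0 : E n) 1) := by
    rw [integrableOn_fun_norm_addHaar volume (f := fun r : ℝ => r ^ a)]
    have h2 : IntegrableOn (fun y : ℝ => y ^ ((n : ℝ) - 1 + a)) (Set.Ioo 0 1) := by
      rw [intervalIntegral.integrableOn_Ioo_rpow_iff zero_lt_one]
      linarith
    refine h2.congr_fun ?_ measurableSet_Ioo
    intro y hy
    simp only [finrank_euclideanSpace, Fintype.card_fin, smul_eq_mul]
    rw [← Real.rpow_natCast, ← Real.rpow_add hy.1]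
    congr 2
    push_cast [Nat.cast_sub hn]
    ring
  exact h.lintegral_lt_top

theorem lintegral_compl_ball_rpow_norm_lt_top {n : ℕ} {a : ℝ} (ha0 : a ≤ 0) (ha : a < -(n : ℝ)) :
    ∫⁻ x in (Metric.ball (0 : E n) 1)ᶜ, ENNReal.ofReal (‖x‖ ^ a) < ∞ := by
  have h := integrable_one_add_norm (E := E n) (μ := volume) (r := -a)
    (by rw [finrank_euclideanSpace, Fintype.card_fin]; linarith)
  have h2 := (h.const_mul ((2 : ℝ) ^ (-a))).lintegral_lt_top
  refine lt_of_le_of_lt ?_ h2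
  refine (setLIntegral_mono_ae' measurableSet_ball.compl
    (Filter.Eventually.of_forall ?_)).trans (setLIntegral_le_lintegral _ _)
  intro x hx
  have hx1 : 1 ≤ ‖x‖ := by simpa using hx
  refine ENNReal.ofReal_le_ofReal ?_
  rw [neg_neg]
  -- Outside the unit ball `(1 + ‖x‖) / 2 ≤ ‖x‖`, and the exponent is nonpositive; this is the
  -- origin of the factor `2 ^ (-a)`.
  have : (2 : ℝ) ^ (-a) * (1 + ‖x‖) ^ a = ((1 + ‖x‖) / 2) ^ a := by
    rw [Real.div_rpow (by positivity) (by norm_num), Real.rpow_neg (by norm_num)]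
    field_simp
  rw [this]
  exact Real.rpow_le_rpow_of_nonpos (by positivity) (by linarith) ha0

/-! ### The symbol of the Gagliardo seminorm -/

/-- The symbol `∫ |e^{2πi h·ξ} - 1|² |h|^{-n-2s} dh`. -/
def gagSymbol (n : ℕ) (s : ℝ) (ξ : E n) : ℝ≥0∞ :=
  ∫⁻ h : E n, ‖(Real.fourierChar ⟪h, ξ⟫ : ℂ) - 1‖ₑ ^ 2 * ENNReal.ofReal (‖h‖ ^ (-(n + 2 * s)))

theorem gagSymbol_smul {n : ℕ} (s : ℝ) {t : ℝ} (ht : 0 < t) (ξ : E n) :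
    gagSymbol n s (t • ξ) = ENNReal.ofReal (t ^ (2 * s)) * gagSymbol n s ξ := by
  have h := lintegral_comp_smul_pos (fun h : E n => ‖(Real.fourierChar ⟪h, ξ⟫ : ℂ) - 1‖ₑ ^ 2 *
    ENNReal.ofReal (‖h‖ ^ (-(n + 2 * s)))) ht
  have h2 : ∀ h : E n, ‖(Real.fourierChar ⟪t • h, ξ⟫ : ℂ) - 1‖ₑ ^ 2 *
      ENNReal.ofReal (‖t • h‖ ^ (-(n + 2 * s))) = ENNReal.ofReal (t ^ (-(n + 2 * s))) *
      (‖(Real.fourierChar ⟪h, t • ξ⟫ : ℂ) - 1‖ₑ ^ 2 *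
      ENNReal.ofReal (‖h‖ ^ (-(n + 2 * s)))) := by
    intro h
    rw [real_inner_smul_left, real_inner_smul_right, norm_smul, Real.norm_eq_abs, abs_of_pos ht,
      Real.mul_rpow ht.le (norm_nonneg _), ENNReal.ofReal_mul (by positivity)]
    ring
  simp_rw [h2] at h
  rw [lintegral_const_mul' _ _ ENNReal.ofReal_ne_top] at h
  have h3 : ENNReal.ofReal (t ^ (n + 2 * s)) * ENNReal.ofReal (t ^ (-(n + 2 * s))) = 1 := by
    rw [← ENNReal.ofReal_mul (by positivity), ← Real.rpow_add ht]; simp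
  have h4 : ENNReal.ofReal (t ^ (n + 2 * s)) * ENNReal.ofReal (t ^ (-(n : ℝ))) =
      ENNReal.ofReal (t ^ (2 * s)) := by
    rw [← ENNReal.ofReal_mul (by positivity), ← Real.rpow_add ht]; congr 2; ring
  have h5 := congrArg (fun z => ENNReal.ofReal (t ^ (n + 2 * s)) * z) h
  simp only [← mul_assoc] at h5
  rw [h3, h4, one_mul] at h5
  exact h5

theorem gagSymbol_isometry {n : ℕ} (s : ℝ) (R : E n ≃ₗᵢ[ℝ] E n) (ξ : E n) :
    gagSymbol n s (R ξ) = gagSymbol n s ξ := by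
  unfold gagSymbol
  rw [← lintegral_comp_isometry _ R]
  simp only [R.inner_map_map, R.norm_map]

/-- Homogeneity of degree `2s` and invariance under isometries determine the symbol from one value;
the isometry used is the reflection carrying `‖ξ‖ • e` to `ξ`. -/
theorem gagSymbol_eq {n : ℕ} {s : ℝ} (hs : 0 < s) {e : E n} (he : ‖e‖ = 1) (ξ : E n) :
    gagSymbol n s ξ = ENNReal.ofReal (‖ξ‖ ^ (2 * s)) * gagSymbol n s e := by
  by_cases hξ : ξ = 0
  · subst hξ
    rw [norm_zero, Real.zero_rpow (by positivity), ENNReal.ofReal_zero, zero_mul]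
    simp [gagSymbol]
  · have hpos : 0 < ‖ξ‖ := norm_pos_iff.2 hξ
    rw [← gagSymbol_smul s hpos]
    have h := Submodule.reflection_sub (v := ‖ξ‖ • e) (w := ξ) (by simp [norm_smul, he])
    conv_lhs => rw [← h]
    exact gagSymbol_isometry s _ _

/-- The character differs from `1` by at most `2π|h|` and by at most `2`. The first bound gives
integrability near the origin because `s < 1`, the second at infinity because `s > 0`. -/
theorem gagSymbol_lt_top {n : ℕ} (hn : 1 ≤ n) {s : ℝ} (hs0 : 0 < s) (hs1 : s < 1) {e : E n}
    (he : ‖e‖ = 1) : gagSymbol n s e < ∞ := by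
  unfold gagSymbol
  rw [← lintegral_add_compl _ (measurableSet_ball (x := (0 : E n)) (ε := 1))]
  refine ENNReal.add_lt_top.2 ⟨?_, ?_⟩
  · have h := lintegral_ball_rpow_norm_lt_top hn (a := 2 - (n + 2 * s)) (by linarith)
    refine lt_of_le_of_lt (b := ∫⁻ x in Metric.ball (0 : E n) 1, ENNReal.ofReal ((2 * Real.pi) ^ 2) *
      ENNReal.ofReal (‖x‖ ^ (2 - (n + 2 * s)))) ?_ ?_
    · refine lintegral_mono fun x => ?_
      by_cases hx : x = 0
      · subst hx; simp
      have hx : 0 < ‖x‖ := norm_pos_iff.2 hx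
      have h1 : ‖(Real.fourierChar ⟪x, e⟫ : ℂ) - 1‖ ≤ 2 * Real.pi * ‖x‖ := by
        rw [Real.fourierChar_apply, mul_comm]
        refine (Real.norm_exp_I_mul_ofReal_sub_one_le).trans ?_
        rw [norm_mul, Real.norm_of_nonneg (by positivity)]
        gcongr
        simpa [he] using norm_inner_le_norm (𝕜 := ℝ) x e
      rw [← ofReal_norm, ← ENNReal.ofReal_pow (norm_nonneg _),
        ← ENNReal.ofReal_mul (by positivity), ← ENNReal.ofReal_mul (by positivity)]
      refine ENNReal.ofReal_le_ofReal ?_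
      have h2 : ‖x‖ ^ (2 - ((n : ℝ) + 2 * s)) = ‖x‖ ^ 2 * ‖x‖ ^ (-((n : ℝ) + 2 * s)) := by
        rw [← Real.rpow_two, ← Real.rpow_add hx, sub_eq_add_neg]
      rw [h2, ← mul_assoc, ← mul_pow]
      gcongr
    · rw [lintegral_const_mul' _ _ ENNReal.ofReal_ne_top]
      exact ENNReal.mul_lt_top ENNReal.ofReal_lt_top h
  · have h := lintegral_compl_ball_rpow_norm_lt_top (n := n) (a := -(n + 2 * s))
      (by have : (0 : ℝ) ≤ n := by positivity
          linarith) (by linarith)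
    refine lt_of_le_of_lt (b := ∫⁻ x in (Metric.ball (0 : E n) 1)ᶜ, ENNReal.ofReal (2 ^ 2) *
      ENNReal.ofReal (‖x‖ ^ (-(n + 2 * s)))) ?_ ?_
    · refine lintegral_mono fun x => ?_
      have h1 : ‖(Real.fourierChar ⟪x, e⟫ : ℂ) - 1‖ ≤ 2 := by
        refine (norm_sub_le _ _).trans ?_
        simp only [Circle.norm_coe, norm_one]
        norm_num
      gcongr
      rw [← ofReal_norm, ← ENNReal.ofReal_pow (norm_nonneg _)]
      exact ENNReal.ofReal_le_ofReal (by gcongr)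
    · rw [lintegral_const_mul' _ _ ENNReal.ofReal_ne_top]
      exact ENNReal.mul_lt_top ENNReal.ofReal_lt_top h

theorem measurable_gagIntegrand {n : ℕ} (s : ℝ) (ξ : E n) :
    Measurable fun h : E n => ‖(Real.fourierChar ⟪h, ξ⟫ : ℂ) - 1‖ₑ ^ 2 *
      ENNReal.ofReal (‖h‖ ^ (-(n + 2 * s))) := by
  have h1 : Continuous fun h : E n => (Real.fourierChar ⟪h, ξ⟫ : ℂ) := by
    have := Real.continuous_fourierChar
    fun_prop
  have h2 := h1.measurable
  fun_prop

/-- The character equals `1` only where `⟪h, e⟫` is an integer, so the integrand is positive on the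
nonempty open strip `0 < ⟪h, e⟫ < 1`. -/
theorem gagSymbol_ne_zero {n : ℕ} {s : ℝ} {e : E n} (he : ‖e‖ = 1) : gagSymbol n s e ≠ 0 := by
  intro h
  unfold gagSymbol at h
  rw [lintegral_eq_zero_iff (measurable_gagIntegrand s e)] at h
  set U : Set (E n) := {h | 0 < ⟪h, e⟫ ∧ ⟪h, e⟫ < 1} with hU
  have hUo : IsOpen U := by
    have h1 : Continuous fun h : E n => ⟪h, e⟫ := by fun_prop
    exact (isOpen_lt continuous_const h1).inter (isOpen_lt h1 continuous_const)
  have hUne : U.Nonempty := by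
    refine ⟨(2⁻¹ : ℝ) • e, ?_⟩
    simp only [hU, Set.mem_ofPred_eq, real_inner_smul_left, real_inner_self_eq_norm_sq, he]
    norm_num
  have hpos := hUo.measure_pos volume hUne
  refine hpos.ne' (measure_mono_null ?_ (ae_iff.1 h))
  rintro x ⟨hx0, hx1⟩ hx
  have hxne : x ≠ 0 := by rintro rfl; simp at hx0
  have hxp : 0 < ‖x‖ ^ (-((n : ℝ) + 2 * s)) := Real.rpow_pos_of_pos (norm_pos_iff.2 hxne) _
  simp only [Pi.zero_apply, mul_eq_zero, ENNReal.ofReal_eq_zero, not_le.2 hxp, or_false,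
    pow_eq_zero_iff, ne_eq, OfNat.ofNat_ne_zero, not_false_eq_true, enorm_eq_zero, sub_eq_zero] at hx
  rw [Real.fourierChar_apply, Complex.exp_eq_one_iff] at hx
  obtain ⟨k, hk⟩ := hx
  have hk2 : ⟪x, e⟫ = k := by
    have h3 : (2 * Real.pi * Complex.I : ℂ) ≠ 0 := Complex.two_pi_I_ne_zero
    have h4 : (2 * Real.pi * Complex.I : ℂ) * (⟪x, e⟫ : ℝ) = (2 * Real.pi * Complex.I : ℂ) * k := by
      rw [mul_comm _ (k : ℂ), ← hk]; push_cast; ring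
    have h5 := mul_left_cancel₀ h3 h4
    exact_mod_cast h5
  rw [hk2] at hx0 hx1
  have h6 : (0 : ℤ) < k := by exact_mod_cast hx0
  have h7 : k < (1 : ℤ) := by exact_mod_cast hx1
  omega

/-! ### The Gagliardo seminorm -/

/-- The square of the Gagliardo seminorm, `∫∫ |u(x) - u(y)|² / |x - y|^{n+2s} dx dy`. -/
def gagliardo (n : ℕ) (s : ℝ) (u : E n → ℂ) : ℝ≥0∞ :=
  ∫⁻ z : E n × E n, ‖u z.1 - u z.2‖ₑ ^ 2 * ENNReal.ofReal (‖z.2 - z.1‖ ^ (-(n + 2 * s)))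

theorem fourier_compSubConst {n : ℕ} (φ : 𝓢(E n, ℂ)) (a ξ : E n) :
    (𝓕 (φ.compSubConstCLM ℂ (-a)) : 𝓢(E n, ℂ)) ξ =
      (Real.fourierChar ⟪a, ξ⟫ : ℂ) * (𝓕 φ : 𝓢(E n, ℂ)) ξ := by
  have h := congrFun (VectorFourier.fourierIntegral_comp_add_right Real.fourierChar
    (volume : Measure (E n)) (innerₗ (E n)) φ a) ξ
  rw [SchwartzMap.fourier_coe, SchwartzMap.fourier_coe]
  have h2 : ⇑(φ.compSubConstCLM ℂ (-a)) = ⇑φ ∘ fun v => v + a := by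
    ext x; simp [SchwartzMap.compSubConstCLM_apply]
  rw [h2]
  simp only [Circle.smul_def, smul_eq_mul, innerₗ_apply_apply] at h
  exact h

theorem lintegral_diff_sq {n : ℕ} (φ : 𝓢(E n, ℂ)) (h : E n) :
    ∫⁻ x, ‖φ x - φ (x + h)‖ₑ ^ 2 =
      ∫⁻ ξ, ‖(Real.fourierChar ⟪h, ξ⟫ : ℂ) - 1‖ₑ ^ 2 * ‖(𝓕 φ : 𝓢(E n, ℂ)) ξ‖ₑ ^ 2 := by
  have h1 := lintegral_enorm_fourier_sq (φ.compSubConstCLM ℂ (-h) - φ)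
  have h2 : ∀ x, ‖(φ.compSubConstCLM ℂ (-h) - φ) x‖ₑ = ‖φ x - φ (x + h)‖ₑ := by
    intro x
    rw [← enorm_neg]
    simp [SchwartzMap.compSubConstCLM_apply]
  simp_rw [h2] at h1
  rw [← h1]
  refine lintegral_congr fun ξ => ?_
  have h3 : (𝓕 (φ.compSubConstCLM ℂ (-h) - φ) : 𝓢(E n, ℂ)) =
      𝓕 (φ.compSubConstCLM ℂ (-h)) - 𝓕 φ :=
    map_sub (fourierEquiv ℂ 𝓢(E n, ℂ)) _ _
  rw [h3, sub_apply, fourier_compSubConst, ← mul_pow, ← enorm_mul]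
  congr 2
  ring

/-- Substitute `y = x + h`, apply Plancherel in `x` for fixed `h`, where translation becomes
modulation, and then integrate in `h` first. -/
theorem gagliardo_schwartz {n : ℕ} (s : ℝ) (φ : 𝓢(E n, ℂ)) :
    gagliardo n s φ = ∫⁻ ξ, gagSymbol n s ξ * ‖(𝓕 φ : 𝓢(E n, ℂ)) ξ‖ₑ ^ 2 := by
  have hφ := φ.continuous.measurable
  have hφ' := (𝓕 φ : 𝓢(E n, ℂ)).continuous.measurable
  have hch : Measurable fun p : E n × E n => (Real.fourierChar ⟪p.1, p.2⟫ : ℂ) := by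
    have := Real.continuous_fourierChar
    exact (by fun_prop : Continuous fun p : E n × E n =>
      (Real.fourierChar ⟪p.1, p.2⟫ : ℂ)).measurable
  unfold gagliardo
  rw [Measure.volume_eq_prod, lintegral_prod _ (by fun_prop)]
  have h1 : ∀ x : E n, ∫⁻ y, ‖φ x - φ y‖ₑ ^ 2 * ENNReal.ofReal (‖y - x‖ ^ (-(n + 2 * s))) =
      ∫⁻ h, ‖φ x - φ (x + h)‖ₑ ^ 2 * ENNReal.ofReal (‖h‖ ^ (-(n + 2 * s))) := by
    intro x
    rw [← lintegral_add_left_eq_self _ x]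
    simp only [add_sub_cancel_left]
  simp_rw [h1]
  rw [lintegral_lintegral_swap (by fun_prop)]
  simp_rw [lintegral_mul_const' _ _ ENNReal.ofReal_ne_top, lintegral_diff_sq,
    ← lintegral_mul_const' _ _ ENNReal.ofReal_ne_top]
  rw [lintegral_lintegral_swap (by fun_prop)]
  refine lintegral_congr fun ξ => ?_
  rw [gagSymbol, ← lintegral_mul_const' _ _ (by simp)]
  refine lintegral_congr fun h => ?_
  ring

/-- The Gagliardo seminorm of a Schwartz function is the `L²` norm of `|ξ|ˢ φ̂` up to a constant. -/
theorem exists_gagliardo_const {n : ℕ} (hn : 1 ≤ n) {s : ℝ} (hs0 : 0 < s) (hs1 : s < 1) :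
    ∃ c : ℝ≥0∞, c ≠ 0 ∧ c ≠ ∞ ∧ ∀ φ : 𝓢(E n, ℂ), gagliardo n s φ =
      c * ∫⁻ ξ, ENNReal.ofReal (‖ξ‖ ^ (2 * s)) * ‖(𝓕 φ : 𝓢(E n, ℂ)) ξ‖ₑ ^ 2 := by
  set e : E n := EuclideanSpace.single ⟨0, hn⟩ 1
  have he : ‖e‖ = 1 := by simp [e]
  refine ⟨gagSymbol n s e, gagSymbol_ne_zero he, (gagSymbol_lt_top hn hs0 hs1 he).ne, ?_⟩
  intro φ
  rw [gagliardo_schwartz, ← lintegral_const_mul' _ _ (gagSymbol_lt_top hn hs0 hs1 he).ne]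
  refine lintegral_congr fun ξ => ?_
  rw [gagSymbol_eq hs0 he ξ]
  ring

end FMSE

end

noncomputable section

namespace FMSE

open MeasureTheory TemperedDistribution FourierTransform Filter Topology Module
open scoped SchwartzMap ENNReal RealInnerProductSpace

/-! ### The fractional Sobolev inequality -/

/-- A smooth cutoff in frequency, equal to `1` on the ball of radius `R` and supported in twice that
ball. The low part is bounded pointwise by Fourier inversion, the high part in `L²` by Plancherel.
-/
theorem exists_low_high {n : ℕ} (φ : 𝓢(E n, ℂ)) {R : ℝ} (hR : 0 < R) :
    ∃ a b : 𝓢(E n, ℂ), φ = a + b ∧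
      (∀ x, ‖a x‖ₑ ≤ ∫⁻ ξ in Metric.ball 0 (2 * R), ‖(𝓕 φ : 𝓢(E n, ℂ)) ξ‖ₑ) ∧
      ∫⁻ x, ‖b x‖ₑ ^ 2 ≤ ∫⁻ ξ in (Metric.ball 0 R)ᶜ, ‖(𝓕 φ : 𝓢(E n, ℂ)) ξ‖ₑ ^ 2 := by
  let χ : ContDiffBump (0 : E n) := ⟨R, 2 * R, hR, by linarith⟩
  have hχ1 : ∀ x ∈ Metric.ball (0 : E n) R, χ x = 1 := fun x hx =>
    χ.one_of_mem_closedBall (Metric.ball_subset_closedBall hx)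
  have hχ0 : ∀ x, x ∉ Metric.ball (0 : E n) (2 * R) → χ x = 0 := fun x hx =>
    χ.zero_of_le_dist (by simpa using hx)
  have htg : (χ : E n → ℝ).HasTemperateGrowth := χ.hasCompactSupport.hasTemperateGrowth χ.contDiff
  set a : 𝓢(E n, ℂ) := SchwartzMap.fourierMultiplierCLM ℂ (χ : E n → ℝ) φ with ha
  have haF : ∀ ξ, (𝓕 a : 𝓢(E n, ℂ)) ξ = (χ ξ : ℂ) * (𝓕 φ : 𝓢(E n, ℂ)) ξ := by
    intro ξ
    rw [ha, SchwartzMap.fourierMultiplierCLM_apply, fourier_fourierInv_eq,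
      SchwartzMap.smulLeftCLM_apply_apply htg]
    simp
  refine ⟨a, φ - a, by simp, ?_, ?_⟩
  · intro x
    have h1 : a x = (𝓕⁻ (𝓕 a : 𝓢(E n, ℂ)) : 𝓢(E n, ℂ)) x := by rw [fourierInv_fourier_eq]
    rw [h1, SchwartzMap.fourierInv_coe, Real.fourierInv_eq]
    refine (enorm_integral_le_lintegral_enorm _).trans ?_
    rw [← lintegral_indicator measurableSet_ball]
    refine lintegral_mono fun ξ => ?_
    rw [← ofReal_norm, Circle.norm_smul, ofReal_norm, haF]
    by_cases hξ : ξ ∈ Metric.ball (0 : E n) (2 * R)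
    · rw [Set.indicator_of_mem hξ, enorm_mul]
      refine mul_le_of_le_one_left zero_le ?_
      rw [← ofReal_norm, Complex.norm_real, Real.norm_of_nonneg χ.nonneg]
      exact ENNReal.ofReal_le_one.2 χ.le_one
    · simp [hχ0 ξ hξ]
  · rw [← lintegral_enorm_fourier_sq, ← lintegral_indicator measurableSet_ball.compl]
    refine lintegral_mono fun ξ => ?_
    have h3 : (𝓕 (φ - a) : 𝓢(E n, ℂ)) = 𝓕 φ - 𝓕 a :=
      map_sub (fourierEquiv ℂ 𝓢(E n, ℂ)) _ _
    rw [h3, sub_apply, haF]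
    by_cases hξ : ξ ∈ Metric.ball (0 : E n) R
    · simp [hχ1 ξ hξ]
    · rw [Set.indicator_of_mem (by exact hξ)]
      have h4 : (𝓕 φ : 𝓢(E n, ℂ)) ξ - (χ ξ : ℂ) * (𝓕 φ : 𝓢(E n, ℂ)) ξ =
          ((1 - χ ξ : ℝ) : ℂ) * (𝓕 φ : 𝓢(E n, ℂ)) ξ := by push_cast; ring
      rw [h4, enorm_mul, mul_pow]
      refine mul_le_of_le_one_left zero_le ?_
      refine pow_le_one₀ zero_le ?_
      rw [← ofReal_norm, Complex.norm_real, Real.norm_of_nonneg (by linarith [χ.le_one (x := ξ)])]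
      exact ENNReal.ofReal_le_one.2 (by linarith [χ.nonneg (x := ξ)])

/-- The square of the homogeneous Sobolev norm of order `σ`. -/
def homSobolev {n : ℕ} (σ : ℝ) (φ : 𝓢(E n, ℂ)) : ℝ≥0∞ :=
  ∫⁻ ξ, ENNReal.ofReal (‖ξ‖ ^ (2 * σ)) * ‖(𝓕 φ : 𝓢(E n, ℂ)) ξ‖ₑ ^ 2

theorem setLIntegral_ball_rpow_norm {n : ℕ} (a : ℝ) {R : ℝ} (hR : 0 < R) :
    ∫⁻ ξ in Metric.ball (0 : E n) R, ENNReal.ofReal (‖ξ‖ ^ a) =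
      ENNReal.ofReal (R ^ (n + a)) *
        ∫⁻ ξ in Metric.ball (0 : E n) 1, ENNReal.ofReal (‖ξ‖ ^ a) := by
  have h := lintegral_comp_smul_pos
    (fun ξ : E n => (Metric.ball (0 : E n) R).indicator (fun ξ => ENNReal.ofReal (‖ξ‖ ^ a)) ξ) hR
  rw [lintegral_indicator measurableSet_ball] at h
  have h1 : ∀ x : E n, (Metric.ball (0 : E n) R).indicator (fun ξ => ENNReal.ofReal (‖ξ‖ ^ a))
      (R • x) = ENNReal.ofReal (R ^ a) *
      (Metric.ball (0 : E n) 1).indicator (fun ξ => ENNReal.ofReal (‖ξ‖ ^ a)) x := by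
    intro x
    have h2 : R • x ∈ Metric.ball (0 : E n) R ↔ x ∈ Metric.ball (0 : E n) 1 := by
      simp only [mem_ball_zero_iff, norm_smul, Real.norm_of_nonneg hR.le]
      exact mul_lt_iff_lt_one_right hR
    by_cases hx : x ∈ Metric.ball (0 : E n) 1
    · rw [Set.indicator_of_mem hx, Set.indicator_of_mem (h2.2 hx), norm_smul,
        Real.norm_of_nonneg hR.le, Real.mul_rpow hR.le (norm_nonneg _),
        ENNReal.ofReal_mul (by positivity)]
    · rw [Set.indicator_of_notMem hx, Set.indicator_of_notMem (mt h2.1 hx), mul_zero]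
  simp_rw [h1] at h
  rw [lintegral_const_mul' _ _ ENNReal.ofReal_ne_top, lintegral_indicator measurableSet_ball] at h
  have h3 : ENNReal.ofReal (R ^ (n : ℝ)) * ENNReal.ofReal (R ^ (-(n : ℝ))) = 1 := by
    rw [← ENNReal.ofReal_mul (by positivity), ← Real.rpow_add hR]; simp
  rw [Real.rpow_add hR, ENNReal.ofReal_mul (by positivity), mul_assoc, h, ← mul_assoc, h3, one_mul]

/-- Cauchy–Schwarz after inserting `‖ξ‖ ^ (-σ) * ‖ξ‖ ^ σ`; the weight `‖ξ‖ ^ (-2σ)` is integrable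
near the origin precisely because `σ < n / 2`, and scaling yields the power of `R`. -/
theorem exists_low_bound {n : ℕ} (hn : 1 ≤ n) {σ : ℝ} (hσ : σ < n / 2) :
    ∃ c : ℝ, 0 < c ∧ ∀ φ : 𝓢(E n, ℂ), homSobolev σ φ ≤ 1 → ∀ R > 0,
      ∫⁻ ξ in Metric.ball 0 (2 * R), ‖(𝓕 φ : 𝓢(E n, ℂ)) ξ‖ₑ ≤
        ENNReal.ofReal (c * R ^ ((n : ℝ) / 2 - σ)) := by
  have hI := lintegral_ball_rpow_norm_lt_top hn (a := -(2 * σ)) (by linarith)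
  set I := ∫⁻ ξ in Metric.ball (0 : E n) 1, ENNReal.ofReal (‖ξ‖ ^ (-(2 * σ))) with hIdef
  refine ⟨2 ^ ((n : ℝ) / 2 - σ) * (I.toReal + 1) ^ (2⁻¹ : ℝ), by positivity, ?_⟩
  intro φ hφ R hR
  have hne : ∀ᵐ ξ ∂(volume.restrict (Metric.ball (0 : E n) (2 * R))), ξ ≠ 0 := by
    have : Nonempty (Fin n) := ⟨⟨0, hn⟩⟩
    refine ae_restrict_of_ae ?_
    rw [ae_iff]
    simp
  have h1 : ∫⁻ ξ in Metric.ball 0 (2 * R), ‖(𝓕 φ : 𝓢(E n, ℂ)) ξ‖ₑ =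
      ∫⁻ ξ in Metric.ball 0 (2 * R), ((fun ξ : E n => ENNReal.ofReal (‖ξ‖ ^ (-σ))) *
        fun ξ => ENNReal.ofReal (‖ξ‖ ^ σ) * ‖(𝓕 φ : 𝓢(E n, ℂ)) ξ‖ₑ) ξ := by
    refine lintegral_congr_ae ?_
    filter_upwards [hne] with ξ hξ
    have hξ' : 0 < ‖ξ‖ := norm_pos_iff.2 hξ
    rw [Pi.mul_apply, ← mul_assoc, ← ENNReal.ofReal_mul (by positivity), ← Real.rpow_add hξ']
    simp
  have hm := (𝓕 φ : 𝓢(E n, ℂ)).continuous.measurable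
  rw [h1]
  refine (ENNReal.lintegral_mul_le_Lp_mul_Lq _ Real.HolderConjugate.two_two
    (by fun_prop) (by fun_prop)).trans ?_
  have h2 : ∫⁻ ξ in Metric.ball (0 : E n) (2 * R), ENNReal.ofReal (‖ξ‖ ^ (-σ)) ^ (2 : ℝ) =
      ENNReal.ofReal ((2 * R) ^ (n + (-(2 * σ)))) * I := by
    rw [hIdef, ← setLIntegral_ball_rpow_norm _ (by positivity)]
    refine lintegral_congr fun ξ => ?_
    rw [ENNReal.ofReal_rpow_of_nonneg (by positivity) (by norm_num),
      ← Real.rpow_mul (norm_nonneg _)]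
    congr 2; ring
  have h3 : ∫⁻ ξ in Metric.ball (0 : E n) (2 * R),
      (ENNReal.ofReal (‖ξ‖ ^ σ) * ‖(𝓕 φ : 𝓢(E n, ℂ)) ξ‖ₑ) ^ (2 : ℝ) ≤ 1 := by
    refine (setLIntegral_le_lintegral _ _).trans ((le_of_eq ?_).trans hφ)
    refine lintegral_congr fun ξ => ?_
    rw [ENNReal.mul_rpow_of_nonneg _ _ (by norm_num),
      ENNReal.ofReal_rpow_of_nonneg (by positivity) (by norm_num),
      ← Real.rpow_mul (norm_nonneg _), ENNReal.rpow_two]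
    congr 3; ring
  rw [h2]
  have h4 : (∫⁻ ξ in Metric.ball (0 : E n) (2 * R),
      (ENNReal.ofReal (‖ξ‖ ^ σ) * ‖(𝓕 φ : 𝓢(E n, ℂ)) ξ‖ₑ) ^ (2 : ℝ)) ^ (1 / 2 : ℝ) ≤ 1 :=
    (ENNReal.rpow_le_rpow h3 (by norm_num)).trans (by simp)
  refine (mul_le_mul' le_rfl h4).trans ?_
  rw [mul_one]
  have h5 : I ≤ ENNReal.ofReal (I.toReal + 1) := by
    rw [ENNReal.le_ofReal_iff_toReal_le hI.ne (by positivity)]; linarith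
  refine (ENNReal.rpow_le_rpow (mul_le_mul' le_rfl h5) (by norm_num)).trans ?_
  rw [← ENNReal.ofReal_mul (by positivity),
    ENNReal.ofReal_rpow_of_nonneg (by positivity) (by norm_num)]
  refine ENNReal.ofReal_le_ofReal (le_of_eq ?_)
  rw [Real.mul_rpow (by positivity) (by positivity), ← Real.rpow_mul (by positivity),
    Real.mul_rpow (by norm_num) hR.le]
  have h6 : ((n : ℝ) + -(2 * σ)) * (1 / 2) = n / 2 - σ := by ring
  rw [h6]
  norm_num
  ring

theorem lintegral_Ioc_rpow {b : ℝ} (hb : -1 < b) {T : ℝ} (hT : 0 ≤ T) :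
    ∫⁻ t in Set.Ioc 0 T, ENNReal.ofReal (t ^ b) = ENNReal.ofReal (T ^ (b + 1) / (b + 1)) := by
  have hi : IntervalIntegrable (fun t : ℝ => t ^ b) volume 0 T :=
    intervalIntegral.intervalIntegrable_rpow' hb
  rw [← ofReal_integral_eq_lintegral_ofReal]
  · rw [← intervalIntegral.integral_of_le hT, integral_rpow (Or.inl hb),
      Real.zero_rpow (by linarith), sub_zero]
  · exact (intervalIntegrable_iff_integrableOn_Ioc_of_le hT).1 hi
  · filter_upwards [ae_restrict_mem measurableSet_Ioc] with t ht
    exact Real.rpow_nonneg ht.1.le _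

/-- The fractional Sobolev inequality `‖φ‖_{L^m} ≤ C ‖φ‖_{Ḣ^σ}` with `m = 2n / (n - 2σ)`. -/
theorem exists_sobolev_const {n : ℕ} (hn : 1 ≤ n) {σ : ℝ} (hσ0 : 0 < σ) (hσ : σ < n / 2) :
    ∃ C : ℝ≥0∞, C ≠ ∞ ∧ ∀ φ : 𝓢(E n, ℂ), homSobolev σ φ ≤ 1 →
      ∫⁻ x, ‖φ x‖ₑ ^ (2 * n / (n - 2 * σ)) ≤ C := by
  obtain ⟨c, hc, hlow⟩ := exists_low_bound hn hσ
  set m : ℝ := 2 * n / (n - 2 * σ) with hm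
  set β : ℝ := (n : ℝ) / 2 - σ with hβ
  have hn0 : (0 : ℝ) < n := by exact_mod_cast hn
  have hβ0 : 0 < β := by rw [hβ]; linarith
  have hd : 0 < n - 2 * σ := by linarith
  have hm2 : 2 < m := by rw [hm, lt_div_iff₀ hd]; linarith
  -- This identity is why `m` is the right exponent: integrating the level-set bound in `t` produces
  -- exactly the weight `‖ξ‖ ^ (2σ)`.
  have hmβ : β * (m - 2) = 2 * σ := by rw [hβ, hm]; field_simp; ring
  refine ⟨ENNReal.ofReal m * (ENNReal.ofReal 4 * ENNReal.ofReal ((2 * c) ^ (m - 2) / (m - 2))),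
    by finiteness, ?_⟩
  intro φ hφ
  have hφm := φ.continuous.measurable
  have hFm := (𝓕 φ : 𝓢(E n, ℂ)).continuous.measurable
  have hlevel : ∀ t ∈ Set.Ioi (0 : ℝ), volume {x | t < ‖φ x‖} * ENNReal.ofReal (t ^ (m - 1)) ≤
      ∫⁻ ξ, ({p : ℝ × E n | p.1 ≤ 2 * c * ‖p.2‖ ^ β}).indicator (fun p =>
        ENNReal.ofReal 4 * ENNReal.ofReal (p.1 ^ (m - 3)) *
          ‖(𝓕 φ : 𝓢(E n, ℂ)) p.2‖ₑ ^ 2) (t, ξ) := by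
    intro t ht
    have ht : 0 < t := ht
    -- The cutoff depends on the level: `R` makes the low-frequency part at most `t / 2` everywhere,
    -- so `|φ| > t` forces `|b| ≥ t / 2` for the high part, and Chebyshev applies to `b`. The factor
    -- `4` comes from the level `t / 2`.
    set R : ℝ := (t / (2 * c)) ^ (β⁻¹) with hR
    have hR0 : 0 < R := by positivity
    have hRβ : c * R ^ β = t / 2 := by
      rw [hR, ← Real.rpow_mul (by positivity), inv_mul_cancel₀ hβ0.ne', Real.rpow_one]
      field_simp
    obtain ⟨a, b, hab, ha, hb⟩ := exists_low_high φ hR0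
    have ha' : ∀ x, ‖a x‖ ≤ t / 2 := by
      intro x
      have h1 := (ha x).trans (hlow φ hφ R hR0)
      rw [hRβ, ← ofReal_norm, ENNReal.ofReal_le_ofReal_iff (by positivity)] at h1
      exact h1
    have hsub : volume {x | t < ‖φ x‖} ≤ volume {x | ENNReal.ofReal ((t / 2) ^ 2) ≤ ‖b x‖ₑ ^ 2} := by
      refine measure_mono fun x hx => ?_
      have hx : t < ‖φ x‖ := hx
      rw [hab, add_apply] at hx
      have h2 := norm_add_le (a x) (b x)
      have h3 := ha' x
      have h4 : t / 2 ≤ ‖b x‖ := by linarith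
      rw [Set.mem_ofPred_eq, ← ofReal_norm, ← ENNReal.ofReal_pow (norm_nonneg _)]
      exact ENNReal.ofReal_le_ofReal (by gcongr)
    have hcheb := mul_meas_ge_le_lintegral₀ (μ := (volume : Measure (E n)))
      (f := fun x => ‖b x‖ₑ ^ 2) (by have := b.continuous.measurable; fun_prop)
      (ENNReal.ofReal ((t / 2) ^ 2))
    have hexp : ENNReal.ofReal (t ^ (m - 1)) = ENNReal.ofReal 4 * ENNReal.ofReal (t ^ (m - 3)) *
        ENNReal.ofReal ((t / 2) ^ 2) := by
      rw [← ENNReal.ofReal_mul (by norm_num), ← ENNReal.ofReal_mul (by positivity)]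
      congr 1
      have h5 : t ^ (m - 1) = t ^ (m - 3) * t ^ 2 := by
        rw [← Real.rpow_two, ← Real.rpow_add ht]; congr 1; ring
      rw [h5]; ring
    calc volume {x | t < ‖φ x‖} * ENNReal.ofReal (t ^ (m - 1))
        ≤ volume {x | ENNReal.ofReal ((t / 2) ^ 2) ≤ ‖b x‖ₑ ^ 2} * ENNReal.ofReal (t ^ (m - 1)) :=
          mul_le_mul' hsub le_rfl
      _ = ENNReal.ofReal 4 * ENNReal.ofReal (t ^ (m - 3)) * (ENNReal.ofReal ((t / 2) ^ 2) *
            volume {x | ENNReal.ofReal ((t / 2) ^ 2) ≤ ‖b x‖ₑ ^ 2}) := by rw [hexp]; ring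
      _ ≤ ENNReal.ofReal 4 * ENNReal.ofReal (t ^ (m - 3)) *
            ∫⁻ ξ in (Metric.ball 0 R)ᶜ, ‖(𝓕 φ : 𝓢(E n, ℂ)) ξ‖ₑ ^ 2 := by
          gcongr
          exact hcheb.trans hb
      _ = ∫⁻ ξ in (Metric.ball 0 R)ᶜ, ENNReal.ofReal 4 * ENNReal.ofReal (t ^ (m - 3)) *
            ‖(𝓕 φ : 𝓢(E n, ℂ)) ξ‖ₑ ^ 2 := by
          rw [lintegral_const_mul' _ _ (by finiteness)]
      _ ≤ _ := by
          rw [← lintegral_indicator measurableSet_ball.compl]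
          refine lintegral_mono fun ξ => ?_
          by_cases hξ : ξ ∈ (Metric.ball (0 : E n) R)ᶜ
          · have hξ' : R ≤ ‖ξ‖ := by simpa using hξ
            rw [Set.indicator_of_mem hξ, Set.indicator_of_mem]
            have h7 : c * R ^ β ≤ c * ‖ξ‖ ^ β := by gcongr
            change t ≤ 2 * c * ‖ξ‖ ^ β
            rw [hRβ] at h7
            linarith
          · rw [Set.indicator_of_notMem hξ]
            exact zero_le
  have hcake := lintegral_rpow_eq_lintegral_meas_lt_mul (volume : Measure (E n))
    (f := fun x => ‖φ x‖) (Filter.Eventually.of_forall fun x => norm_nonneg _)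
    (by fun_prop) (p := m) (by linarith)
  have h0 : ∫⁻ x, ‖φ x‖ₑ ^ m = ∫⁻ x, ENNReal.ofReal (‖φ x‖ ^ m) := by
    refine lintegral_congr fun x => ?_
    rw [← ENNReal.ofReal_rpow_of_nonneg (norm_nonneg _) (by linarith), ofReal_norm]
  rw [h0, hcake]
  refine mul_le_mul' le_rfl ?_
  refine (setLIntegral_mono_ae' measurableSet_Ioi (Filter.Eventually.of_forall hlevel)).trans ?_
  have hmeas : MeasurableSet {p : ℝ × E n | p.1 ≤ 2 * c * ‖p.2‖ ^ β} :=
    measurableSet_le (by fun_prop) (by fun_prop)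
  have hswap : AEMeasurable (Function.uncurry fun (t : ℝ) (ξ : E n) =>
      ({p : ℝ × E n | p.1 ≤ 2 * c * ‖p.2‖ ^ β}).indicator (fun p =>
        ENNReal.ofReal 4 * ENNReal.ofReal (p.1 ^ (m - 3)) *
          ‖(𝓕 φ : 𝓢(E n, ℂ)) p.2‖ₑ ^ 2) (t, ξ))
      ((volume.restrict (Set.Ioi 0)).prod volume) :=
    ((by fun_prop : Measurable fun p : ℝ × E n =>
      ENNReal.ofReal 4 * ENNReal.ofReal (p.1 ^ (m - 3)) *
        ‖(𝓕 φ : 𝓢(E n, ℂ)) p.2‖ₑ ^ 2).indicator hmeas).aemeasurable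
  -- With the frequency `ξ` fixed, the levels that see it are those with `t ≤ 2c‖ξ‖ ^ β`, and `t ^
  -- (m - 3)` is integrable at zero because `m > 2`.
  rw [lintegral_lintegral_swap hswap]
  have hinner : ∀ ξ : E n, ∫⁻ t in Set.Ioi (0 : ℝ),
      ({p : ℝ × E n | p.1 ≤ 2 * c * ‖p.2‖ ^ β}).indicator (fun p =>
        ENNReal.ofReal 4 * ENNReal.ofReal (p.1 ^ (m - 3)) *
          ‖(𝓕 φ : 𝓢(E n, ℂ)) p.2‖ₑ ^ 2) (t, ξ) =
      ENNReal.ofReal 4 * ENNReal.ofReal ((2 * c) ^ (m - 2) / (m - 2)) *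
        (ENNReal.ofReal (‖ξ‖ ^ (2 * σ)) * ‖(𝓕 φ : 𝓢(E n, ℂ)) ξ‖ₑ ^ 2) := by
    intro ξ
    have h1 : ∀ t : ℝ, ({p : ℝ × E n | p.1 ≤ 2 * c * ‖p.2‖ ^ β}).indicator (fun p =>
        ENNReal.ofReal 4 * ENNReal.ofReal (p.1 ^ (m - 3)) *
          ‖(𝓕 φ : 𝓢(E n, ℂ)) p.2‖ₑ ^ 2) (t, ξ) =
        (Set.Iic (2 * c * ‖ξ‖ ^ β)).indicator (fun t => ENNReal.ofReal 4 *
          ENNReal.ofReal (t ^ (m - 3)) * ‖(𝓕 φ : 𝓢(E n, ℂ)) ξ‖ₑ ^ 2) t := fun t => rfl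
    simp_rw [h1]
    rw [setLIntegral_indicator measurableSet_Iic, Set.inter_comm, Set.Ioi_inter_Iic,
      lintegral_mul_const' _ _ (by finiteness), lintegral_const_mul' _ _ (by finiteness),
      lintegral_Ioc_rpow (by linarith) (by positivity)]
    have h2 : (2 * c * ‖ξ‖ ^ β) ^ (m - 3 + 1) / (m - 3 + 1) =
        (2 * c) ^ (m - 2) / (m - 2) * ‖ξ‖ ^ (2 * σ) := by
      have h3 : m - 3 + 1 = m - 2 := by ring
      rw [h3, Real.mul_rpow (by positivity) (by positivity), ← Real.rpow_mul (norm_nonneg _), hmβ]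
      ring
    rw [h2, ENNReal.ofReal_mul (div_nonneg (by positivity) (by linarith))]
    ring
  simp_rw [hinner]
  rw [lintegral_const_mul' _ _ (by finiteness)]
  exact mul_le_of_le_one_right zero_le hφ

end FMSE

end

noncomputable section

namespace FMSE

open MeasureTheory TemperedDistribution FourierTransform Filter Topology Module
open scoped SchwartzMap ENNReal RealInnerProductSpace

/-! ### Estimates for functions in the Sobolev space -/

/-- Fatou's lemma with converging bounds; it carries estimates from Schwartz functions to all of
`L²`. -/
theorem lintegral_le_of_tendsto_ae {α : Type*} [MeasurableSpace α] {μ : Measure α}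
    {f : ℕ → α → ℝ≥0∞} {h : α → ℝ≥0∞} {c : ℕ → ℝ≥0∞} {C : ℝ≥0∞}
    (hf : ∀ k, AEMeasurable (f k) μ) (hlim : ∀ᵐ x ∂μ, Tendsto (fun k => f k x) atTop (𝓝 (h x)))
    (hle : ∀ k, ∫⁻ x, f k x ∂μ ≤ c k) (hc : Tendsto c atTop (𝓝 C)) : ∫⁻ x, h x ∂μ ≤ C := by
  have h1 : ∫⁻ x, h x ∂μ = ∫⁻ x, liminf (fun k => f k x) atTop ∂μ :=
    lintegral_congr_ae (hlim.mono fun x hx => hx.liminf_eq.symm)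
  rw [h1, ← hc.liminf_eq]
  exact (lintegral_liminf_le' hf).trans (liminf_le_liminf (Eventually.of_forall hle))

/-- Density gives convergence in `L²`, preserved by the bounded operator `besselInv`; a subsequence
of the images converges almost everywhere. -/
theorem exists_schwartz_seq {n : ℕ} {s : ℝ} (hs : 0 ≤ s) (g : L2 n) :
    ∃ γ : ℕ → 𝓢(E n, ℂ), Tendsto (fun k => (toL2 (γ k))) atTop (𝓝 g) ∧
      ∀ᵐ x, Tendsto (fun k => besselInv n hs (toL2 (γ k)) x) atTop
        (𝓝 (besselInv n hs g x)) := by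
  obtain ⟨v, hv, hvlim⟩ := mem_closure_iff_seq_limit.1
    (denseRange_toL2 n g)
  choose γ hγ using hv
  have hγ' : ∀ k, toL2 (γ k) = v k := hγ
  have hlim2 : Tendsto (fun k => besselInv n hs (v k)) atTop (𝓝 (besselInv n hs g)) :=
    ((besselInv n hs).continuous.tendsto g).comp hvlim
  obtain ⟨ns, hns, hae⟩ := (tendstoInMeasure_of_tendsto_Lp hlim2).exists_seq_tendsto_ae
  refine ⟨fun k => γ (ns k), ?_, ?_⟩
  · simp only [hγ']
    exact hvlim.comp hns.tendsto_atTop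
  · simpa only [hγ'] using hae

theorem tendsto_enorm_pow_two {α F : Type*} [NormedAddCommGroup F] {l : Filter α} {v : α → F}
    {a : F} (h : Tendsto v l (𝓝 a)) : Tendsto (fun k => ‖v k‖ₑ ^ 2) l (𝓝 (‖a‖ₑ ^ 2)) :=
  ((ENNReal.continuous_pow 2).tendsto _).comp ((continuous_enorm.tendsto a).comp h)

theorem tendsto_enorm_sq {n : ℕ} {v : ℕ → L2 n} {g : L2 n} (h : Tendsto v atTop (𝓝 g))
    {C : ℝ≥0∞} (hC : C ≠ ∞) : Tendsto (fun k => C * ‖v k‖ₑ ^ 2) atTop (𝓝 (C * ‖g‖ₑ ^ 2)) :=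
  ENNReal.Tendsto.const_mul (tendsto_enorm_pow_two h) (Or.inr hC)

theorem enorm_fourier_sq_of_symbol {n : ℕ} {s : ℝ} {φ g : 𝓢(E n, ℂ)} {ξ : E n}
    (h : (𝓕 φ : 𝓢(E n, ℂ)) ξ = (besselSymbol n s ξ : ℂ) * (𝓕 g : 𝓢(E n, ℂ)) ξ) :
    ENNReal.ofReal ((1 + ‖ξ‖ ^ 2) ^ s) * ‖(𝓕 φ : 𝓢(E n, ℂ)) ξ‖ₑ ^ 2 =
      ‖(𝓕 g : 𝓢(E n, ℂ)) ξ‖ₑ ^ 2 := by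
  have h1 : (0 : ℝ) < 1 + ‖ξ‖ ^ 2 := by positivity
  have h2 : ((1 + ‖ξ‖ ^ 2) ^ s : ℝ) * besselSymbol n s ξ ^ 2 = 1 := by
    rw [besselSymbol, ← Real.rpow_mul_natCast h1.le, ← Real.rpow_add h1]
    have : s + -s / 2 * (2 : ℕ) = 0 := by push_cast; ring
    rw [this, Real.rpow_zero]
  rw [h, enorm_mul, mul_pow, ← mul_assoc, ← ofReal_norm (besselSymbol n s ξ : ℂ),
    Complex.norm_real, Real.norm_of_nonneg (besselSymbol_pos s ξ).le,
    ← ENNReal.ofReal_pow (besselSymbol_pos s ξ).le, ← ENNReal.ofReal_mul (by positivity), h2,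
    ENNReal.ofReal_one, one_mul]

theorem homSobolev_le {n : ℕ} {s σ : ℝ} (hσ0 : 0 ≤ σ) (hσ : σ ≤ s) {φ g : 𝓢(E n, ℂ)}
    (h : ∀ ξ, (𝓕 φ : 𝓢(E n, ℂ)) ξ = (besselSymbol n s ξ : ℂ) * (𝓕 g : 𝓢(E n, ℂ)) ξ) :
    homSobolev σ φ ≤ ‖(toL2 g)‖ₑ ^ 2 := by
  rw [enorm_toL2_sq, ← lintegral_enorm_fourier_sq g]
  refine lintegral_mono fun ξ => ?_
  rw [← enorm_fourier_sq_of_symbol (h ξ)]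
  gcongr ?_ * _
  refine ENNReal.ofReal_le_ofReal ?_
  rw [Real.rpow_mul (norm_nonneg _), Real.rpow_two]
  calc (‖ξ‖ ^ 2) ^ σ ≤ (1 + ‖ξ‖ ^ 2) ^ σ :=
        Real.rpow_le_rpow (by positivity) (by linarith) hσ0
    _ ≤ (1 + ‖ξ‖ ^ 2) ^ s :=
        Real.rpow_le_rpow_of_exponent_le (by linarith [sq_nonneg ‖ξ‖]) hσ

theorem ae_fst_of_ae {n : ℕ} {P : E n → Prop} (h : ∀ᵐ x, P x) :
    ∀ᵐ z : E n × E n, P z.1 :=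
  (Measure.quasiMeasurePreserving_fst (μ := (volume : Measure (E n)))
    (ν := (volume : Measure (E n)))).ae h

theorem ae_snd_of_ae {n : ℕ} {P : E n → Prop} (h : ∀ᵐ x, P x) :
    ∀ᵐ z : E n × E n, P z.2 :=
  (Measure.quasiMeasurePreserving_snd (μ := (volume : Measure (E n)))
    (ν := (volume : Measure (E n)))).ae h

theorem gagliardo_congr {n : ℕ} {s : ℝ} {u v : E n → ℂ} (h : u =ᵐ[volume] v) :
    gagliardo n s u = gagliardo n s v := by
  refine lintegral_congr_ae ?_
  filter_upwards [ae_fst_of_ae h, ae_snd_of_ae h] with z h1 h2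
  rw [h1, h2]

theorem measurable_kernel {n : ℕ} (a : ℝ) :
    Measurable fun z : E n × E n => ENNReal.ofReal (‖z.2 - z.1‖ ^ a) := by
  fun_prop

theorem aestronglyMeasurable_fst {n : ℕ} (u : L2 n) :
    AEStronglyMeasurable (fun z : E n × E n => u z.1) :=
  (Lp.aestronglyMeasurable u).comp_quasiMeasurePreserving Measure.quasiMeasurePreserving_fst

theorem aestronglyMeasurable_snd {n : ℕ} (u : L2 n) :
    AEStronglyMeasurable (fun z : E n × E n => u z.2) :=
  (Lp.aestronglyMeasurable u).comp_quasiMeasurePreserving Measure.quasiMeasurePreserving_snd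

/-- The Gagliardo seminorm is bounded by the `Hˢ` norm. -/
theorem exists_gagliardo_le {n : ℕ} (hn : 1 ≤ n) {s : ℝ} (hs0 : 0 < s) (hs1 : s < 1) :
    ∃ C : ℝ≥0∞, C ≠ ∞ ∧ ∀ g : L2 n,
      gagliardo n s (besselInv n hs0.le g) ≤ C * ‖g‖ₑ ^ 2 := by
  obtain ⟨c, -, hc, hg⟩ := exists_gagliardo_const hn hs0 hs1
  refine ⟨c, hc, fun g => ?_⟩
  obtain ⟨γ, hγ, hae⟩ := exists_schwartz_seq hs0.le g
  refine lintegral_le_of_tendsto_ae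
    (f := fun k z => ‖besselInv n hs0.le (toL2 (γ k)) z.1 -
      besselInv n hs0.le (toL2 (γ k)) z.2‖ₑ ^ 2 *
        ENNReal.ofReal (‖z.2 - z.1‖ ^ (-(n + 2 * s)))) ?_ ?_ (fun k => ?_) (tendsto_enorm_sq hγ hc)
  · intro k
    exact ((((aestronglyMeasurable_fst _).sub (aestronglyMeasurable_snd _)).enorm.pow_const 2).mul
      (measurable_kernel _).aemeasurable)
  · filter_upwards [ae_fst_of_ae hae, ae_snd_of_ae hae] with z h1 h2
    refine ENNReal.Tendsto.mul_const ?_ (Or.inr ENNReal.ofReal_ne_top)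
    exact tendsto_enorm_pow_two (h1.sub h2)
  · obtain ⟨φ, hφ, hF⟩ := exists_besselInv_schwartz hs0.le (γ k)
    change gagliardo n s _ ≤ _
    rw [hφ, gagliardo_congr (coeFn_toL2 φ), hg]
    gcongr
    exact homSobolev_le hs0.le le_rfl hF

/-- The `Hˢ` norm is bounded by the `L²` norm and the Gagliardo seminorm. -/
theorem exists_enorm_le_gagliardo {n : ℕ} (hn : 1 ≤ n) {s : ℝ} (hs0 : 0 < s) (hs1 : s < 1) :
    ∃ C : ℝ≥0∞, C ≠ ∞ ∧ ∀ g : 𝓢(E n, ℂ), ‖(toL2 g)‖ₑ ^ 2 ≤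
      ‖besselInv n hs0.le (toL2 g)‖ₑ ^ 2 +
        C * gagliardo n s (besselInv n hs0.le (toL2 g)) := by
  obtain ⟨c, hc0, hc, hg⟩ := exists_gagliardo_const hn hs0 hs1
  refine ⟨c⁻¹, ENNReal.inv_ne_top.2 hc0, fun g => ?_⟩
  obtain ⟨φ, hφ, hF⟩ := exists_besselInv_schwartz hs0.le g
  have hm := (𝓕 φ : 𝓢(E n, ℂ)).continuous.measurable
  rw [hφ, gagliardo_congr (coeFn_toL2 φ), hg, ← mul_assoc, ENNReal.inv_mul_cancel hc0 hc,
    one_mul, enorm_toL2_sq, enorm_toL2_sq, ← lintegral_enorm_fourier_sq g,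
    ← lintegral_enorm_fourier_sq φ, ← lintegral_add_left (by fun_prop)]
  refine lintegral_mono fun ξ => ?_
  rw [← enorm_fourier_sq_of_symbol (hF ξ), ← one_add_mul]
  gcongr ?_ * _
  rw [← ENNReal.ofReal_one, ← ENNReal.ofReal_add zero_le_one (by positivity)]
  refine ENNReal.ofReal_le_ofReal ?_
  rw [Real.rpow_mul (norm_nonneg _), Real.rpow_two]
  -- Subadditivity of `t ↦ t ^ s` for `s ≤ 1` gives `(1 + ‖ξ‖²)ˢ ≤ 1 + ‖ξ‖²ˢ`.
  have := NNReal.coe_le_coe.2 (NNReal.rpow_add_le_add_rpow 1 (‖ξ‖₊ ^ 2) hs0.le hs1.le)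
  simpa using this

/-! ### Weights in `Lᵖ` against functions in `Hˢ` -/

theorem two_le_pExp (n : ℕ) (s : ℝ) : 2 ≤ pExp n s := le_max_left _ _

/-- Hölder with exponents `p` and `p / (p - 1)` requires `u ∈ L^{2p/(p-1)}`, which is the Sobolev
exponent of order `σ = n / (2p)`. The definition of `p` gives `σ ≤ s` from `p ≥ n / (2s)` and `σ < n
/ 2` from `p ≥ 2`. -/
theorem exists_weight_const_unit {n : ℕ} (hn : 1 ≤ n) {s : ℝ} (hs0 : 0 < s) :
    ∃ C : ℝ≥0∞, C ≠ ∞ ∧ ∀ V : E n → ℝ≥0∞, AEMeasurable V →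
      ∀ γ : 𝓢(E n, ℂ), ‖(toL2 γ)‖ ≤ 1 →
      ∫⁻ x, V x * ‖besselInv n hs0.le (toL2 γ) x‖ₑ ^ 2 ≤
        C * (∫⁻ x, V x ^ pExp n s) ^ (1 / pExp n s) := by
  have hps : (n : ℝ) / (2 * s) ≤ pExp n s := le_max_right _ _
  have hp2 : 2 ≤ pExp n s := two_le_pExp n s
  generalize pExp n s = p at hp2 hps ⊢
  have hn0 : (0 : ℝ) < n := by exact_mod_cast hn
  have hp1 : 0 < p - 1 := by linarith
  have hps : (n : ℝ) / (2 * p) ≤ s := by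
    rw [div_le_iff₀ (by positivity)] at hps ⊢
    linarith
  have hσ : (n : ℝ) / (2 * p) < n / 2 := by
    rw [div_lt_div_iff₀ (by positivity) (by norm_num)]
    nlinarith
  obtain ⟨C, hC, hsob⟩ := exists_sobolev_const hn (σ := n / (2 * p)) (by positivity) hσ
  have hconj : p.HolderConjugate (p / (p - 1)) := Real.HolderConjugate.conjExponent (by linarith)
  have hm : 2 * n / (n - 2 * ((n : ℝ) / (2 * p))) = 2 * (p / (p - 1)) := by
    have h3 : (n : ℝ) - 2 * (n / (2 * p)) = n * (p - 1) / p := by field_simp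
    rw [h3]
    field_simp
  rw [hm] at hsob
  have hq0 : 0 < p / (p - 1) := by positivity
  refine ⟨C ^ (1 / (p / (p - 1))), ENNReal.rpow_ne_top_of_nonneg (by positivity) hC,
    fun V hV γ hγ => ?_⟩
  obtain ⟨φ, hφ, hF⟩ := exists_besselInv_schwartz hs0.le γ
  have h1 : homSobolev ((n : ℝ) / (2 * p)) φ ≤ 1 := by
    refine (homSobolev_le (by positivity) hps hF).trans (pow_le_one₀ zero_le ?_)
    rw [← ofReal_norm]
    exact ENNReal.ofReal_le_one.2 hγ
  have h2 := hsob φ h1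
  have h3 : ∫⁻ x, V x * ‖besselInv n hs0.le (toL2 γ) x‖ₑ ^ 2 =
      ∫⁻ x, (V * fun x => ‖φ x‖ₑ ^ 2) x := by
    rw [hφ]
    refine lintegral_congr_ae ?_
    filter_upwards [coeFn_toL2 φ] with x hx
    rw [hx, Pi.mul_apply]
  have hφm := φ.continuous.measurable
  rw [h3]
  refine (ENNReal.lintegral_mul_le_Lp_mul_Lq _ hconj hV (by fun_prop)).trans ?_
  rw [mul_comm]
  gcongr
  refine (le_of_eq (lintegral_congr fun x => ?_)).trans h2
  rw [← ENNReal.rpow_two, ← ENNReal.rpow_mul]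

theorem lintegral_weight_smul {n : ℕ} (V : E n → ℝ≥0∞) (c : ℂ) (u : L2 n) :
    ∫⁻ x, V x * ‖(c • u : L2 n) x‖ₑ ^ 2 = ‖c‖ₑ ^ 2 * ∫⁻ x, V x * ‖u x‖ₑ ^ 2 := by
  rw [← lintegral_const_mul' _ _ (by finiteness)]
  refine lintegral_congr_ae ?_
  filter_upwards [Lp.coeFn_smul c u] with x hx
  rw [hx, Pi.smul_apply, enorm_smul, mul_pow]
  ring

theorem enorm_ofReal_norm {F : Type*} [NormedAddCommGroup F] (a : F) :
    ‖((‖a‖ : ℝ) : ℂ)‖ₑ = ‖a‖ₑ := by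
  rw [← ofReal_norm, Complex.norm_real, norm_norm, ofReal_norm]

/-- Both sides are homogeneous of degree two, so dividing by the norm removes the normalisation. -/
theorem exists_weight_const_schwartz {n : ℕ} (hn : 1 ≤ n) {s : ℝ} (hs0 : 0 < s) :
    ∃ C : ℝ≥0∞, C ≠ ∞ ∧ ∀ V : E n → ℝ≥0∞, AEMeasurable V →
      ∀ γ : 𝓢(E n, ℂ),
      ∫⁻ x, V x * ‖besselInv n hs0.le (toL2 γ) x‖ₑ ^ 2 ≤
        C * (∫⁻ x, V x ^ pExp n s) ^ (1 / pExp n s) * ‖(toL2 γ)‖ₑ ^ 2 := by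
  obtain ⟨C, hC, hunit⟩ := exists_weight_const_unit hn hs0
  refine ⟨C, hC, fun V hV γ => ?_⟩
  have hunit' : ∀ c : ℂ, ‖c • (toL2 γ)‖ ≤ 1 →
      ‖c‖ₑ ^ 2 * ∫⁻ x, V x * ‖besselInv n hs0.le (toL2 γ) x‖ₑ ^ 2 ≤
        C * (∫⁻ x, V x ^ pExp n s) ^ (1 / pExp n s) := by
    intro c hc
    have h1 := hunit V hV (c • γ) (by rw [toL2_smul]; exact hc)
    rw [toL2_smul, ContinuousLinearMap.map_smul] at h1
    rw [← lintegral_weight_smul]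
    exact h1
  generalize (toL2 γ) = G at hunit' ⊢
  clear hunit
  by_cases h0 : G = 0
  · rw [h0, map_zero]
    have h1 := lintegral_weight_smul V 0 (0 : L2 n)
    rw [smul_zero, enorm_zero, zero_pow two_ne_zero, zero_mul] at h1
    rw [h1]
    exact zero_le
  · have hr0 : (‖G‖ : ℂ) ≠ 0 := Complex.ofReal_ne_zero.2 (norm_ne_zero_iff.2 h0)
    have h1 := hunit' (‖G‖ : ℂ)⁻¹ (by
      rw [norm_smul, norm_inv, Complex.norm_real, norm_norm,
        inv_mul_cancel₀ (norm_ne_zero_iff.2 h0)])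
    have h4 : ‖G‖ₑ ^ 2 * ‖(‖G‖ : ℂ)⁻¹‖ₑ ^ 2 = 1 := by
      rw [← enorm_ofReal_norm G, ← mul_pow, ← enorm_mul, mul_inv_cancel₀ hr0]; simp
    calc ∫⁻ x, V x * ‖besselInv n hs0.le G x‖ₑ ^ 2
        = ‖G‖ₑ ^ 2 * (‖(‖G‖ : ℂ)⁻¹‖ₑ ^ 2 *
            ∫⁻ x, V x * ‖besselInv n hs0.le G x‖ₑ ^ 2) := by
          rw [← mul_assoc, h4, one_mul]
      _ ≤ ‖G‖ₑ ^ 2 * (C * (∫⁻ x, V x ^ pExp n s) ^ (1 / pExp n s)) := mul_le_mul' le_rfl h1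
      _ = _ := by rw [mul_comm]

theorem ae_ne_top_of_lintegral_rpow {α : Type*} [MeasurableSpace α] {μ : Measure α} {p : ℝ}
    (hp : 0 < p) {V : α → ℝ≥0∞} (hV : AEMeasurable V μ) (hVp : ∫⁻ x, V x ^ p ∂μ ≠ ∞) :
    ∀ᵐ x ∂μ, V x ≠ ∞ := by
  filter_upwards [ae_lt_top' (hV.pow_const p) hVp] with x hx h
  rw [h, ENNReal.top_rpow_of_pos hp] at hx
  exact lt_irrefl _ hx

/-- Functions in `Hˢ` are square integrable with respect to weights in `Lᵖ`, where
`p = max {2, n / (2s)}`. -/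
theorem exists_weight_const {n : ℕ} (hn : 1 ≤ n) {s : ℝ} (hs0 : 0 < s) :
    ∃ C : ℝ≥0∞, C ≠ ∞ ∧ ∀ V : E n → ℝ≥0∞, AEMeasurable V →
      ∫⁻ x, V x ^ pExp n s ≠ ∞ → ∀ g : L2 n,
      ∫⁻ x, V x * ‖besselInv n hs0.le g x‖ₑ ^ 2 ≤
        C * (∫⁻ x, V x ^ pExp n s) ^ (1 / pExp n s) * ‖g‖ₑ ^ 2 := by
  obtain ⟨C, hC, hsch⟩ := exists_weight_const_schwartz hn hs0
  refine ⟨C, hC, fun V hV hVp g => ?_⟩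
  have hp0 : 0 < pExp n s := by linarith [two_le_pExp n s]
  have hK : C * (∫⁻ x, V x ^ pExp n s) ^ (1 / pExp n s) ≠ ∞ :=
    ENNReal.mul_ne_top hC (ENNReal.rpow_ne_top_of_nonneg (by positivity) hVp)
  have hVtop := ae_ne_top_of_lintegral_rpow hp0 hV hVp
  replace hsch := hsch V hV
  generalize C * (∫⁻ x, V x ^ pExp n s) ^ (1 / pExp n s) = K at hK hsch ⊢
  obtain ⟨γ, hγ, hae⟩ := exists_schwartz_seq hs0.le g
  have hlim : ∀ᵐ x, Tendsto (fun k => V x * ‖besselInv n hs0.le (toL2 (γ k)) x‖ₑ ^ 2) atTop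
      (𝓝 (V x * ‖besselInv n hs0.le g x‖ₑ ^ 2)) := by
    filter_upwards [hae, hVtop] with x hx hVx
    exact ENNReal.Tendsto.const_mul (tendsto_enorm_pow_two hx) (Or.inr hVx)
  exact lintegral_le_of_tendsto_ae
    (fun k => hV.mul ((Lp.aestronglyMeasurable _).enorm.pow_const 2)) hlim (fun k => hsch (γ k))
    (tendsto_enorm_sq hγ hK)

/-- Dominated convergence: wherever `V` is finite, the part above height `M` is eventually zero, and
`V ^ p` dominates. -/
theorem exists_truncation {n : ℕ} {p : ℝ} (hp : 0 < p) {V : E n → ℝ≥0∞} (hV : AEMeasurable V)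
    (hVp : ∫⁻ x, V x ^ p ≠ ∞) {ε : ℝ≥0∞} (hε : ε ≠ 0) :
    ∃ M : ℕ, ∫⁻ x, (Set.Ioi (M : ℝ≥0∞)).indicator id (V x) ^ p ≤ ε := by
  have hlim : Tendsto (fun M : ℕ => ∫⁻ x, (Set.Ioi (M : ℝ≥0∞)).indicator id (V x) ^ p) atTop
      (𝓝 (∫⁻ _ : E n, 0)) := by
    refine tendsto_lintegral_of_dominated_convergence' (fun x => V x ^ p) ?_ ?_ hVp ?_
    · intro M
      exact ((measurable_id.indicator measurableSet_Ioi).comp_aemeasurable hV).pow_const p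
    · intro M
      refine Eventually.of_forall fun x => ?_
      exact ENNReal.rpow_le_rpow (Set.indicator_le_self _ _ _) hp.le
    · filter_upwards [ae_ne_top_of_lintegral_rpow hp hV hVp] with x hVx
      obtain ⟨N, hN⟩ := ENNReal.exists_nat_gt hVx
      refine tendsto_const_nhds.congr' ?_
      filter_upwards [eventually_ge_atTop N] with M hM
      rw [Set.indicator_of_notMem, ENNReal.zero_rpow_of_pos hp]
      simp only [Set.mem_Ioi, not_lt]
      exact hN.le.trans (by exact_mod_cast hM)
  rw [lintegral_zero] at hlim
  obtain ⟨M, hM⟩ := (hlim.eventually (ge_mem_nhds (pos_iff_ne_zero.2 hε))).exists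
  exact ⟨M, hM⟩

/-- Weights in `Lᵖ` are form bounded with relative bound zero. -/
theorem exists_weight_small {n : ℕ} (hn : 1 ≤ n) {s : ℝ} (hs0 : 0 < s) {V : E n → ℝ≥0∞}
    (hV : AEMeasurable V) (hVp : ∫⁻ x, V x ^ pExp n s ≠ ∞) {ε : ℝ≥0∞} (hε : ε ≠ 0) :
    ∃ C : ℝ≥0∞, C ≠ ∞ ∧ ∀ g : L2 n, ∫⁻ x, V x * ‖besselInv n hs0.le g x‖ₑ ^ 2 ≤
      ε * ‖g‖ₑ ^ 2 + C * ‖besselInv n hs0.le g‖ₑ ^ 2 := by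
  obtain ⟨C, hC, hw⟩ := exists_weight_const hn hs0
  have hp2 := two_le_pExp n s
  set p := pExp n s
  obtain ⟨δ, hδ0, hδ⟩ : ∃ δ : ℝ≥0∞, δ ≠ 0 ∧ C * δ ^ (1 / p) ≤ ε := by
    have hlim : Tendsto (fun δ : ℝ≥0∞ => C * δ ^ (1 / p)) (𝓝 0) (𝓝 (C * 0 ^ (1 / p))) :=
      ENNReal.Tendsto.const_mul ((ENNReal.continuous_rpow_const).tendsto 0) (Or.inr hC)
    rw [ENNReal.zero_rpow_of_pos (by positivity), mul_zero] at hlim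
    have h1 := (hlim.mono_left (nhdsWithin_le_nhds (s := Set.Ioi 0))).eventually (ge_mem_nhds (pos_iff_ne_zero.2 hε))
    obtain ⟨δ, h2, h3⟩ := (h1.and (self_mem_nhdsWithin (s := Set.Ioi (0 : ℝ≥0∞)))).exists
    exact ⟨δ, (pos_iff_ne_zero.1 h3), h2⟩
  -- The part of `V` above height `M` has small `Lᵖ` norm and costs `ε ‖g‖²`; the part below is
  -- bounded by `M` and costs `M` times the squared `L²` norm.
  obtain ⟨M, hM⟩ := exists_truncation (by linarith) hV hVp hδ0
  refine ⟨M, ENNReal.natCast_ne_top M, fun g => ?_⟩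
  have hVM : AEMeasurable (fun x => (Set.Ioi (M : ℝ≥0∞)).indicator id (V x)) :=
    (measurable_id.indicator measurableSet_Ioi).comp_aemeasurable hV
  have hu : AEMeasurable (fun x => ‖besselInv n hs0.le g x‖ₑ ^ 2) :=
    (Lp.aestronglyMeasurable _).enorm.pow_const 2
  have h1 := hw _ hVM (ne_top_of_le_ne_top hVp (lintegral_mono fun x =>
    ENNReal.rpow_le_rpow (Set.indicator_le_self _ _ _) (by linarith))) g
  calc ∫⁻ x, V x * ‖besselInv n hs0.le g x‖ₑ ^ 2
      ≤ ∫⁻ x, ((Set.Ioi (M : ℝ≥0∞)).indicator id (V x) * ‖besselInv n hs0.le g x‖ₑ ^ 2 +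
          M * ‖besselInv n hs0.le g x‖ₑ ^ 2) := by
        refine lintegral_mono fun x => ?_
        rw [← add_mul]
        gcongr
        by_cases h : V x ∈ Set.Ioi (M : ℝ≥0∞)
        · rw [Set.indicator_of_mem h]; exact le_self_add
        · rw [Set.indicator_of_notMem h, zero_add]; simpa using h
    _ = (∫⁻ x, (Set.Ioi (M : ℝ≥0∞)).indicator id (V x) * ‖besselInv n hs0.le g x‖ₑ ^ 2) +
          M * ‖besselInv n hs0.le g‖ₑ ^ 2 := by
        rw [lintegral_add_right' _ (hu.const_mul _), lintegral_const_mul'' _ hu, enorm_L2_sq]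
    _ ≤ _ := by
        refine add_le_add (h1.trans ?_) le_rfl
        refine mul_le_mul' (le_trans ?_ hδ) le_rfl
        gcongr

end FMSE

end

noncomputable section

namespace FMSE

open MeasureTheory TemperedDistribution Filter Topology Module
open scoped ENNReal

/-! ### The magnetic gradient -/

theorem norm_toComplex {n : ℕ} (x : E n) : ‖toComplex x‖ = ‖x‖ := by
  simp [EuclideanSpace.norm_eq, toComplex]

theorem norm_dot_le {n : ℕ} (a b : EC n) : ‖dot a b‖ ≤ ‖a‖ * ‖b‖ := by
  refine (norm_sum_le _ _).trans ?_
  simp only [norm_mul]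
  rw [EuclideanSpace.norm_eq, EuclideanSpace.norm_eq]
  exact Real.sum_mul_le_sqrt_mul_sqrt _ _ _

theorem dot_add_left {n : ℕ} (a b c : EC n) : dot (a + b) c = dot a c + dot b c := by
  simp [dot, add_mul, Finset.sum_add_distrib]

theorem dot_add_right {n : ℕ} (a b c : EC n) : dot a (b + c) = dot a b + dot a c := by
  simp [dot, mul_add, Finset.sum_add_distrib]

theorem dot_smul_left {n : ℕ} (c : ℂ) (a b : EC n) : dot (c • a) b = c * dot a b := by
  simp [dot, Finset.mul_sum, mul_assoc]

theorem dot_smul_right {n : ℕ} (c : ℂ) (a b : EC n) : dot a (c • b) = c * dot a b := by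
  simp only [dot, Finset.mul_sum, PiLp.smul_apply, smul_eq_mul]
  exact Finset.sum_congr rfl fun _ _ => by ring

theorem dot_comm {n : ℕ} (a b : EC n) : dot a b = dot b a := by
  simp [dot, mul_comm]

theorem dot_toComplex_self {n : ℕ} (x : E n) :
    dot (toComplex x) (toComplex x) = ((‖x‖ ^ 2 : ℝ) : ℂ) := by
  rw [EuclideanSpace.norm_sq_eq]
  simp [dot, toComplex, sq]

theorem enorm_mul_le_sq_add_sq (a b : ℝ≥0∞) : a * b ≤ a ^ 2 + b ^ 2 := by
  rcases le_total a b with h | h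
  · calc a * b ≤ b * b := by gcongr
      _ ≤ _ := by rw [sq b]; exact le_add_self
  · calc a * b ≤ a * a := by gcongr
      _ ≤ _ := by rw [sq a]; exact le_self_add

theorem enorm_dot_le {n : ℕ} (a b : EC n) : ‖dot a b‖ₑ ≤ ‖a‖ₑ ^ 2 + ‖b‖ₑ ^ 2 := by
  refine le_trans ?_ (enorm_mul_le_sq_add_sq _ _)
  rw [← ofReal_norm, ← ofReal_norm, ← ofReal_norm, ← ENNReal.ofReal_mul (norm_nonneg _)]
  exact ENNReal.ofReal_le_ofReal (norm_dot_le a b)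

theorem enorm_add_sq_le {F : Type*} [NormedAddCommGroup F] (a b : F) :
    ‖a + b‖ₑ ^ 2 ≤ 2 * ‖a‖ₑ ^ 2 + 2 * ‖b‖ₑ ^ 2 := by
  have h : ‖a + b‖ ^ 2 ≤ 2 * ‖a‖ ^ 2 + 2 * ‖b‖ ^ 2 := by
    have := norm_add_le a b
    nlinarith [norm_nonneg (a + b), sq_nonneg (‖a‖ - ‖b‖)]
  simp only [← ofReal_norm]
  rw [← ENNReal.ofReal_pow (norm_nonneg _), ← ENNReal.ofReal_pow (norm_nonneg _),
    ← ENNReal.ofReal_pow (norm_nonneg _)]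
  have h2 : (2 : ℝ≥0∞) = ENNReal.ofReal 2 := by simp
  rw [h2, ← ENNReal.ofReal_mul (by norm_num), ← ENNReal.ofReal_mul (by norm_num),
    ← ENNReal.ofReal_add (by positivity) (by positivity)]
  exact ENNReal.ofReal_le_ofReal h

theorem Cns_pos {n : ℕ} {s : ℝ} (hs0 : 0 < s) (hs1 : s < 1) : 0 < Cns n s := by
  have h1 : 0 < Real.Gamma ((n : ℝ) / 2 + s) := Real.Gamma_pos_of_pos (by positivity)
  have h2 : Real.Gamma (-s) ≠ 0 := by
    refine Real.Gamma_ne_zero fun m hm => ?_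
    have hm' : s = m := by linarith
    rw [hm'] at hs0 hs1
    have h3 : 0 < m := by exact_mod_cast hs0
    have h4 : m < 1 := by exact_mod_cast hs1
    omega
  have h3 : 0 < |Real.Gamma (-s)| := abs_pos.2 h2
  unfold Cns
  positivity

theorem norm_alpha_sq {n : ℕ} {s : ℝ} (hs0 : 0 < s) (hs1 : s < 1) (x y : E n) :
    ‖alpha s x y‖ ^ 2 = Cns n s / 2 * ‖y - x‖ ^ (-(n + 2 * s)) := by
  have hC := Cns_pos (n := n) hs0 hs1
  -- On the diagonal both sides are zero, since `0` to the nonzero power `-(n + 2s)` is `0` for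
  -- `Real.rpow`.
  by_cases h : y - x = 0
  · rw [alpha, h, smul_zero, norm_zero, Real.zero_rpow]
    · simp
    · have : (0 : ℝ) ≤ n := by positivity
      linarith
  have hpos : 0 < ‖y - x‖ := norm_pos_iff.2 h
  rw [alpha, norm_smul, Real.norm_of_nonneg (by positivity), mul_pow, div_pow, div_pow,
    Real.sq_sqrt hC.le, Real.sq_sqrt (by norm_num), ← Real.rpow_mul_natCast hpos.le,
    ← Real.rpow_natCast ‖y - x‖ 2, div_mul_eq_mul_div, mul_div_assoc, ← Real.rpow_sub hpos]
  congr 2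
  push_cast
  ring

theorem enorm_fracGrad_sq {n : ℕ} {s : ℝ} (hs0 : 0 < s) (hs1 : s < 1) (u : E n → ℂ) (x y : E n) :
    ‖fracGrad s u x y‖ₑ ^ 2 = ENNReal.ofReal (Cns n s / 2) *
      (‖u x - u y‖ₑ ^ 2 * ENNReal.ofReal (‖y - x‖ ^ (-(n + 2 * s)))) := by
  have hC := Cns_pos (n := n) hs0 hs1
  rw [fracGrad, enorm_smul, mul_pow, ← ofReal_norm (toComplex _), norm_toComplex,
    ← ENNReal.ofReal_pow (norm_nonneg _), norm_alpha_sq hs0 hs1,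
    ENNReal.ofReal_mul (by positivity)]
  ring

theorem lintegral_enorm_fracGrad_sq {n : ℕ} {s : ℝ} (hs0 : 0 < s) (hs1 : s < 1) (u : E n → ℂ) :
    ∫⁻ z : E n × E n, ‖fracGrad s u z.1 z.2‖ₑ ^ 2 =
      ENNReal.ofReal (Cns n s / 2) * gagliardo n s u := by
  simp_rw [enorm_fracGrad_sq hs0 hs1]
  rw [lintegral_const_mul' _ _ ENNReal.ofReal_ne_top, gagliardo]

theorem aestronglyMeasurable_fracGrad {n : ℕ} (s : ℝ) (u : L2 n) :
    AEStronglyMeasurable (fun z : E n × E n => fracGrad s u z.1 z.2) := by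
  have h1 : Measurable fun z : E n × E n => alpha s z.1 z.2 := by
    unfold alpha
    fun_prop
  have h2 : Continuous (toComplex (n := n)) := by
    unfold toComplex
    fun_prop
  have h3 : AEStronglyMeasurable fun z : E n × E n => toComplex (alpha s z.1 z.2) :=
    (h2.measurable.comp h1).aestronglyMeasurable
  exact ((aestronglyMeasurable_fst u).sub (aestronglyMeasurable_snd u)).smul h3

theorem aestronglyMeasurable_smul_potential {n : ℕ} {A : E n → E n → EC n}
    (hA : AEStronglyMeasurable (fun z : E n × E n => A z.1 z.2) volume) (u : L2 n) :
    AEStronglyMeasurable (fun z : E n × E n => u z.1 • A z.1 z.2) :=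
  (aestronglyMeasurable_fst u).smul hA

theorem aestronglyMeasurable_magGrad {n : ℕ} (s : ℝ) {A : E n → E n → EC n}
    (hA : AEStronglyMeasurable (fun z : E n × E n => A z.1 z.2) volume) (u : L2 n) :
    AEStronglyMeasurable (fun z : E n × E n => magGrad s A u z.1 z.2) :=
  (aestronglyMeasurable_fracGrad s u).add (aestronglyMeasurable_smul_potential hA u)

/-- By Tonelli, integrating in `y` first turns the bivariate potential into the scalar weight `J2 A
^ 2` on `|u|²`. -/
theorem lintegral_enorm_smul_potential_sq {n : ℕ} {A : E n → E n → EC n}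
    (hA : AEStronglyMeasurable (fun z : E n × E n => A z.1 z.2) volume) (u : L2 n) :
    ∫⁻ z : E n × E n, ‖u z.1 • A z.1 z.2‖ₑ ^ 2 = ∫⁻ x, J2 A x ^ 2 * ‖u x‖ₑ ^ 2 := by
  have hm := (aestronglyMeasurable_smul_potential hA u).enorm.pow_const 2
  rw [Measure.volume_eq_prod] at hm ⊢
  rw [lintegral_prod _ hm]
  refine lintegral_congr fun x => ?_
  simp_rw [enorm_smul, mul_pow]
  have hsq : ∀ I : ℝ≥0∞, (I ^ (2⁻¹ : ℝ)) ^ 2 = I := by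
    intro I
    rw [← ENNReal.rpow_two, ← ENNReal.rpow_mul]
    norm_num
  rw [lintegral_const_mul' _ _ (by finiteness), mul_comm, J2, hsq]

/-- `J2 A ∈ L^{2p}` means that `J2 A ^ 2` is a weight in `Lᵖ`, so `exists_weight_small` applies to
it. -/
theorem exists_potential_small {n : ℕ} (hn : 1 ≤ n) {s : ℝ} (hs0 : 0 < s)
    {Ω : Set (E n)} {A : E n → E n → EC n} {q : E n → ℝ} (hAq : P0 s Ω A q)
    {ε : ℝ≥0∞} (hε : ε ≠ 0) :
    ∃ C : ℝ≥0∞, C ≠ ∞ ∧ ∀ g : L2 n,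
      ∫⁻ z : E n × E n, ‖besselInv n hs0.le g z.1 • A z.1 z.2‖ₑ ^ 2 ≤
        ε * ‖g‖ₑ ^ 2 + C * ‖besselInv n hs0.le g‖ₑ ^ 2 := by
  have hp : 0 < pExp n s := by linarith [two_le_pExp n s]
  have hJ := hAq.memLp_J2
  have hJm : AEMeasurable (J2 A) := hJ.1.aemeasurable
  have hfin : ∫⁻ x, (J2 A x ^ 2) ^ pExp n s ≠ ∞ := by
    have h1 := (eLpNorm_lt_top_iff_lintegral_rpow_enorm_lt_top
      (ENNReal.ofReal_pos.2 (by linarith)).ne' ENNReal.ofReal_ne_top).1 hJ.2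
    rw [ENNReal.toReal_ofReal (by linarith)] at h1
    refine (lt_of_eq_of_lt (lintegral_congr fun x => ?_) h1).ne
    rw [enorm_eq_self, ← ENNReal.rpow_two, ← ENNReal.rpow_mul]
  obtain ⟨C, hC, h⟩ := exists_weight_small hn hs0 (hJm.pow_const 2) hfin hε
  refine ⟨C, hC, fun g => ?_⟩
  rw [lintegral_enorm_smul_potential_sq hAq.measurable_A]
  exact h g

theorem exists_scalar_small {n : ℕ} (hn : 1 ≤ n) {s : ℝ} (hs0 : 0 < s)
    {Ω : Set (E n)} (hΩ : MeasurableSet Ω) {A : E n → E n → EC n} {q : E n → ℝ}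
    (hAq : P0 s Ω A q) {ε : ℝ≥0∞} (hε : ε ≠ 0) :
    ∃ C : ℝ≥0∞, C ≠ ∞ ∧ ∀ g : L2 n,
      ∫⁻ x in Ω, ‖q x‖ₑ * ‖besselInv n hs0.le g x‖ₑ ^ 2 ≤
        ε * ‖g‖ₑ ^ 2 + C * ‖besselInv n hs0.le g‖ₑ ^ 2 := by
  have hp : 0 < pExp n s := by linarith [two_le_pExp n s]
  have hq := hAq.memLp_q
  have hm : AEMeasurable (Ω.indicator fun x => ‖q x‖ₑ) :=
    (aemeasurable_indicator_iff hΩ).2 hq.1.enorm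
  have hfin : ∫⁻ x, (Ω.indicator (fun x => ‖q x‖ₑ) x) ^ pExp n s ≠ ∞ := by
    have h1 := (eLpNorm_lt_top_iff_lintegral_rpow_enorm_lt_top
      (ENNReal.ofReal_pos.2 hp).ne' ENNReal.ofReal_ne_top).1 hq.2
    rw [ENNReal.toReal_ofReal hp.le, ← lintegral_indicator hΩ] at h1
    refine (lt_of_eq_of_lt (lintegral_congr fun x => ?_) h1).ne
    by_cases hx : x ∈ Ω
    · rw [Set.indicator_of_mem hx, Set.indicator_of_mem hx]
    · rw [Set.indicator_of_notMem hx, Set.indicator_of_notMem hx, ENNReal.zero_rpow_of_pos hp]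
  obtain ⟨C, hC, h⟩ := exists_weight_small hn hs0 hm hfin hε
  refine ⟨C, hC, fun g => ?_⟩
  refine (le_of_eq ?_).trans (h g)
  rw [← lintegral_indicator hΩ]
  refine lintegral_congr fun x => ?_
  by_cases hx : x ∈ Ω
  · rw [Set.indicator_of_mem hx, Set.indicator_of_mem hx]
  · rw [Set.indicator_of_notMem hx, Set.indicator_of_notMem hx, zero_mul]

theorem enorm_besselInv_sq_le {n : ℕ} {s : ℝ} (hs : 0 ≤ s) (g : L2 n) :
    ‖besselInv n hs g‖ₑ ^ 2 ≤ ‖g‖ₑ ^ 2 := by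
  gcongr
  rw [← ofReal_norm, ← ofReal_norm]
  exact ENNReal.ofReal_le_ofReal (norm_besselInv_le hs g)

theorem exists_magGrad_le {n : ℕ} (hn : 1 ≤ n) {s : ℝ} (hs0 : 0 < s) (hs1 : s < 1)
    {Ω : Set (E n)} {A : E n → E n → EC n} {q : E n → ℝ} (hAq : P0 s Ω A q) :
    ∃ C : ℝ≥0∞, C ≠ ∞ ∧ ∀ g : L2 n,
      ∫⁻ z : E n × E n, ‖magGrad s A (besselInv n hs0.le g) z.1 z.2‖ₑ ^ 2 ≤ C * ‖g‖ₑ ^ 2 := by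
  obtain ⟨C1, hC1, h1⟩ := exists_gagliardo_le hn hs0 hs1
  obtain ⟨C2, hC2, h2⟩ := exists_potential_small hn hs0 hAq one_ne_zero
  refine ⟨2 * (ENNReal.ofReal (Cns n s / 2) * C1) + 2 * (1 + C2), by finiteness, fun g => ?_⟩
  have hm := ((aestronglyMeasurable_fracGrad s (besselInv n hs0.le g)).enorm.pow_const 2)
  calc ∫⁻ z : E n × E n, ‖magGrad s A (besselInv n hs0.le g) z.1 z.2‖ₑ ^ 2
      ≤ ∫⁻ z : E n × E n, (2 * ‖fracGrad s (besselInv n hs0.le g) z.1 z.2‖ₑ ^ 2 +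
          2 * ‖besselInv n hs0.le g z.1 • A z.1 z.2‖ₑ ^ 2) :=
        lintegral_mono fun z => enorm_add_sq_le _ _
    _ = 2 * (ENNReal.ofReal (Cns n s / 2) * gagliardo n s (besselInv n hs0.le g)) +
          2 * ∫⁻ z : E n × E n, ‖besselInv n hs0.le g z.1 • A z.1 z.2‖ₑ ^ 2 := by
        rw [lintegral_add_left' (hm.const_mul 2), lintegral_const_mul' _ _ (by finiteness),
          lintegral_const_mul' _ _ (by finiteness), lintegral_enorm_fracGrad_sq hs0 hs1]
    _ ≤ 2 * (ENNReal.ofReal (Cns n s / 2) * (C1 * ‖g‖ₑ ^ 2)) +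
          2 * (1 * ‖g‖ₑ ^ 2 + C2 * ‖g‖ₑ ^ 2) := by
        have h3 := (h2 g).trans (add_le_add le_rfl
          (mul_le_mul' le_rfl (enorm_besselInv_sq_le hs0.le g)))
        have h4 := h1 g
        gcongr
    _ = _ := by ring

theorem exists_scalar_le {n : ℕ} (hn : 1 ≤ n) {s : ℝ} (hs0 : 0 < s)
    {Ω : Set (E n)} (hΩ : MeasurableSet Ω) {A : E n → E n → EC n} {q : E n → ℝ}
    (hAq : P0 s Ω A q) :
    ∃ C : ℝ≥0∞, C ≠ ∞ ∧ ∀ g : L2 n,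
      ∫⁻ x in Ω, ‖q x‖ₑ * ‖besselInv n hs0.le g x‖ₑ ^ 2 ≤ C * ‖g‖ₑ ^ 2 := by
  obtain ⟨C, hC, h⟩ := exists_scalar_small hn hs0 hΩ hAq one_ne_zero
  refine ⟨1 + C, by finiteness, fun g => (h g).trans ?_⟩
  rw [add_mul]
  exact add_le_add le_rfl (mul_le_mul' le_rfl (enorm_besselInv_sq_le hs0.le g))

/-! ### The bilinear form -/

theorem AEStronglyMeasurable.dot {n : ℕ} {α : Type*} [MeasurableSpace α] {μ : Measure α}
    {f g : α → EC n} (hf : AEStronglyMeasurable f μ) (hg : AEStronglyMeasurable g μ) :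
    AEStronglyMeasurable (fun x => FMSE.dot (f x) (g x)) μ := by
  unfold FMSE.dot
  fun_prop

theorem lintegral_add_sq {α : Type*} [MeasurableSpace α] {μ : Measure α} {w a b : α → ℝ≥0∞}
    (hw : AEMeasurable w μ) (ha : AEMeasurable a μ) :
    ∫⁻ x, w x * (a x ^ 2 + b x ^ 2) ∂μ =
      ∫⁻ x, w x * a x ^ 2 ∂μ + ∫⁻ x, w x * b x ^ 2 ∂μ := by
  simp_rw [mul_add]
  exact lintegral_add_left' (hw.mul (ha.pow_const 2)) _

theorem lintegral_enorm_dot_le {n : ℕ} (s : ℝ) {A : E n → E n → EC n}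
    (hA : AEStronglyMeasurable (fun z : E n × E n => A z.1 z.2) volume) (u v : L2 n) :
    ∫⁻ z : E n × E n, ‖dot (magGrad s A u z.1 z.2) (magGrad s A v z.1 z.2)‖ₑ ≤
      (∫⁻ z : E n × E n, ‖magGrad s A u z.1 z.2‖ₑ ^ 2) +
        ∫⁻ z : E n × E n, ‖magGrad s A v z.1 z.2‖ₑ ^ 2 := by
  rw [← lintegral_add_left' ((aestronglyMeasurable_magGrad s hA u).enorm.pow_const 2)]
  exact lintegral_mono fun z => enorm_dot_le _ _

theorem lintegral_enorm_scalar_le {n : ℕ} {Ω : Set (E n)} {q : E n → ℝ}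
    (hq : AEStronglyMeasurable q (volume.restrict Ω)) (u v : L2 n) :
    ∫⁻ x in Ω, ‖(q x : ℂ) * u x * v x‖ₑ ≤
      (∫⁻ x in Ω, ‖q x‖ₑ * ‖u x‖ₑ ^ 2) + ∫⁻ x in Ω, ‖q x‖ₑ * ‖v x‖ₑ ^ 2 := by
  rw [← lintegral_add_sq hq.enorm (Lp.aestronglyMeasurable u).enorm.restrict]
  refine lintegral_mono fun x => ?_
  have h1 : ‖(q x : ℂ)‖ₑ = ‖q x‖ₑ := by
    rw [← ofReal_norm, ← ofReal_norm, Complex.norm_real]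
  rw [enorm_mul, enorm_mul, h1, mul_assoc]
  gcongr
  exact enorm_mul_le_sq_add_sq _ _

theorem integrable_dot {n : ℕ} (hn : 1 ≤ n) {s : ℝ} (hs0 : 0 < s) (hs1 : s < 1)
    {Ω : Set (E n)} {A : E n → E n → EC n} {q : E n → ℝ} (hAq : P0 s Ω A q) (g h : L2 n) :
    Integrable fun z : E n × E n => dot (magGrad s A (besselInv n hs0.le g) z.1 z.2)
      (magGrad s A (besselInv n hs0.le h) z.1 z.2) := by
  obtain ⟨C, hC, hb⟩ := exists_magGrad_le hn hs0 hs1 hAq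
  refine ⟨AEStronglyMeasurable.dot (aestronglyMeasurable_magGrad s hAq.measurable_A _)
    (aestronglyMeasurable_magGrad s hAq.measurable_A _), ?_⟩
  refine lt_of_le_of_lt ((lintegral_enorm_dot_le s hAq.measurable_A _ _).trans
    (add_le_add (hb g) (hb h))) ?_
  have : C * ‖g‖ₑ ^ 2 + C * ‖h‖ₑ ^ 2 ≠ ∞ := by finiteness
  exact this.lt_top

theorem integrable_scalar {n : ℕ} (hn : 1 ≤ n) {s : ℝ} (hs0 : 0 < s)
    {Ω : Set (E n)} (hΩ : MeasurableSet Ω) {A : E n → E n → EC n} {q : E n → ℝ}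
    (hAq : P0 s Ω A q) (g h : L2 n) :
    IntegrableOn (fun x => (q x : ℂ) * besselInv n hs0.le g x * besselInv n hs0.le h x) Ω := by
  obtain ⟨C, hC, hb⟩ := exists_scalar_le hn hs0 hΩ hAq
  have hq := hAq.memLp_q.1
  refine ⟨((Complex.continuous_ofReal.comp_aestronglyMeasurable hq).mul
    (Lp.aestronglyMeasurable _).restrict).mul (Lp.aestronglyMeasurable _).restrict, ?_⟩
  refine lt_of_le_of_lt ((lintegral_enorm_scalar_le hq _ _).trans
    (add_le_add (hb g) (hb h))) ?_
  have : C * ‖g‖ₑ ^ 2 + C * ‖h‖ₑ ^ 2 ≠ ∞ := by finiteness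
  exact this.lt_top

theorem magGrad_add_ae {n : ℕ} (s : ℝ) (A : E n → E n → EC n) (u v : L2 n) :
    ∀ᵐ z : E n × E n, magGrad s A (u + v : L2 n) z.1 z.2 =
      magGrad s A u z.1 z.2 + magGrad s A v z.1 z.2 := by
  have h := Lp.coeFn_add u v
  filter_upwards [ae_fst_of_ae h, ae_snd_of_ae h] with z h1 h2
  simp only [magGrad, fracGrad, h1, h2, Pi.add_apply]
  module

theorem magGrad_smul_ae {n : ℕ} (s : ℝ) (A : E n → E n → EC n) (c : ℂ) (u : L2 n) :
    ∀ᵐ z : E n × E n, magGrad s A (c • u : L2 n) z.1 z.2 = c • magGrad s A u z.1 z.2 := by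
  have h := Lp.coeFn_smul c u
  filter_upwards [ae_fst_of_ae h, ae_snd_of_ae h] with z h1 h2
  simp only [magGrad, fracGrad, h1, h2, Pi.smul_apply, smul_eq_mul]
  module

/-- No conjugation enters the form, so the adjoint problem is the equation itself; both solvability
and the duality argument use this. -/
theorem bilin_comm {n : ℕ} (s : ℝ) (Ω : Set (E n)) (A : E n → E n → EC n) (q : E n → ℝ)
    (u v : L2 n) : bilin s Ω A q u v = bilin s Ω A q v u := by
  unfold bilin
  congr 1
  · exact integral_congr_ae (Eventually.of_forall fun z => dot_comm _ _)
  · exact integral_congr_ae (Eventually.of_forall fun x => by ring)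

theorem bilin_smul_left {n : ℕ} (s : ℝ) (Ω : Set (E n)) (A : E n → E n → EC n) (q : E n → ℝ)
    (c : ℂ) (u v : L2 n) : bilin s Ω A q (c • u) v = c * bilin s Ω A q u v := by
  unfold bilin
  rw [mul_add, ← integral_const_mul, ← integral_const_mul]
  congr 1
  · refine integral_congr_ae ?_
    filter_upwards [magGrad_smul_ae s A c u] with z hz
    rw [hz, dot_smul_left]
  · refine integral_congr_ae ?_
    filter_upwards [ae_restrict_of_ae (Lp.coeFn_smul c u)] with x hx
    rw [hx, Pi.smul_apply, smul_eq_mul]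
    ring

theorem bilin_add_left {n : ℕ} (hn : 1 ≤ n) {s : ℝ} (hs0 : 0 < s) (hs1 : s < 1)
    {Ω : Set (E n)} (hΩ : MeasurableSet Ω) {A : E n → E n → EC n} {q : E n → ℝ}
    (hAq : P0 s Ω A q) (g h k : L2 n) :
    bilin s Ω A q (besselInv n hs0.le g + besselInv n hs0.le h) (besselInv n hs0.le k) =
      bilin s Ω A q (besselInv n hs0.le g) (besselInv n hs0.le k) +
        bilin s Ω A q (besselInv n hs0.le h) (besselInv n hs0.le k) := by
  unfold bilin
  rw [add_add_add_comm, ← integral_add (integrable_dot hn hs0 hs1 hAq g k)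
    (integrable_dot hn hs0 hs1 hAq h k), ← integral_add (integrable_scalar hn hs0 hΩ hAq g k)
    (integrable_scalar hn hs0 hΩ hAq h k)]
  congr 1
  · refine integral_congr_ae ?_
    filter_upwards [magGrad_add_ae s A (besselInv n hs0.le g) (besselInv n hs0.le h)] with z hz
    rw [hz, dot_add_left]
  · refine integral_congr_ae ?_
    filter_upwards [ae_restrict_of_ae (Lp.coeFn_add (besselInv n hs0.le g) (besselInv n hs0.le h))]
      with x hx
    rw [hx, Pi.add_apply]
    ring

/-- On unit balls the crude inequality `ab ≤ a² + b²` suffices; `LinearMap.norm_le_of_unit_bound`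
restores homogeneity. -/
theorem exists_bilin_bound {n : ℕ} (hn : 1 ≤ n) {s : ℝ} (hs0 : 0 < s) (hs1 : s < 1)
    {Ω : Set (E n)} (hΩ : MeasurableSet Ω) {A : E n → E n → EC n} {q : E n → ℝ}
    (hAq : P0 s Ω A q) : ∃ C : ℝ, ∀ g h : L2 n, ‖g‖ ≤ 1 → ‖h‖ ≤ 1 →
      ‖bilin s Ω A q (besselInv n hs0.le g) (besselInv n hs0.le h)‖ ≤ C := by
  obtain ⟨C1, hC1, h1⟩ := exists_magGrad_le hn hs0 hs1 hAq
  obtain ⟨C2, hC2, h2⟩ := exists_scalar_le hn hs0 hΩ hAq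
  have hfin : C1 + C1 + (C2 + C2) ≠ ∞ := by finiteness
  refine ⟨(C1 + C1 + (C2 + C2)).toReal, fun g h hg hh => ?_⟩
  have key : ∀ (C : ℝ≥0∞) (k : L2 n), ‖k‖ ≤ 1 → C * ‖k‖ₑ ^ 2 ≤ C := by
    intro C k hk
    refine mul_le_of_le_one_right zero_le (pow_le_one₀ zero_le ?_)
    rw [← ofReal_norm]
    exact ENNReal.ofReal_le_one.2 hk
  rw [← toReal_enorm]
  refine ENNReal.toReal_mono hfin ((enorm_add_le _ _).trans ?_)
  refine add_le_add ?_ ?_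
  · refine (enorm_integral_le_lintegral_enorm _).trans
      ((lintegral_enorm_dot_le s hAq.measurable_A _ _).trans ?_)
    exact add_le_add ((h1 g).trans (key _ _ hg)) ((h1 h).trans (key _ _ hh))
  · refine (enorm_integral_le_lintegral_enorm _).trans
      ((lintegral_enorm_scalar_le hAq.memLp_q.1 _ _).trans ?_)
    exact add_le_add ((h2 g).trans (key _ _ hg)) ((h2 h).trans (key _ _ hh))

theorem LinearMap.norm_le_of_unit_bound {X Y : Type*} [NormedAddCommGroup X] [NormedSpace ℂ X]
    [NormedAddCommGroup Y] [NormedSpace ℂ Y] (b : X →ₗ[ℂ] Y →ₗ[ℂ] ℂ) {C : ℝ}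
    (h : ∀ x y, ‖x‖ ≤ 1 → ‖y‖ ≤ 1 → ‖b x y‖ ≤ C) (x : X) (y : Y) :
    ‖b x y‖ ≤ C * ‖x‖ * ‖y‖ := by
  by_cases hx : x = 0
  · simp [hx]
  by_cases hy : y = 0
  · simp [hy]
  have hx' := norm_pos_iff.2 hx
  have hy' := norm_pos_iff.2 hy
  have h1 := h ((‖x‖ : ℂ)⁻¹ • x) ((‖y‖ : ℂ)⁻¹ • y)
    (by rw [norm_smul, norm_inv, Complex.norm_real, norm_norm, inv_mul_cancel₀ hx'.ne'])
    (by rw [norm_smul, norm_inv, Complex.norm_real, norm_norm, inv_mul_cancel₀ hy'.ne'])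
  rw [map_smul, map_smul, LinearMap.smul_apply, norm_smul, norm_smul, norm_inv, norm_inv,
    Complex.norm_real, Complex.norm_real, norm_norm, norm_norm, inv_mul_le_iff₀ hy',
    inv_mul_le_iff₀ hx'] at h1
  linarith

/-- The bilinear form, in terms of the Bessel potentials, is continuous. -/
theorem exists_bilinCLM {n : ℕ} (hn : 1 ≤ n) {s : ℝ} (hs0 : 0 < s) (hs1 : s < 1)
    {Ω : Set (E n)} (hΩ : MeasurableSet Ω) {A : E n → E n → EC n} {q : E n → ℝ}
    (hAq : P0 s Ω A q) : ∃ b : L2 n →L[ℂ] L2 n →L[ℂ] ℂ, ∀ g h,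
      b g h = bilin s Ω A q (besselInv n hs0.le g) (besselInv n hs0.le h) := by
  obtain ⟨C, hC⟩ := exists_bilin_bound hn hs0 hs1 hΩ hAq
  let b : L2 n →ₗ[ℂ] L2 n →ₗ[ℂ] ℂ := LinearMap.mk₂ ℂ
    (fun g h => bilin s Ω A q (besselInv n hs0.le g) (besselInv n hs0.le h))
    (fun g h k => by rw [map_add, bilin_add_left hn hs0 hs1 hΩ hAq])
    (fun c g k => by rw [map_smul, bilin_smul_left, smul_eq_mul])
    (fun k g h => by
      rw [map_add, bilin_comm, bilin_add_left hn hs0 hs1 hΩ hAq, bilin_comm s Ω A q _ (_ : L2 n),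
        bilin_comm s Ω A q (besselInv n hs0.le h)])
    (fun c k g => by
      rw [map_smul, bilin_comm, bilin_smul_left, smul_eq_mul, bilin_comm])
  exact ⟨b.mkContinuous₂ C (LinearMap.norm_le_of_unit_bound b hC), fun g h => rfl⟩

end FMSE

end

noncomputable section

namespace FMSE

open MeasureTheory TemperedDistribution Filter Topology Module
open scoped ENNReal

/-! ### Compactness: approximation by averages over small cubes -/

/-- The half-open cube of side `r` with index `k ∈ ℤⁿ`. -/
def cube {n : ℕ} (r : ℝ) (k : Fin n → ℤ) : Set (E n) := {x | ∀ i, ⌊x i / r⌋ = k i}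

theorem measurableSet_cube {n : ℕ} (r : ℝ) (k : Fin n → ℤ) : MeasurableSet (cube r k) := by
  have h : cube r k = ⋂ i, {x : E n | ⌊x i / r⌋ = k i} := by
    ext x; simp [cube]
  rw [h]
  refine MeasurableSet.iInter fun i => ?_
  have hm : Measurable fun x : E n => ⌊x i / r⌋ := by fun_prop
  exact hm (measurableSet_singleton (k i))

theorem pairwise_disjoint_cube {n : ℕ} (r : ℝ) :
    Pairwise (Function.onFun Disjoint (cube (n := n) r)) := by
  intro k l hkl
  refine Set.disjoint_left.2 fun x hx hy => hkl ?_
  ext i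
  rw [← hx i, ← hy i]

theorem volume_cube {n : ℕ} {r : ℝ} (hr : 0 < r) (k : Fin n → ℤ) :
    volume (cube r k) = ENNReal.ofReal (r ^ n) := by
  have h : cube r k = (WithLp.ofLp : E n → Fin n → ℝ) ⁻¹'
      (Set.pi Set.univ fun i => Set.Ico (k i * r) ((k i + 1) * r)) := by
    ext x
    simp only [cube, Set.mem_ofPred_eq, Set.mem_preimage, Set.mem_pi, Set.mem_univ, true_imp_iff,
      Set.mem_Ico, Int.floor_eq_iff]
    refine forall_congr' fun i => ?_
    rw [le_div_iff₀ hr, div_lt_iff₀ hr]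
  rw [h, (PiLp.volume_preserving_ofLp (Fin n)).measure_preimage
    (MeasurableSet.univ_pi fun i => measurableSet_Ico).nullMeasurableSet, Real.volume_pi_Ico]
  have h2 : ∀ i : Fin n, ((k i : ℝ) + 1) * r - k i * r = r := fun i => by ring
  simp [h2, ENNReal.ofReal_pow hr.le]

theorem norm_sub_le_of_mem_cube {n : ℕ} {r : ℝ} (hr : 0 < r) {k : Fin n → ℤ} {x y : E n}
    (hx : x ∈ cube r k) (hy : y ∈ cube r k) : ‖y - x‖ ≤ √n * r := by
  rw [EuclideanSpace.norm_eq]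
  refine Real.sqrt_le_iff.2 ⟨by positivity, ?_⟩
  rw [mul_pow, Real.sq_sqrt (by positivity)]
  have h : ∀ i ∈ (Finset.univ : Finset (Fin n)), ‖(y - x) i‖ ^ 2 ≤ r ^ 2 := by
    intro i _
    rw [PiLp.sub_apply, Real.norm_eq_abs]
    have h1 := Int.floor_eq_iff.1 (hx i)
    have h2 := Int.floor_eq_iff.1 (hy i)
    rw [le_div_iff₀ hr, div_lt_iff₀ hr] at h1 h2
    have h3 : |y i - x i| ≤ r := abs_le.2 ⟨by linarith, by linarith⟩
    gcongr
  refine (Finset.sum_le_sum h).trans ?_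
  simp

theorem exists_finset_cube {n : ℕ} {Ω : Set (E n)} (hΩ : Bornology.IsBounded Ω) {r : ℝ}
    (hr : 0 < r) : ∃ T : Finset (Fin n → ℤ), Ω ⊆ ⋃ k ∈ T, cube r k := by
  obtain ⟨R, hR⟩ := hΩ.exists_norm_le
  refine ⟨Fintype.piFinset fun _ => Finset.Icc ⌊-R / r⌋ ⌊R / r⌋, fun x hx => ?_⟩
  refine Set.mem_iUnion₂.2 ⟨fun i => ⌊x i / r⌋, ?_, fun i => rfl⟩
  refine Fintype.mem_piFinset.2 fun i => Finset.mem_Icc.2 ?_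
  have h1 : |x i| ≤ R := by
    rw [← Real.norm_eq_abs]
    exact (PiLp.norm_apply_le x i).trans (hR x hx)
  have h2 := abs_le.1 h1
  exact ⟨Int.floor_le_floor (by gcongr; exact h2.1), Int.floor_le_floor (by gcongr; exact h2.2)⟩

theorem lintegral_sq_le {α : Type*} [MeasurableSpace α] {μ : Measure α} {f : α → ℝ≥0∞}
    (hf : AEMeasurable f μ) : (∫⁻ x, f x ∂μ) ^ 2 ≤ μ Set.univ * ∫⁻ x, f x ^ 2 ∂μ := by
  have h := ENNReal.lintegral_mul_le_Lp_mul_Lq μ Real.HolderConjugate.two_two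
    (aemeasurable_const (b := (1 : ℝ≥0∞))) hf
  simp only [Pi.mul_apply, one_mul, lintegral_const, ENNReal.rpow_two, one_pow] at h
  have hsq : ∀ I : ℝ≥0∞, (I ^ (1 / 2 : ℝ)) ^ 2 = I := by
    intro I
    rw [← ENNReal.rpow_two, ← ENNReal.rpow_mul]
    norm_num
  calc (∫⁻ x, f x ∂μ) ^ 2
      ≤ (μ Set.univ ^ (1 / 2 : ℝ) * (∫⁻ x, f x ^ 2 ∂μ) ^ (1 / 2 : ℝ)) ^ 2 := by gcongr
    _ = _ := by rw [mul_pow, hsq, hsq]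

/-- A Poincaré inequality with explicit mean value. -/
theorem lintegral_sq_le_mean_add {α : Type*} [MeasurableSpace α] {μ : Measure α}
    [IsFiniteMeasure μ] (hμ : μ Set.univ ≠ 0) {u : α → ℂ} (hu : Integrable u μ) :
    ∫⁻ x, ‖u x‖ₑ ^ 2 ∂μ ≤ 2 * (μ Set.univ)⁻¹ * ‖∫ x, u x ∂μ‖ₑ ^ 2 +
      2 * (μ Set.univ)⁻¹ * ∫⁻ z, ‖u z.1 - u z.2‖ₑ ^ 2 ∂(μ.prod μ) := by
  set M := μ Set.univ with hM
  have hMtop : M ≠ ∞ := measure_ne_top μ _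
  set w : ℂ := ∫ x, u x ∂μ with hw
  have hpt : ∀ x, M ^ 2 * ‖u x‖ₑ ^ 2 ≤ 2 * ‖w‖ₑ ^ 2 + 2 * (M * ∫⁻ y, ‖u x - u y‖ₑ ^ 2 ∂μ) := by
    intro x
    -- The total mass times `u x` is the integral of `u` plus the integrated differences; squaring
    -- and Cauchy–Schwarz give the pointwise bound.
    have h1 : ((μ.real Set.univ : ℝ) : ℂ) * u x = w + ∫ y, (u x - u y) ∂μ := by
      rw [integral_sub (integrable_const _) hu, integral_const, ← hw, Complex.real_smul]
      ring
    have h2 : ‖((μ.real Set.univ : ℝ) : ℂ)‖ₑ = M := by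
      rw [← ofReal_norm, Complex.norm_real, Real.norm_of_nonneg measureReal_nonneg]
      exact ENNReal.ofReal_toReal hMtop
    calc M ^ 2 * ‖u x‖ₑ ^ 2 = ‖w + ∫ y, (u x - u y) ∂μ‖ₑ ^ 2 := by
          rw [← h1, enorm_mul, h2, mul_pow]
      _ ≤ 2 * ‖w‖ₑ ^ 2 + 2 * ‖∫ y, (u x - u y) ∂μ‖ₑ ^ 2 := enorm_add_sq_le _ _
      _ ≤ 2 * ‖w‖ₑ ^ 2 + 2 * (∫⁻ y, ‖u x - u y‖ₑ ∂μ) ^ 2 := by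
          gcongr
          exact enorm_integral_le_lintegral_enorm _
      _ ≤ _ := by
          gcongr
          exact lintegral_sq_le (aestronglyMeasurable_const.sub hu.1).enorm
  have hint := lintegral_mono (μ := μ) hpt
  have hm : AEMeasurable (fun z : α × α => ‖u z.1 - u z.2‖ₑ ^ 2) (μ.prod μ) :=
    (hu.1.comp_fst.sub hu.1.comp_snd).enorm.pow_const 2
  rw [lintegral_const_mul' _ _ (by finiteness), lintegral_add_left' aemeasurable_const,
    lintegral_const, lintegral_const_mul' _ _ (by finiteness), lintegral_const_mul' _ _ hMtop,
    ← lintegral_prod _ hm, ← hM] at hint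
  have hinv : M⁻¹ ^ 2 * M ^ 2 = 1 := by
    rw [← mul_pow, ENNReal.inv_mul_cancel hμ hMtop, one_pow]
  have hinv1 : M⁻¹ * M = 1 := ENNReal.inv_mul_cancel hμ hMtop
  calc ∫⁻ x, ‖u x‖ₑ ^ 2 ∂μ = M⁻¹ ^ 2 * (M ^ 2 * ∫⁻ x, ‖u x‖ₑ ^ 2 ∂μ) := by
        rw [← mul_assoc, hinv, one_mul]
    _ ≤ M⁻¹ ^ 2 * (2 * ‖w‖ₑ ^ 2 * M +
          2 * (M * ∫⁻ z, ‖u z.1 - u z.2‖ₑ ^ 2 ∂(μ.prod μ))) := by gcongr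
    _ = (M⁻¹ * M) * (2 * M⁻¹ * ‖w‖ₑ ^ 2 +
          2 * M⁻¹ * ∫⁻ z, ‖u z.1 - u z.2‖ₑ ^ 2 ∂(μ.prod μ)) := by ring
    _ = _ := by rw [hinv1, one_mul]

/-- Within a cube `|x - y| ≤ √n r`, so the singular kernel, multiplied by `(√n r) ^ (n + 2s)`, is at
least `1` off the diagonal. Against the factor `r ^ (-n)` of the Poincaré inequality this leaves `r
^ (2s)`, which is small with `r`. -/
theorem setLIntegral_cube_le {n : ℕ} {s : ℝ} (hs0 : 0 < s) {r : ℝ} (hr : 0 < r) (k : Fin n → ℤ)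
    (u : L2 n) : ∫⁻ x in cube r k, ‖u x‖ₑ ^ 2 ≤
      2 * (ENNReal.ofReal (r ^ n))⁻¹ * ‖∫ x in cube r k, u x‖ₑ ^ 2 +
        ENNReal.ofReal (2 * √n ^ (n + 2 * s) * r ^ (2 * s)) *
          ∫⁻ z in cube r k ×ˢ cube r k, ‖u z.1 - u z.2‖ₑ ^ 2 *
            ENNReal.ofReal (‖z.2 - z.1‖ ^ (-(n + 2 * s))) := by
  have hvol := volume_cube hr k
  have hfin : IsFiniteMeasure (volume.restrict (cube r k)) :=
    ⟨by rw [Measure.restrict_apply_univ, hvol]; exact ENNReal.ofReal_lt_top⟩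
  have hu : Integrable u (volume.restrict (cube r k)) :=
    ((Lp.memLp u).restrict _).integrable (by norm_num)
  have h := lintegral_sq_le_mean_add (μ := volume.restrict (cube r k))
    (by rw [Measure.restrict_apply_univ, hvol]; exact (ENNReal.ofReal_pos.2 (by positivity)).ne') hu
  rw [Measure.restrict_apply_univ, hvol, Measure.prod_restrict, ← Measure.volume_eq_prod] at h
  refine h.trans (add_le_add le_rfl ?_)
  rw [← lintegral_const_mul' _ _ ENNReal.ofReal_ne_top, ← lintegral_const_mul' _ _
    (ENNReal.mul_ne_top (by simp) (ENNReal.inv_ne_top.2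
      (ENNReal.ofReal_pos.2 (by positivity)).ne'))]
  refine setLIntegral_mono_ae' ((measurableSet_cube r k).prod (measurableSet_cube r k))
    (Eventually.of_forall fun z hz => ?_)
  by_cases hz0 : z.2 - z.1 = 0
  · rw [sub_eq_zero.1 hz0]; simp
  have hd : 0 < ‖z.2 - z.1‖ := norm_pos_iff.2 hz0
  have hle := norm_sub_le_of_mem_cube hr hz.1 hz.2
  have h2 : (2 : ℝ≥0∞) * (ENNReal.ofReal (r ^ n))⁻¹ = ENNReal.ofReal (2 * (r ^ n)⁻¹) := by
    rw [ENNReal.ofReal_mul (by norm_num), ENNReal.ofReal_inv_of_pos (by positivity)]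
    simp
  rw [h2, mul_comm (‖_‖ₑ ^ 2) (ENNReal.ofReal (_ ^ _)), ← mul_assoc,
    ← ENNReal.ofReal_mul (by positivity)]
  refine mul_le_mul' (ENNReal.ofReal_le_ofReal ?_) le_rfl
  have h3 : (1 : ℝ) ≤ (√n * r) ^ (n + 2 * s) * ‖z.2 - z.1‖ ^ (-(n + 2 * s)) := by
    rw [Real.rpow_neg hd.le, ← div_eq_mul_inv, one_le_div (by positivity)]
    exact Real.rpow_le_rpow hd.le hle (by positivity)
  calc 2 * (r ^ n)⁻¹ = 2 * (r ^ n)⁻¹ * 1 := by ring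
    _ ≤ 2 * (r ^ n)⁻¹ * ((√n * r) ^ (n + 2 * s) * ‖z.2 - z.1‖ ^ (-(n + 2 * s))) := by gcongr
    _ = _ := by
      rw [Real.mul_rpow (by positivity) hr.le, Real.rpow_add hr, Real.rpow_natCast]
      field_simp

theorem exists_small_side {n : ℕ} {s : ℝ} (hs0 : 0 < s) {δ : ℝ} (hδ : 0 < δ) :
    ∃ r : ℝ, 0 < r ∧ 2 * √n ^ (n + 2 * s) * r ^ (2 * s) ≤ δ := by
  have hlim : Tendsto (fun r : ℝ => 2 * √n ^ (n + 2 * s) * r ^ (2 * s)) (𝓝[>] 0)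
      (𝓝 (2 * √n ^ (n + 2 * s) * 0 ^ (2 * s))) := by
    refine Tendsto.const_mul _ ?_
    exact ((Real.continuous_rpow_const (by positivity)).tendsto 0).mono_left nhdsWithin_le_nhds
  rw [Real.zero_rpow (by positivity), mul_zero] at hlim
  obtain ⟨r, h1, h2⟩ := ((hlim.eventually (ge_mem_nhds hδ)).and self_mem_nhdsWithin).exists
  exact ⟨r, h2, h1⟩

/-- On functions supported in a bounded set, the `L²` norm is bounded by finitely many linear
functionals, up to a small multiple of the Gagliardo seminorm. -/
theorem exists_finite_rank {n : ℕ} {s : ℝ} (hs0 : 0 < s) {Ω : Set (E n)}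
    (hΩ : Bornology.IsBounded Ω) {δ : ℝ} (hδ : 0 < δ) :
    ∃ (T : Finset (Fin n → ℤ)) (F : L2 n →L[ℂ] (T → ℂ)) (C : ℝ≥0∞), C ≠ ∞ ∧ ∀ u : L2 n,
      (∀ᵐ x, x ∉ Ω → u x = 0) →
        ‖u‖ₑ ^ 2 ≤ C * ‖F u‖ₑ ^ 2 + ENNReal.ofReal δ * gagliardo n s u := by
  obtain ⟨r, hr, hrδ⟩ := exists_small_side (n := n) hs0 hδ
  obtain ⟨T, hT⟩ := exists_finset_cube hΩ hr
  have hvol : ∀ k : Fin n → ℤ, volume (cube r k) ≠ ∞ := fun k => by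
    rw [volume_cube hr k]; exact ENNReal.ofReal_ne_top
  -- The functionals are the integrals over the finitely many cubes covering `Ω`, written as inner
  -- products with indicators.
  let F : L2 n →L[ℂ] (T → ℂ) := ContinuousLinearMap.pi fun k =>
    innerSL ℂ (indicatorConstLp 2 (measurableSet_cube r k.1) (hvol k.1) (1 : ℂ))
  have hF : ∀ u k, F u k = ∫ x in cube r k.1, u x := fun u k =>
    L2.inner_indicatorConstLp_one (measurableSet_cube r k.1) (hvol k.1) u
  have hr0 : ENNReal.ofReal (r ^ n) ≠ 0 := (ENNReal.ofReal_pos.2 (by positivity)).ne'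
  refine ⟨T, F, T.card * (2 * (ENNReal.ofReal (r ^ n))⁻¹), by finiteness, fun u hu => ?_⟩
  have hcover : ‖u‖ₑ ^ 2 ≤ ∑ k ∈ T, ∫⁻ x in cube r k, ‖u x‖ₑ ^ 2 := by
    rw [enorm_L2_sq, ← lintegral_biUnion_finset
      ((pairwise_disjoint_cube r).set_pairwise _) (fun k _ => measurableSet_cube r k),
      ← lintegral_indicator (T.measurableSet_biUnion fun k _ => measurableSet_cube r k)]
    refine lintegral_mono_ae ?_
    filter_upwards [hu] with x hx
    by_cases hxT : x ∈ ⋃ k ∈ T, cube r k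
    · rw [Set.indicator_of_mem hxT]
    · rw [hx fun h => hxT (hT h)]; simp
  -- The diagonal blocks are pairwise disjoint, so the local seminorms add up to at most the global
  -- one, whatever the number of cubes.
  have hgag : ∑ k ∈ T, ∫⁻ z in cube r k ×ˢ cube r k, ‖u z.1 - u z.2‖ₑ ^ 2 *
      ENNReal.ofReal (‖z.2 - z.1‖ ^ (-(n + 2 * s))) ≤ gagliardo n s u := by
    rw [← lintegral_biUnion_finset (s := T) (t := fun k => cube r k ×ˢ cube r k)]
    · exact setLIntegral_le_lintegral _ _
    · intro k _ l _ hkl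
      exact Set.disjoint_prod.2 (Or.inl (pairwise_disjoint_cube r hkl))
    · exact fun k _ => (measurableSet_cube r k).prod (measurableSet_cube r k)
  calc ‖u‖ₑ ^ 2 ≤ ∑ k ∈ T, ∫⁻ x in cube r k, ‖u x‖ₑ ^ 2 := hcover
    _ ≤ ∑ k ∈ T, (2 * (ENNReal.ofReal (r ^ n))⁻¹ * ‖F u‖ₑ ^ 2 +
        ENNReal.ofReal δ *
          ∫⁻ z in cube r k ×ˢ cube r k, ‖u z.1 - u z.2‖ₑ ^ 2 *
            ENNReal.ofReal (‖z.2 - z.1‖ ^ (-(n + 2 * s)))) := by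
        refine Finset.sum_le_sum fun k hk => (setLIntegral_cube_le hs0 hr k u).trans ?_
        refine add_le_add (mul_le_mul' le_rfl ?_)
          (mul_le_mul' (ENNReal.ofReal_le_ofReal hrδ) le_rfl)
        rw [← hF u ⟨k, hk⟩]
        gcongr
        rw [← ofReal_norm, ← ofReal_norm]
        exact ENNReal.ofReal_le_ofReal (norm_le_pi_norm (F u) ⟨k, hk⟩)
    _ ≤ _ := by
        rw [Finset.sum_add_distrib, Finset.sum_const, nsmul_eq_mul, ← Finset.mul_sum]
        exact add_le_add (le_of_eq (by ring)) (mul_le_mul' le_rfl hgag)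

end FMSE

end

noncomputable section

namespace FMSE

open MeasureTheory TemperedDistribution Filter Topology Module
open scoped SchwartzMap ENNReal ComplexConjugate

/-! ### The Gårding inequality -/

/-- Because `r` is real, pairing with the conjugate makes the principal term the square `x²`, where
`x = ‖c • toComplex r‖`. With `y = ‖U • a‖` the other terms are at least `-2xy - y²`, and `(x - 2y)²
≥ 0` absorbs the mixed one. -/
theorem dot_conj_lower_bound {n : ℕ} (c U : ℂ) (r : E n) (a : EC n) :
    2⁻¹ * ‖c • toComplex r‖ ^ 2 ≤
      (dot (c • toComplex r + U • a) (conj c • toComplex r + conj U • a)).re +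
        3 * ‖U • a‖ ^ 2 := by
  have h1 : (dot (c • toComplex r) (conj c • toComplex r)).re = ‖c • toComplex r‖ ^ 2 := by
    rw [dot_smul_left, dot_smul_right, dot_toComplex_self, ← mul_assoc, Complex.mul_conj,
      ← Complex.ofReal_mul, Complex.ofReal_re, norm_smul, norm_toComplex, mul_pow,
      Complex.normSq_eq_norm_sq]
  have hc : ‖conj c • toComplex r‖ = ‖c • toComplex r‖ := by
    rw [norm_smul, norm_smul, Complex.norm_conj]
  have hU : ‖conj U • a‖ = ‖U • a‖ := by
    rw [norm_smul, norm_smul, Complex.norm_conj]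
  have key : ∀ x y : EC n, -(‖x‖ * ‖y‖) ≤ (dot x y).re := fun x y =>
    (neg_le_neg (norm_dot_le x y)).trans (abs_le.1 (Complex.abs_re_le_norm _)).1
  have h2 := key (c • toComplex r) (conj U • a)
  have h3 := key (U • a) (conj c • toComplex r)
  have h4 := key (U • a) (conj U • a)
  rw [hU] at h2 h4
  rw [hc] at h3
  rw [dot_add_left, dot_add_right, dot_add_right, Complex.add_re, Complex.add_re, Complex.add_re,
    h1]
  nlinarith [sq_nonneg (‖c • toComplex r‖ - 2 * ‖U • a‖)]

theorem integrable_norm_sq_of_lintegral {α F : Type*} [MeasurableSpace α] {μ : Measure α}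
    [NormedAddCommGroup F] {f : α → F} (hf : AEStronglyMeasurable f μ)
    (h : ∫⁻ x, ‖f x‖ₑ ^ 2 ∂μ ≠ ∞) : Integrable (fun x => ‖f x‖ ^ 2) μ := by
  refine ⟨hf.norm.pow 2, ?_⟩
  rw [hasFiniteIntegral_iff_enorm]
  simpa only [enorm_pow, enorm_norm] using h.lt_top

theorem ofReal_integral_norm_sq {α F : Type*} [MeasurableSpace α] {μ : Measure α}
    [NormedAddCommGroup F] {f : α → F} (hf : AEStronglyMeasurable f μ)
    (h : ∫⁻ x, ‖f x‖ₑ ^ 2 ∂μ ≠ ∞) :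
    ENNReal.ofReal (∫ x, ‖f x‖ ^ 2 ∂μ) = ∫⁻ x, ‖f x‖ₑ ^ 2 ∂μ := by
  rw [ofReal_integral_eq_lintegral_ofReal (integrable_norm_sq_of_lintegral hf h)
    (Eventually.of_forall fun _ => by positivity)]
  refine lintegral_congr fun x => ?_
  rw [ENNReal.ofReal_pow (norm_nonneg _), ofReal_norm]

/-- Integrate `dot_conj_lower_bound` with `u` tested against its conjugate; clearing the factor
`1/2` gives the coefficients `2`, `6`, `2`. -/
theorem lintegral_fracGrad_le {n : ℕ} (hn : 1 ≤ n) {s : ℝ} (hs0 : 0 < s) (hs1 : s < 1)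
    {Ω : Set (E n)} {A : E n → E n → EC n} {q : E n → ℝ}
    (hAq : P0 s Ω A q) {g h : L2 n}
    (hgh : ∀ᵐ x, besselInv n hs0.le h x = conj (besselInv n hs0.le g x)) :
    ∫⁻ z : E n × E n, ‖fracGrad s (besselInv n hs0.le g) z.1 z.2‖ₑ ^ 2 ≤
      2 * ‖bilin s Ω A q (besselInv n hs0.le g) (besselInv n hs0.le h)‖ₑ +
      6 * (∫⁻ z : E n × E n, ‖besselInv n hs0.le g z.1 • A z.1 z.2‖ₑ ^ 2) +
      2 * ∫⁻ x in Ω, ‖q x‖ₑ * ‖besselInv n hs0.le g x‖ₑ ^ 2 := by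
  set u := besselInv n hs0.le g with hu
  set v := besselInv n hs0.le h with hv
  obtain ⟨C1, hC1, h1⟩ := exists_gagliardo_le hn hs0 hs1
  obtain ⟨C2, hC2, h2⟩ := exists_potential_small hn hs0 hAq one_ne_zero
  have hD : ∫⁻ z : E n × E n, ‖fracGrad s u z.1 z.2‖ₑ ^ 2 ≠ ∞ := by
    rw [lintegral_enorm_fracGrad_sq hs0 hs1]
    exact ENNReal.mul_ne_top ENNReal.ofReal_ne_top (ne_top_of_le_ne_top (by finiteness) (h1 g))
  have hW : ∫⁻ z : E n × E n, ‖u z.1 • A z.1 z.2‖ₑ ^ 2 ≠ ∞ :=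
    ne_top_of_le_ne_top (by finiteness) (h2 g)
  have hDm := aestronglyMeasurable_fracGrad s u
  have hWm := aestronglyMeasurable_smul_potential hAq.measurable_A u
  have hDi := integrable_norm_sq_of_lintegral hDm hD
  have hWi := integrable_norm_sq_of_lintegral hWm hW
  have hdi := integrable_dot hn hs0 hs1 hAq g h
  set I := ∫ z : E n × E n, dot (magGrad s A u z.1 z.2) (magGrad s A v z.1 z.2) with hI
  set S := ∫ x in Ω, (q x : ℂ) * u x * v x with hS
  have hpt : ∀ᵐ z : E n × E n, 2⁻¹ * ‖fracGrad s u z.1 z.2‖ ^ 2 ≤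
      (dot (magGrad s A u z.1 z.2) (magGrad s A v z.1 z.2)).re +
        3 * ‖u z.1 • A z.1 z.2‖ ^ 2 := by
    filter_upwards [ae_fst_of_ae hgh, ae_snd_of_ae hgh] with z hz1 hz2
    have := dot_conj_lower_bound (u z.1 - u z.2) (u z.1) (alpha s z.1 z.2) (A z.1 z.2)
    rw [map_sub, ← hz1, ← hz2] at this
    exact this
  have hmono := integral_mono_ae (hDi.const_mul 2⁻¹) (hdi.re.add (hWi.const_mul 3)) hpt
  have hsplit := integral_add hdi.re (hWi.const_mul 3)
  have hre : ∫ z : E n × E n, RCLike.re (dot (magGrad s A u z.1 z.2) (magGrad s A v z.1 z.2)) =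
      I.re := integral_re hdi
  rw [integral_const_mul] at hmono
  rw [integral_const_mul, hre] at hsplit
  replace hmono := hmono.trans_eq hsplit
  have hQ : ENNReal.ofReal ‖S‖ ≤ ∫⁻ x in Ω, ‖q x‖ₑ * ‖u x‖ₑ ^ 2 := by
    rw [ofReal_norm]
    refine (enorm_integral_le_lintegral_enorm _).trans (le_of_eq (lintegral_congr_ae ?_))
    filter_upwards [ae_restrict_of_ae hgh] with x hx
    have h3 : ‖(q x : ℂ)‖ₑ = ‖q x‖ₑ := by
      rw [← ofReal_norm, ← ofReal_norm, Complex.norm_real]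
    have h4 : ‖conj (u x)‖ₑ = ‖u x‖ₑ := by
      rw [← ofReal_norm, ← ofReal_norm, Complex.norm_conj]
    rw [hx, enorm_mul, enorm_mul, h3, h4]
    ring
  have hbil : I.re ≤ ‖bilin s Ω A q u v‖ + ‖S‖ := by
    have h5 : I = bilin s Ω A q u v - S := by
      rw [bilin]; ring
    calc I.re ≤ ‖I‖ := Complex.re_le_norm I
      _ ≤ _ := by rw [h5]; exact norm_sub_le _ _
  rw [← ofReal_integral_norm_sq hDm hD, ← ofReal_integral_norm_sq hWm hW]
  have hWn : 0 ≤ ∫ z : E n × E n, ‖u z.1 • A z.1 z.2‖ ^ 2 :=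
    integral_nonneg fun _ => by positivity
  calc ENNReal.ofReal (∫ z : E n × E n, ‖fracGrad s u z.1 z.2‖ ^ 2)
      ≤ ENNReal.ofReal (2 * ‖bilin s Ω A q u v‖ + 6 * (∫ z : E n × E n, ‖u z.1 • A z.1 z.2‖ ^ 2) +
          2 * ‖S‖) := by
        refine ENNReal.ofReal_le_ofReal ?_
        linarith
    _ = 2 * ‖bilin s Ω A q u v‖ₑ + 6 * ENNReal.ofReal (∫ z : E n × E n, ‖u z.1 • A z.1 z.2‖ ^ 2) +
          2 * ENNReal.ofReal ‖S‖ := by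
        rw [ENNReal.ofReal_add (by positivity) (by positivity),
          ENNReal.ofReal_add (by positivity) (by positivity), ENNReal.ofReal_mul (by norm_num),
          ENNReal.ofReal_mul (by norm_num), ENNReal.ofReal_mul (by norm_num),
          ofReal_norm (bilin s Ω A q u v)]
        norm_num
    _ ≤ _ := by gcongr

theorem ENNReal.le_of_le_add_half {N S : ℝ≥0∞} (hN : N ≠ ∞) (h : N ≤ S + 2⁻¹ * N) :
    N ≤ 2 * S := by
  lift N to NNReal using hN
  by_cases hS : S = ∞
  · rw [hS]; simp
  lift S to NNReal using hS
  have h2 : (2⁻¹ : ℝ≥0∞) = ((2⁻¹ : NNReal) : ℝ≥0∞) := by simp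
  have h3 : (2 : ℝ≥0∞) = ((2 : NNReal) : ℝ≥0∞) := by simp
  rw [h2] at h
  rw [h3]
  norm_cast at h ⊢
  have h' : (N : ℝ) ≤ S + 2⁻¹ * N := by exact_mod_cast h
  have : (N : ℝ) ≤ 2 * S := by linarith
  exact_mod_cast this

theorem exists_pos_mul_le_half {K : ℝ≥0∞} (hK : K ≠ ∞) : ∃ ε : ℝ, 0 < ε ∧
    K * ENNReal.ofReal ε ≤ 2⁻¹ := by
  lift K to NNReal using hK
  refine ⟨(2 * ((K : ℝ) + 1))⁻¹, by positivity, ?_⟩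
  rw [← ENNReal.ofReal_coe_nnreal, ← ENNReal.ofReal_mul (by positivity)]
  have h2 : (2⁻¹ : ℝ≥0∞) = ENNReal.ofReal 2⁻¹ := by
    rw [ENNReal.ofReal_inv_of_pos (by norm_num)]; simp
  rw [h2]
  refine ENNReal.ofReal_le_ofReal ?_
  rw [mul_inv_le_iff₀ (by positivity)]
  linarith

theorem exists_garding {n : ℕ} (hn : 1 ≤ n) {s : ℝ} (hs0 : 0 < s) (hs1 : s < 1)
    {Ω : Set (E n)} (hΩ : MeasurableSet Ω) {A : E n → E n → EC n} {q : E n → ℝ}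
    (hAq : P0 s Ω A q) : ∃ C : ℝ≥0∞, C ≠ ∞ ∧ ∀ (γ : 𝓢(E n, ℂ)) (h : L2 n),
    (∀ᵐ x, besselInv n hs0.le h x = conj (besselInv n hs0.le (toL2 γ) x)) →
    ‖toL2 γ‖ₑ ^ 2 ≤ C * (‖bilin s Ω A q (besselInv n hs0.le (toL2 γ)) (besselInv n hs0.le h)‖ₑ +
      ‖besselInv n hs0.le (toL2 γ)‖ₑ ^ 2) := by
  obtain ⟨K₀, hK₀, hlow⟩ := exists_enorm_le_gagliardo hn hs0 hs1
  have hc : ENNReal.ofReal (Cns n s / 2) ≠ 0 :=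
    (ENNReal.ofReal_pos.2 (half_pos (Cns_pos hs0 hs1))).ne'
  set c := ENNReal.ofReal (Cns n s / 2) with hcdef
  have hctop : c ≠ ∞ := ENNReal.ofReal_ne_top
  have hK : K₀ * c⁻¹ ≠ ∞ := ENNReal.mul_ne_top hK₀ (ENNReal.inv_ne_top.2 hc)
  set K := K₀ * c⁻¹ with hKdef
  -- Here `8 = 6 + 2` collects the coefficients of the two potential terms, so that together they
  -- cost at most half of the squared `Hˢ` norm and can be absorbed.
  obtain ⟨ε, hε, hεK⟩ := exists_pos_mul_le_half (K := 8 * K) (by finiteness)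
  have hε' : ENNReal.ofReal ε ≠ 0 := (ENNReal.ofReal_pos.2 hε).ne'
  obtain ⟨C1, hC1, h1⟩ := exists_potential_small hn hs0 hAq hε'
  obtain ⟨C2, hC2, h2⟩ := exists_scalar_small hn hs0 hΩ hAq hε'
  refine ⟨2 * (1 + 2 * K + K * (6 * C1 + 2 * C2)), by finiteness, fun γ h hgh => ?_⟩
  have hfrac := lintegral_fracGrad_le hn hs0 hs1 hAq hgh
  have hγ := hlow γ
  rw [lintegral_enorm_fracGrad_sq hs0 hs1, ← hcdef] at hfrac
  have hg : K₀ * gagliardo n s (besselInv n hs0.le (toL2 γ)) =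
      K * (c * gagliardo n s (besselInv n hs0.le (toL2 γ))) := by
    rw [hKdef, mul_assoc, ← mul_assoc c⁻¹, ENNReal.inv_mul_cancel hc hctop, one_mul]
  rw [hg] at hγ
  replace h1 := h1 (toL2 γ)
  replace h2 := h2 (toL2 γ)
  have hN : ‖toL2 γ‖ₑ ^ 2 ≠ ∞ := by finiteness
  generalize ‖toL2 γ‖ₑ ^ 2 = N at *
  generalize ‖bilin s Ω A q (besselInv n hs0.le (toL2 γ)) (besselInv n hs0.le h)‖ₑ = β at *
  generalize ‖besselInv n hs0.le (toL2 γ)‖ₑ ^ 2 = U at *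
  generalize ∫⁻ z : E n × E n, ‖besselInv n hs0.le (toL2 γ) z.1 • A z.1 z.2‖ₑ ^ 2 = W at *
  generalize ∫⁻ x in Ω, ‖q x‖ₑ * ‖besselInv n hs0.le (toL2 γ) x‖ₑ ^ 2 = Q at *
  generalize c * gagliardo n s (besselInv n hs0.le (toL2 γ)) = D at *
  have hmain : N ≤ (U + 2 * K * β + K * (6 * C1 + 2 * C2) * U) + 2⁻¹ * N := by
    calc N ≤ U + K * D := hγ
      _ ≤ U + K * (2 * β + 6 * (ENNReal.ofReal ε * N + C1 * U) +
            2 * (ENNReal.ofReal ε * N + C2 * U)) := by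
          refine add_le_add le_rfl (mul_le_mul' le_rfl (hfrac.trans ?_))
          gcongr
      _ = (U + 2 * K * β + K * (6 * C1 + 2 * C2) * U) + 8 * K * ENNReal.ofReal ε * N := by ring
      _ ≤ _ := by gcongr
  refine (ENNReal.le_of_le_add_half hN hmain).trans ?_
  rw [mul_assoc 2 (1 + 2 * K + K * (6 * C1 + 2 * C2))]
  refine mul_le_mul' le_rfl ?_
  calc U + 2 * K * β + K * (6 * C1 + 2 * C2) * U
      ≤ (1 + 2 * K + K * (6 * C1 + 2 * C2)) * U + (1 + 2 * K + K * (6 * C1 + 2 * C2)) * β := by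
        have e1 : (1 + 2 * K + K * (6 * C1 + 2 * C2)) * U + (1 + 2 * K + K * (6 * C1 + 2 * C2)) * β
          = (U + 2 * K * β + K * (6 * C1 + 2 * C2) * U) +
            (2 * K * U + β + K * (6 * C1 + 2 * C2) * β) := by ring
        rw [e1]
        exact le_self_add
    _ = _ := by ring

/-- The Gårding inequality up to finitely many linear functionals. -/
theorem exists_garding_finite_rank {n : ℕ} (hn : 1 ≤ n) {s : ℝ} (hs0 : 0 < s) (hs1 : s < 1)
    {Ω : Set (E n)} (hΩ : MeasurableSet Ω) (hΩb : Bornology.IsBounded Ω)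
    {A : E n → E n → EC n} {q : E n → ℝ} (hAq : P0 s Ω A q) :
    ∃ (T : Finset (Fin n → ℤ)) (F : L2 n →L[ℂ] (T → ℂ)) (C : ℝ≥0∞), C ≠ ∞ ∧
      ∀ (γ : 𝓢(E n, ℂ)) (h : L2 n),
      (∀ᵐ x, besselInv n hs0.le h x = conj (besselInv n hs0.le (toL2 γ) x)) →
      (∀ᵐ x, x ∉ Ω → besselInv n hs0.le (toL2 γ) x = 0) →
      ‖toL2 γ‖ₑ ^ 2 ≤ C *
        (‖bilin s Ω A q (besselInv n hs0.le (toL2 γ)) (besselInv n hs0.le h)‖ₑ +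
          ‖F (toL2 γ)‖ₑ ^ 2) := by
  obtain ⟨C, hC, hgar⟩ := exists_garding hn hs0 hs1 hΩ hAq
  obtain ⟨K, hK, hgag⟩ := exists_gagliardo_le hn hs0 hs1
  -- The `L²` term of the Gårding inequality is replaced by the functionals plus `δ` times the
  -- seminorm; `K` bounds the seminorm by the `Hˢ` norm, so this `δ` allows absorption.
  obtain ⟨δ, hδ, hδK⟩ := exists_pos_mul_le_half (K := C * K) (by finiteness)
  obtain ⟨T, F, C', hC', hF⟩ := exists_finite_rank hs0 hΩb hδ
  refine ⟨T, F ∘L besselInv n hs0.le, 2 * (C * (1 + C')), by finiteness, fun γ h hgh hsupp => ?_⟩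
  have h1 := hgar γ h hgh
  have h2 := hF _ hsupp
  have h3 := hgag (toL2 γ)
  have hN : ‖toL2 γ‖ₑ ^ 2 ≠ ∞ := by finiteness
  rw [ContinuousLinearMap.comp_apply]
  generalize ‖toL2 γ‖ₑ ^ 2 = N at *
  generalize ‖bilin s Ω A q (besselInv n hs0.le (toL2 γ)) (besselInv n hs0.le h)‖ₑ = β at *
  generalize ‖F (besselInv n hs0.le (toL2 γ))‖ₑ ^ 2 = f at *
  have hmain : N ≤ C * (β + C' * f) + 2⁻¹ * N := by
    calc N ≤ C * (β + (C' * f + ENNReal.ofReal δ * (K * N))) :=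
          h1.trans (by gcongr; exact h2.trans (by gcongr))
      _ = C * (β + C' * f) + C * K * ENNReal.ofReal δ * N := by ring
      _ ≤ _ := by gcongr
  refine (ENNReal.le_of_le_add_half hN hmain).trans ?_
  rw [mul_assoc, mul_assoc]
  refine mul_le_mul' le_rfl (mul_le_mul' le_rfl ?_)
  calc β + C' * f ≤ (β + C' * f) + (f + C' * β) := le_self_add
    _ = _ := by ring

end FMSE

end

noncomputable section

namespace FMSE

open MeasureTheory TemperedDistribution Filter Topology Module
open scoped SchwartzMap ContDiff ComplexConjugate

/-! ### Linear functional analysis -/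

/-- Otherwise there are unit vectors `y k` with `T (y k) → 0`. The bounded sequence `F (y k)` has a
convergent subsequence, since `V` is proper; `hC` applied to differences makes the vectors Cauchy
along it, and their limit is a unit vector killed by `T`. -/
theorem exists_le_of_finite_rank {X Y V : Type*} [NormedAddCommGroup X] [NormedSpace ℂ X]
    [CompleteSpace X] [NormedAddCommGroup Y] [NormedSpace ℂ Y] [NormedAddCommGroup V]
    [NormedSpace ℂ V] [ProperSpace V] (T : X →L[ℂ] Y) (F : X →L[ℂ] V) {C : ℝ}
    (hC : ∀ x, ‖x‖ ≤ C * (‖T x‖ + ‖F x‖)) (hT : ∀ x, T x = 0 → x = 0) :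
    ∃ c : ℝ, ∀ x, ‖x‖ ≤ c * ‖T x‖ := by
  by_contra! hcon
  have hex : ∀ k : ℕ, ∃ y : X, ‖y‖ = 1 ∧ ‖T y‖ ≤ ((k : ℝ) + 1)⁻¹ := by
    intro k
    obtain ⟨x, hx⟩ := hcon ((k : ℝ) + 1)
    have hx0 : 0 < ‖x‖ := lt_of_le_of_lt (by positivity) hx
    refine ⟨(‖x‖ : ℂ)⁻¹ • x, ?_, ?_⟩
    · rw [norm_smul, norm_inv, Complex.norm_real, norm_norm, inv_mul_cancel₀ hx0.ne']
    · rw [map_smul, norm_smul, norm_inv, Complex.norm_real, norm_norm, inv_mul_le_iff₀ hx0,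
        ← div_eq_mul_inv, le_div_iff₀ (by positivity)]
      linarith
  choose y hy1 hyT using hex
  have hFb : ∀ k, F (y k) ∈ Metric.closedBall (0 : V) ‖F‖ := by
    intro k
    rw [mem_closedBall_zero_iff]
    simpa [hy1 k] using F.le_opNorm (y k)
  obtain ⟨a, -, ns, hns, hlim⟩ := (isCompact_closedBall (0 : V) ‖F‖).tendsto_subseq hFb
  have hT0 : Tendsto (fun k => T (y (ns k))) atTop (𝓝 0) := by
    refine squeeze_zero_norm (fun k => hyT (ns k)) ?_
    have h1 : Tendsto (fun k : ℕ => ((k : ℝ) + 1)⁻¹) atTop (𝓝 0) := by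
      simpa [one_div] using tendsto_one_div_add_atTop_nhds_zero_nat (𝕜 := ℝ)
    exact h1.comp hns.tendsto_atTop
  have hcauchy : CauchySeq fun k => y (ns k) := by
    have hTc := hT0.cauchySeq
    have hFc : CauchySeq fun k => F (y (ns k)) := hlim.cauchySeq
    rw [Metric.cauchySeq_iff] at hTc hFc ⊢
    intro ε hε
    have hη : 0 < ε / (2 * (|C| + 1)) := by positivity
    obtain ⟨N1, hN1⟩ := hTc _ hη
    obtain ⟨N2, hN2⟩ := hFc _ hη
    refine ⟨max N1 N2, fun i hi j hj => ?_⟩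
    have h1 := hN1 i (le_of_max_le_left hi) j (le_of_max_le_left hj)
    have h2 := hN2 i (le_of_max_le_right hi) j (le_of_max_le_right hj)
    rw [dist_eq_norm, ← map_sub] at h1 h2
    rw [dist_eq_norm]
    have hlt : ‖T (y (ns i) - y (ns j))‖ + ‖F (y (ns i) - y (ns j))‖ < ε / (|C| + 1) := by
      have : ε / (|C| + 1) = ε / (2 * (|C| + 1)) + ε / (2 * (|C| + 1)) := by field_simp; ring
      linarith
    rw [lt_div_iff₀ (by positivity)] at hlt
    refine (hC _).trans_lt (lt_of_le_of_lt ?_ hlt)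
    rw [mul_comm]
    exact mul_le_mul_of_nonneg_left ((le_abs_self C).trans (by linarith)) (by positivity)
  obtain ⟨z, hz⟩ := cauchySeq_tendsto_of_complete hcauchy
  have hz1 : ‖z‖ = 1 := by
    refine tendsto_nhds_unique hz.norm ?_
    simp only [hy1]
    exact tendsto_const_nhds
  have hz0 : T z = 0 := tendsto_nhds_unique ((T.continuous.tendsto z).comp hz) hT0
  rw [hT z hz0, norm_zero] at hz1
  exact zero_ne_one hz1

/-- An injective symmetric bilinear form that is bounded below represents all functionals. -/
theorem exists_forall_eq_of_symm {X : Type*} [NormedAddCommGroup X] [InnerProductSpace ℂ X]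
    [CompleteSpace X] (T : X →L[ℂ] X →L[ℂ] ℂ) (hsymm : ∀ x y, T x y = T y x) {c : ℝ}
    (hc : ∀ x, ‖x‖ ≤ c * ‖T x‖) (l : X →L[ℂ] ℂ) : ∃ x, T x = l := by
  have hanti : AntilipschitzWith c.toNNReal T := by
    refine T.antilipschitz_of_bound fun x => (hc x).trans ?_
    gcongr
    exact Real.le_coe_toNNReal c
  have hclosed : IsClosed (Set.range T) := hanti.isClosed_range T.uniformContinuous
  let D := InnerProductSpace.toDual ℂ X
  -- `M` consists of the Riesz representatives of the range. A vector `w` orthogonal to `M`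
  -- satisfies `T x w = 0` for all `x`; by symmetry `T w = 0`, and the lower bound gives `w = 0`.
  let M : Submodule ℂ X := Submodule.comap D.toLinearEquiv.toLinearMap T.range
  have hM : IsClosed (M : Set X) := hclosed.preimage D.continuous
  have hMtop : M = ⊤ := by
    have := hM.isComplete
    have hproj : M.HasOrthogonalProjection := by
      have : CompleteSpace M := hM.completeSpace_coe
      infer_instance
    rw [← Submodule.orthogonal_eq_bot_iff, Submodule.eq_bot_iff]
    intro w hw
    have h1 : ∀ x, T x w = 0 := by
      intro x
      have h2 : D.symm (T x) ∈ M := by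
        change D (D.symm (T x)) ∈ T.range
        rw [LinearIsometryEquiv.apply_symm_apply]
        exact ⟨x, rfl⟩
      have h3 := (Submodule.mem_orthogonal M w).1 hw _ h2
      rwa [InnerProductSpace.toDual_symm_apply] at h3
    have h4 : T w = 0 := by
      ext x
      rw [hsymm, h1]; rfl
    have h5 := hc w
    rw [h4, norm_zero, mul_zero] at h5
    exact norm_le_zero_iff.1 h5
  have h6 : D.symm l ∈ M := hMtop ▸ Submodule.mem_top
  have h7 : D (D.symm l) ∈ T.range := h6
  rw [LinearIsometryEquiv.apply_symm_apply] at h7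
  exact h7

/-! ### Bessel potentials of test functions -/

theorem zero_mem_TestFun {n : ℕ} (U : Set (E n)) : (0 : E n → ℂ) ∈ TestFun U :=
  ⟨contDiff_const, HasCompactSupport.zero, by simp [tsupport]⟩

theorem add_mem_TestFun {n : ℕ} {U : Set (E n)} {f g : E n → ℂ} (hf : f ∈ TestFun U)
    (hg : g ∈ TestFun U) : f + g ∈ TestFun U :=
  ⟨hf.1.add hg.1, hf.2.1.add hg.2.1,
    (tsupport_add f g).trans (Set.union_subset hf.2.2 hg.2.2)⟩

theorem smul_mem_TestFun {n : ℕ} {U : Set (E n)} (c : ℂ) {f : E n → ℂ} (hf : f ∈ TestFun U) :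
    c • f ∈ TestFun U :=
  ⟨hf.1.const_smul c, hf.2.1.smul_left (f := fun _ => c),
    (closure_mono (Function.support_const_smul_subset c f)).trans hf.2.2⟩

theorem conj_mem_TestFun {n : ℕ} {U : Set (E n)} {f : E n → ℂ} (hf : f ∈ TestFun U) :
    (fun x => conj (f x)) ∈ TestFun U := by
  have h : Function.support (fun x => conj (f x)) = Function.support f := by
    ext x; simp
  refine ⟨Complex.conjCLE.contDiff.comp hf.1, hf.2.1.comp_left (map_zero _), ?_⟩
  rw [tsupport, h]
  exact hf.2.2

/-- The Bessel potentials of the test functions in `U`. -/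
def besselTest {n : ℕ} {s : ℝ} (hs : 0 ≤ s) (U : Set (E n)) : Submodule ℂ (L2 n) where
  carrier := {g | besselInv n hs g ∈ TestL2 U}
  zero_mem' := by
    refine ⟨0, zero_mem_TestFun U, ?_⟩
    rw [map_zero]
    exact Lp.coeFn_zero _ _ _
  add_mem' := by
    rintro g h ⟨f, hf, hgf⟩ ⟨k, hk, hhk⟩
    refine ⟨f + k, add_mem_TestFun hf hk, ?_⟩
    rw [map_add]
    exact (Lp.coeFn_add _ _).trans (hgf.add hhk)
  smul_mem' := by
    rintro c g ⟨f, hf, hgf⟩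
    refine ⟨c • f, smul_mem_TestFun c hf, ?_⟩
    rw [map_smul]
    exact (Lp.coeFn_smul _ _).trans (hgf.const_smul c)

theorem mem_besselTest {n : ℕ} {s : ℝ} (hs : 0 ≤ s) (U : Set (E n)) (g : L2 n) :
    g ∈ besselTest hs U ↔ besselInv n hs g ∈ TestL2 U := Iff.rfl

/-- The `Hˢ` norm of `besselInv g` is `‖g‖`, so the closure in `Hˢ` becomes an ordinary closure in
`L²`. -/
theorem mem_HsTilde_iff {n : ℕ} {s : ℝ} (hs : 0 ≤ s) (U : Set (E n)) (u : L2 n) :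
    u ∈ HsTilde s U ↔ ∃ g ∈ (besselTest hs U).topologicalClosure, besselInv n hs g = u := by
  constructor
  · rintro ⟨hu, happ⟩
    obtain ⟨g, rfl⟩ := (mem_Hs_iff hs u).1 hu
    refine ⟨g, ?_, rfl⟩
    refine Metric.mem_closure_iff.2 fun ε hε => ?_
    obtain ⟨φ, hφ, hlt⟩ := happ ε hε
    obtain ⟨k, hk, hkε⟩ := (HsNormLt_iff hs _ _).1 hlt
    refine ⟨g - k, ?_, ?_⟩
    · change besselInv n hs (g - k) ∈ TestL2 U
      rw [map_sub, hk, sub_sub_cancel]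
      exact hφ
    · rwa [dist_eq_norm, sub_sub_cancel]
  · rintro ⟨g, hg, rfl⟩
    refine ⟨(mem_Hs_iff hs _).2 ⟨g, rfl⟩, fun ε hε => ?_⟩
    obtain ⟨k, hk, hkε⟩ := Metric.mem_closure_iff.1 hg ε hε
    refine ⟨besselInv n hs k, hk, (HsNormLt_iff hs _ _).2 ⟨g - k, map_sub _ _ _, ?_⟩⟩
    rwa [← dist_eq_norm]

theorem exists_schwartz_of_TestFun {n : ℕ} {s : ℝ} (hs : 0 ≤ s) {U : Set (E n)} {f : E n → ℂ}
    (hf : f ∈ TestFun U) :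
    ∃ γ : 𝓢(E n, ℂ), besselInv n hs (toL2 γ) =ᵐ[volume] f := by
  obtain ⟨γ, hγ⟩ := exists_schwartz_besselInv_eq hs (hf.2.1.toSchwartzMap hf.1)
  refine ⟨γ, ?_⟩
  rw [hγ]
  exact coeFn_toL2 _

theorem exists_schwartz_of_mem_besselTest {n : ℕ} {s : ℝ} (hs : 0 ≤ s) {U : Set (E n)} {g : L2 n}
    (hg : g ∈ besselTest hs U) : ∃ γ : 𝓢(E n, ℂ), toL2 γ = g := by
  obtain ⟨f, hf, hgf⟩ := hg
  obtain ⟨γ, hγ⟩ := exists_schwartz_of_TestFun hs hf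
  exact ⟨γ, besselInv_injective hs (Lp.ext (hγ.trans hgf.symm))⟩

/-- Complex conjugation is bounded in the `Hˢ` norm. -/
theorem exists_conj {n : ℕ} (hn : 1 ≤ n) {s : ℝ} (hs0 : 0 < s) (hs1 : s < 1) :
    ∃ C : ℝ, 0 ≤ C ∧ ∀ (U : Set (E n)), ∀ g ∈ besselTest hs0.le U, ∃ h ∈ besselTest hs0.le U,
      (∀ᵐ x, besselInv n hs0.le h x = conj (besselInv n hs0.le g x)) ∧ ‖h‖ ≤ C * ‖g‖ := by
  obtain ⟨C1, hC1, h1⟩ := exists_gagliardo_le hn hs0 hs1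
  obtain ⟨C2, hC2, h2⟩ := exists_enorm_le_gagliardo hn hs0 hs1
  have hfin : 1 + C2 * C1 ≠ ⊤ := by finiteness
  -- Conjugation preserves the `L²` norm and the Gagliardo seminorm, which together are equivalent
  -- to the `Hˢ` norm; the constant is the loss in that equivalence.
  refine ⟨√(1 + C2 * C1).toReal, Real.sqrt_nonneg _, ?_⟩
  rintro U g ⟨f, hf, hgf⟩
  obtain ⟨γ, hγ⟩ := exists_schwartz_of_TestFun hs0.le (conj_mem_TestFun hf)
  have hconj : ∀ᵐ x, besselInv n hs0.le (toL2 γ) x = conj (besselInv n hs0.le g x) := by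
    filter_upwards [hγ, hgf] with x hx1 hx2
    rw [hx1, hx2]
  refine ⟨toL2 γ, ⟨_, conj_mem_TestFun hf, hγ⟩, hconj, ?_⟩
  have hnorm : ‖besselInv n hs0.le (toL2 γ)‖ₑ ^ 2 = ‖besselInv n hs0.le g‖ₑ ^ 2 := by
    rw [enorm_L2_sq, enorm_L2_sq]
    refine lintegral_congr_ae ?_
    filter_upwards [hconj] with x hx
    rw [hx, ← ofReal_norm, ← ofReal_norm, Complex.norm_conj]
  have hgag : gagliardo n s (besselInv n hs0.le (toL2 γ)) =
      gagliardo n s (besselInv n hs0.le g) := by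
    refine lintegral_congr_ae ?_
    filter_upwards [ae_fst_of_ae hconj, ae_snd_of_ae hconj] with z hz1 hz2
    rw [hz1, hz2, ← map_sub, ← ofReal_norm, ← ofReal_norm, Complex.norm_conj]
  have h3 := h2 γ
  rw [hnorm, hgag] at h3
  have h4 : ‖toL2 γ‖ₑ ^ 2 ≤ (1 + C2 * C1) * ‖g‖ₑ ^ 2 := by
    refine h3.trans ?_
    rw [add_mul, one_mul, mul_assoc]
    exact add_le_add (enorm_besselInv_sq_le hs0.le g) (mul_le_mul' le_rfl (h1 g))
  have h5 := ENNReal.toReal_mono (by finiteness) h4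
  rw [ENNReal.toReal_mul, ENNReal.toReal_pow, ENNReal.toReal_pow, toReal_enorm, toReal_enorm] at h5
  refine abs_le_of_sq_le_sq' ?_ (by positivity) |>.2
  rwa [mul_pow, Real.sq_sqrt ENNReal.toReal_nonneg]

/-- Vanishing outside `U` is the kernel of a continuous restriction map, hence a closed condition,
and test functions satisfy it. -/
theorem ae_eq_zero_of_mem_closure {n : ℕ} {s : ℝ} (hs : 0 ≤ s) {U : Set (E n)}
    (hU : MeasurableSet U) {g : L2 n} (hg : g ∈ (besselTest hs U).topologicalClosure) :
    ∀ᵐ x, x ∉ U → besselInv n hs g x = 0 := by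
  let ρ := LpToLpRestrictCLM (E n) ℂ ℂ (volume : Measure (E n)) 2 Uᶜ
  have hρ : ∀ u : L2 n, ρ u = 0 ↔ ∀ᵐ x, x ∉ U → u x = 0 := by
    intro u
    have h1 := LpToLpRestrictCLM_coeFn ℂ Uᶜ u
    have h2 : (∀ᵐ x, x ∉ U → u x = 0) ↔ u =ᵐ[volume.restrict Uᶜ] 0 :=
      (ae_restrict_iff' hU.compl).symm
    rw [h2, Lp.eq_zero_iff_ae_eq_zero]
    exact ⟨fun h => h1.symm.trans h, fun h => h1.trans h⟩
  have hcl : IsClosed {g : L2 n | ρ (besselInv n hs g) = 0} :=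
    isClosed_eq (ρ.continuous.comp (besselInv n hs).continuous) continuous_const
  have hsub : (besselTest hs U : Set (L2 n)) ⊆ {g | ρ (besselInv n hs g) = 0} := by
    rintro k ⟨f, hf, hkf⟩
    refine (hρ _).2 ?_
    filter_upwards [hkf] with x hx hxU
    rw [hx]
    exact image_eq_zero_of_notMem_tsupport fun h => hxU (hf.2.2 h)
  exact (hρ _).1 (closure_minimal hsub hcl hg)

end FMSE

end

noncomputable section

namespace FMSE

open MeasureTheory TemperedDistribution Filter Topology Module
open scoped SchwartzMap ContDiff ComplexConjugate

/-! ### Solvability of the Dirichlet problem -/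

/-- If the conclusion failed, then `r ≤ a`, so `D r² ≤ D a r`; one factor `a` then cancels and
leaves `a ≤ D C t + D r`, a contradiction. -/
theorem le_mul_add_of_sq_le {a t r D C : ℝ} (ht : 0 ≤ t) (hr : 0 ≤ r) (hD : 0 ≤ D)
    (hC : 0 ≤ C) (h : a ^ 2 ≤ D * (t * (C * a) + r ^ 2)) : a ≤ (D * C + D + 1) * (t + r) := by
  by_contra! hlt
  have hDC : 0 ≤ D * C := mul_nonneg hD hC
  have h1 : t + r ≤ (D * C + D + 1) * (t + r) :=
    le_mul_of_one_le_left (add_nonneg ht hr) (by linarith)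
  have h2 : r ≤ a := by linarith
  have h3 : 0 < a := by linarith
  have h4 := mul_lt_mul_of_pos_left hlt h3
  have h5 : D * r ^ 2 ≤ D * (a * r) := by
    refine mul_le_mul_of_nonneg_left ?_ hD
    nlinarith
  have h6 : 0 ≤ a * t * (D + 1) := by positivity
  have h7 : 0 ≤ a * r * (D * C + 1) := by positivity
  nlinarith

/-- The closure of the Bessel potentials of the test functions in `U`. -/
abbrev besselTilde {n : ℕ} {s : ℝ} (hs : 0 ≤ s) (U : Set (E n)) : Submodule ℂ (L2 n) :=
  (besselTest hs U).topologicalClosure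

/-- A Fredholm alternative for symmetric bilinear forms satisfying a Gårding inequality on a
dense set, up to an operator of finite rank. -/
theorem exists_forall_eq_of_garding {X V : Type*} [NormedAddCommGroup X] [InnerProductSpace ℂ X]
    [CompleteSpace X] [NormedAddCommGroup V] [NormedSpace ℂ V] [ProperSpace V]
    (B : X →L[ℂ] X →L[ℂ] ℂ) (hsymm : ∀ x y, B x y = B y x) {S : Set X} (hSd : Dense S)
    (F : X →L[ℂ] V) {C : ℝ} (hS : ∀ x ∈ S, ∀ t : ℝ, 0 ≤ t → (∀ y ∈ S, ‖B x y‖ ≤ t * ‖y‖) →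
      ‖x‖ ≤ C * (t + ‖F x‖))
    (hinj : ∀ x, (∀ y, B x y = 0) → x = 0) (l : X →L[ℂ] ℂ) : ∃ x, ∀ y, B x y = l y := by
  -- On `S` take `t = ‖B x‖`; both sides are continuous in `x`, so density extends the inequality.
  have hbound : ∀ x, ‖x‖ ≤ C * (‖B x‖ + ‖F x‖) := by
    have hcl : IsClosed {x : X | ‖x‖ ≤ C * (‖B x‖ + ‖F x‖)} :=
      isClosed_le continuous_norm (by fun_prop)
    refine fun x => closure_minimal (fun x hx => ?_) hcl (hSd x)
    exact hS x hx _ (norm_nonneg _) fun y _ => (B x).le_opNorm y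
  obtain ⟨c, hc⟩ := exists_le_of_finite_rank B F hbound fun x hx => hinj x fun y => by rw [hx]; rfl
  obtain ⟨x, hx⟩ := exists_forall_eq_of_symm B hsymm hc l
  exact ⟨x, fun y => DFunLike.congr_fun hx y⟩

theorem exists_forall_mem_closure_eq {X V : Type*} [NormedAddCommGroup X] [InnerProductSpace ℂ X]
    [CompleteSpace X] [NormedAddCommGroup V] [NormedSpace ℂ V] [ProperSpace V]
    (b : X →L[ℂ] X →L[ℂ] ℂ) (hsymm : ∀ x y, b x y = b y x) (S : Submodule ℂ X) (F : X →L[ℂ] V)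
    {C : ℝ} (hS : ∀ x ∈ S, ∀ t : ℝ, 0 ≤ t → (∀ y ∈ S, ‖b x y‖ ≤ t * ‖y‖) →
      ‖x‖ ≤ C * (t + ‖F x‖))
    (hinj : ∀ x ∈ S.topologicalClosure, (∀ y ∈ S.topologicalClosure, b x y = 0) → x = 0)
    (l : X →L[ℂ] ℂ) :
    ∃ x ∈ S.topologicalClosure, ∀ y ∈ S.topologicalClosure, b x y = l y := by
  have hK : CompleteSpace S.topologicalClosure :=
    S.isClosed_topologicalClosure.completeSpace_coe
  have hd : Dense {x : S.topologicalClosure | (x : X) ∈ S} := by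
    intro x
    rw [closure_subtype]
    refine closure_mono ?_ x.2
    exact fun y hy => ⟨⟨y, S.le_topologicalClosure hy⟩, hy, rfl⟩
  obtain ⟨x, hx⟩ := exists_forall_eq_of_garding
    (b.bilinearComp S.topologicalClosure.subtypeL S.topologicalClosure.subtypeL)
    (fun x y => hsymm x y) hd (F.comp S.topologicalClosure.subtypeL) (C := C)
    (fun x hx t ht hxt => hS x hx t ht fun y hy => hxt ⟨y, S.le_topologicalClosure hy⟩ hy)
    (fun x hx => Subtype.ext (hinj x x.2 fun y hy => hx ⟨y, hy⟩))
    (l.comp S.topologicalClosure.subtypeL)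
  exact ⟨x, x.2, fun y hy => hx ⟨y, hy⟩⟩

/-- The Gårding inequality tests `u` against its conjugate, an admissible test function with `Hˢ`
norm at most `C ‖g‖` by `exists_conj`; a bound `t` on the functional thus controls the form by `t C
‖g‖`. -/
theorem exists_apriori {n : ℕ} (hn : 1 ≤ n) {s : ℝ} (hs0 : 0 < s) (hs1 : s < 1) {Ω : Set (E n)}
    (hΩ : MeasurableSet Ω) (hΩb : Bornology.IsBounded Ω) {A : E n → E n → EC n} {q : E n → ℝ}
    (hAq : P0 s Ω A q) :
    ∃ (T : Finset (Fin n → ℤ)) (F : L2 n →L[ℂ] (T → ℂ)) (C : ℝ),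
      ∀ g ∈ besselTest hs0.le Ω, ∀ t : ℝ, 0 ≤ t → (∀ h ∈ besselTest hs0.le Ω,
        ‖bilin s Ω A q (besselInv n hs0.le g) (besselInv n hs0.le h)‖ ≤ t * ‖h‖) →
        ‖g‖ ≤ C * (t + ‖F g‖) := by
  obtain ⟨T, F, D, hD, hF⟩ := exists_garding_finite_rank hn hs0 hs1 hΩ hΩb hAq
  obtain ⟨C, hC, hconj⟩ := exists_conj hn hs0 hs1
  refine ⟨T, F, D.toReal * C + D.toReal + 1, fun g hg t ht hgt => ?_⟩
  obtain ⟨h, hh, hhg, hhC⟩ := hconj Ω g hg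
  have hzero := ae_eq_zero_of_mem_closure hs0.le hΩ ((besselTest hs0.le Ω).le_topologicalClosure hg)
  obtain ⟨γ, rfl⟩ := exists_schwartz_of_mem_besselTest hs0.le hg
  have h1 := ENNReal.toReal_mono (by finiteness) (hF γ h hhg hzero)
  rw [ENNReal.toReal_mul, ENNReal.toReal_add (by finiteness) (by finiteness), ENNReal.toReal_pow,
    ENNReal.toReal_pow, toReal_enorm, toReal_enorm, toReal_enorm] at h1
  refine le_mul_add_of_sq_le ht (norm_nonneg _) ENNReal.toReal_nonneg hC (h1.trans ?_)
  gcongr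
  refine (hgt h hh).trans ?_
  gcongr

theorem solvesIn_iff {n : ℕ} {s : ℝ} (hs : 0 ≤ s) {Ω : Set (E n)} {A : E n → E n → EC n}
    {q : E n → ℝ} {b : L2 n →L[ℂ] L2 n →L[ℂ] ℂ}
    (hb : ∀ g h, b g h = bilin s Ω A q (besselInv n hs g) (besselInv n hs h)) (U : Set (E n))
    (g : L2 n) :
    SolvesIn s Ω A q U (besselInv n hs g) ↔ ∀ k ∈ besselTilde hs U, b g k = 0 := by
  constructor
  · intro h k hk
    rw [hb]
    exact h _ ((mem_HsTilde_iff hs U _).2 ⟨k, hk, rfl⟩)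
  · intro h v hv
    obtain ⟨k, hk, rfl⟩ := (mem_HsTilde_iff hs U v).1 hv
    rw [← hb]
    exact h k hk

theorem isSolution_iff {n : ℕ} {s : ℝ} (hs : 0 ≤ s) {Ω : Set (E n)} {A : E n → E n → EC n}
    {q : E n → ℝ} {b : L2 n →L[ℂ] L2 n →L[ℂ] ℂ}
    (hb : ∀ g h, b g h = bilin s Ω A q (besselInv n hs g) (besselInv n hs h)) (f g : L2 n) :
    IsSolution s Ω A q (besselInv n hs f) (besselInv n hs g) ↔
      g - f ∈ besselTilde hs Ω ∧ ∀ k ∈ besselTilde hs Ω, b g k = 0 := by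
  rw [IsSolution, solvesIn_iff hs hb, ← map_sub, mem_HsTilde_iff hs]
  constructor
  · rintro ⟨-, ⟨k, hk, hkg⟩, h⟩
    exact ⟨besselInv_injective hs hkg ▸ hk, h⟩
  · rintro ⟨h1, h2⟩
    exact ⟨(mem_Hs_iff hs _).2 ⟨g, rfl⟩, ⟨_, h1, rfl⟩, h2⟩

/-- The injectivity required by the Fredholm alternative is the eigenvalue hypothesis: an element of
the kernel is a solution with exterior value zero. -/
theorem exists_solution {n : ℕ} (hn : 1 ≤ n) {s : ℝ} (hs0 : 0 < s) (hs1 : s < 1) {Ω : Set (E n)}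
    (hΩ : MeasurableSet Ω) (hΩb : Bornology.IsBounded Ω) {A : E n → E n → EC n} {q : E n → ℝ}
    (hAq : P0 s Ω A q) (h0 : ZeroNotEigenvalue s Ω A q) {b : L2 n →L[ℂ] L2 n →L[ℂ] ℂ}
    (hb : ∀ g h, b g h = bilin s Ω A q (besselInv n hs0.le g) (besselInv n hs0.le h))
    (l : L2 n →L[ℂ] ℂ) :
    ∃ φ ∈ besselTilde hs0.le Ω, ∀ k ∈ besselTilde hs0.le Ω, b φ k = l k := by
  obtain ⟨T, F, C, hF⟩ := exists_apriori hn hs0 hs1 hΩ hΩb hAq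
  refine exists_forall_mem_closure_eq b (fun g h => by rw [hb, hb, bilin_comm])
    (besselTest hs0.le Ω) F (C := C) (fun g hg t ht hgt => hF g hg t ht fun h hh => ?_)
    (fun g hg hg0 => ?_) l
  · rw [← hb]
    exact hgt h hh
  · have h1 : IsSolution s Ω A q (besselInv n hs0.le 0) (besselInv n hs0.le g) := by
      rw [isSolution_iff hs0.le hb, sub_zero]
      exact ⟨hg, hg0⟩
    rw [map_zero] at h1
    exact besselInv_injective hs0.le ((h0 _ h1).trans (map_zero _).symm)

/-! ### Restrictions to an open set -/

/-- The restriction `L²(ℝⁿ) → L²(Ω)`. -/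
abbrev restrictL2 {n : ℕ} (Ω : Set (E n)) :
    L2 n →L[ℂ] Lp ℂ 2 ((volume : Measure (E n)).restrict Ω) :=
  LpToLpRestrictCLM (E n) ℂ ℂ volume 2 Ω

theorem mem_RungeSet_iff {n : ℕ} {s : ℝ} (hs : 0 ≤ s) {Ω : Set (E n)} {A : E n → E n → EC n}
    {q : E n → ℝ} {b : L2 n →L[ℂ] L2 n →L[ℂ] ℂ}
    (hb : ∀ g h, b g h = bilin s Ω A q (besselInv n hs g) (besselInv n hs h)) (W : Set (E n))
    (w : Lp ℂ 2 ((volume : Measure (E n)).restrict Ω)) :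
    w ∈ RungeSet s Ω A q W ↔ ∃ f ∈ besselTest hs W, ∃ g : L2 n, g - f ∈ besselTilde hs Ω ∧
      (∀ k ∈ besselTilde hs Ω, b g k = 0) ∧ w = restrictL2 Ω (besselInv n hs g) := by
  constructor
  · rintro ⟨f, hf, u, hu, hwu⟩
    obtain ⟨g, rfl⟩ := (mem_Hs_iff hs u).1 hu.1
    obtain ⟨φ, hφ, hfφ⟩ := id hf
    obtain ⟨γ, hγ⟩ := exists_schwartz_of_TestFun hs hφ
    have hγf : besselInv n hs (toL2 γ) = f := Lp.ext (hγ.trans hfφ.symm)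
    rw [← hγf, isSolution_iff hs hb] at hu
    refine ⟨toL2 γ, ?_, g, hu.1, hu.2, Lp.ext (hwu.trans (LpToLpRestrictCLM_coeFn ℂ Ω _).symm)⟩
    rwa [mem_besselTest, hγf]
  · rintro ⟨f, hf, g, h1, h2, rfl⟩
    exact ⟨_, hf, _, (isSolution_iff hs hb f g).2 ⟨h1, h2⟩, LpToLpRestrictCLM_coeFn ℂ Ω _⟩

/-- The Runge set is a subspace of `L²(Ω)`. -/
theorem exists_submodule_RungeSet {n : ℕ} {s : ℝ} (hs : 0 ≤ s) {Ω : Set (E n)}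
    {A : E n → E n → EC n} {q : E n → ℝ} {b : L2 n →L[ℂ] L2 n →L[ℂ] ℂ}
    (hb : ∀ g h, b g h = bilin s Ω A q (besselInv n hs g) (besselInv n hs h)) (W : Set (E n)) :
    ∃ R : Submodule ℂ (Lp ℂ 2 ((volume : Measure (E n)).restrict Ω)),
      (R : Set _) = RungeSet s Ω A q W := by
  refine ⟨{ carrier := RungeSet s Ω A q W, zero_mem' := ?_, add_mem' := ?_, smul_mem' := ?_ }, rfl⟩
  · intro v w hv hw
    rw [mem_RungeSet_iff hs hb] at hv hw ⊢
    obtain ⟨f, hf, g, h1, h2, rfl⟩ := hv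
    obtain ⟨f', hf', g', h1', h2', rfl⟩ := hw
    refine ⟨f + f', add_mem hf hf', g + g', ?_, fun k hk => ?_, ?_⟩
    · rw [add_sub_add_comm]
      exact add_mem h1 h1'
    · rw [map_add, add_apply, h2 k hk, h2' k hk, add_zero]
    · rw [map_add, map_add]
  · rw [mem_RungeSet_iff hs hb]
    refine ⟨0, zero_mem _, 0, ?_, fun k _ => ?_, ?_⟩
    · rw [sub_zero]; exact zero_mem _
    · rw [map_zero]; rfl
    · rw [map_zero, map_zero]
  · intro c v hv
    rw [mem_RungeSet_iff hs hb] at hv ⊢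
    obtain ⟨f, hf, g, h1, h2, rfl⟩ := hv
    refine ⟨c • f, Submodule.smul_mem _ c hf, c • g, ?_, fun k hk => ?_, ?_⟩
    · rw [← smul_sub]
      exact Submodule.smul_mem _ c h1
    · rw [map_smul, smul_apply, h2 k hk, smul_zero]
    · rw [map_smul, map_smul]

/-- Test functions are dense in `L²(Ω)`. -/
theorem eq_zero_of_forall_besselTest {n : ℕ} {s : ℝ} (hs : 0 ≤ s) {Ω : Set (E n)} (hΩo : IsOpen Ω)
    (hΩb : Bornology.IsBounded Ω) (w : Lp ℂ 2 ((volume : Measure (E n)).restrict Ω))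
    (h : ∀ k ∈ besselTest hs Ω, inner ℂ w (restrictL2 Ω (besselInv n hs k)) = 0) : w = 0 := by
  have hfin : IsFiniteMeasure ((volume : Measure (E n)).restrict Ω) :=
    isFiniteMeasure_restrict.2 hΩb.measure_lt_top.ne
  have hint : IntegrableOn w Ω volume := (Lp.memLp w).integrable one_le_two
  rw [Lp.eq_zero_iff_ae_eq_zero]
  refine (ae_restrict_iff' hΩo.measurableSet).2 ?_
  refine hΩo.ae_eq_zero_of_integral_contDiff_smul_eq_zero hint.locallyIntegrableOn ?_
  intro g hg hgc hgs
  have hf : (fun x => (g x : ℂ)) ∈ TestFun Ω := by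
    refine ⟨Complex.ofRealCLM.contDiff.comp hg, hgc.comp_left Complex.ofReal_zero, ?_⟩
    refine (closure_mono ?_).trans hgs
    intro x hx hx0
    exact hx (by simp [hx0])
  obtain ⟨γ, hγ⟩ := exists_schwartz_of_TestFun hs hf
  have h1 := h (toL2 γ) ⟨_, hf, hγ⟩
  -- Swapping the arguments moves the conjugation from `w` to the test function, which is real.
  rw [← inner_conj_symm, map_eq_zero, L2.inner_def] at h1
  have h2 : ∫ x in Ω, g x • w x = 0 := by
    rw [← h1]
    refine integral_congr_ae ?_
    filter_upwards [LpToLpRestrictCLM_coeFn ℂ Ω (besselInv n hs (toL2 γ)),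
      ae_restrict_of_ae hγ] with x hx1 hx2
    rw [hx1, hx2, RCLike.inner_apply, Complex.conj_ofReal, Complex.real_smul, mul_comm]
  rw [← h2]
  refine (setIntegral_eq_integral_of_forall_compl_eq_zero fun x hx => ?_).symm
  rw [image_eq_zero_of_notMem_tsupport fun hx' => hx (hgs hx'), zero_smul]

theorem restrictL2_eq_zero_of_mem_besselTest {n : ℕ} {s : ℝ} (hs : 0 ≤ s) {Ω W : Set (E n)}
    (hΩ : MeasurableSet Ω) (hW : W ⊆ (closure Ω)ᶜ) {k : L2 n} (hk : k ∈ besselTest hs W) :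
    restrictL2 Ω (besselInv n hs k) = 0 := by
  obtain ⟨f, hf, hkf⟩ := hk
  rw [Lp.eq_zero_iff_ae_eq_zero]
  refine (LpToLpRestrictCLM_coeFn ℂ Ω _).trans ?_
  refine (ae_restrict_iff' hΩ).2 ?_
  filter_upwards [hkf] with x hx hxΩ
  rw [hx]
  exact image_eq_zero_of_notMem_tsupport fun h => hW (hf.2.2 h) (subset_closure hxΩ)

/-! ### The duality argument -/

theorem rap_of_wucp {n : ℕ} (hn : 1 ≤ n) {s : ℝ} (hs0 : 0 < s) (hs1 : s < 1) {Ω : Set (E n)}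
    (hΩo : IsOpen Ω) (hΩb : Bornology.IsBounded Ω) {A : E n → E n → EC n} {q : E n → ℝ}
    (hAq : P0 s Ω A q) (h0 : ZeroNotEigenvalue s Ω A q) {W : Set (E n)} (hWo : IsOpen W)
    (hW : W ⊆ (closure Ω)ᶜ) (hWUCP : WUCP s Ω A q W) : RAP s Ω A q W := by
  have hΩ := hΩo.measurableSet
  obtain ⟨b, hb⟩ := exists_bilinCLM hn hs0 hs1 hΩ hAq
  have hsymm : ∀ g h, b g h = b h g := fun g h => by rw [hb, hb, bilin_comm]
  obtain ⟨R, hR⟩ := exists_submodule_RungeSet hs0.le hb W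
  rw [RAP, ← hR, Submodule.dense_iff_topologicalClosure_eq_top,
    Submodule.topologicalClosure_eq_top_iff, Submodule.eq_bot_iff]
  intro w hw
  have hwR : ∀ v ∈ RungeSet s Ω A q W, inner ℂ w v = 0 := fun v hv =>
    (Submodule.mem_orthogonal' R w).1 hw v (by rwa [← SetLike.mem_coe, hR])
  let l : L2 n →L[ℂ] ℂ :=
    (innerSL ℂ w).comp ((restrictL2 Ω).comp (besselInv n hs0.le))
  have hl : ∀ k, l k = inner ℂ w (restrictL2 Ω (besselInv n hs0.le k)) := fun _ => rfl
  -- `φ` is the dual solution, with source `w` and zero exterior value.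
  obtain ⟨φ, hφ, hφl⟩ := exists_solution hn hs0 hs1 hΩ hΩb hAq h0 hb l
  have htest : ∀ f ∈ besselTest hs0.le W, b φ f = 0 := by
    intro f hf
    -- The correction `k` makes `f + k` the solution with exterior value `f`, to which the
    -- orthogonality of `w` applies.
    obtain ⟨k, hk, hkf⟩ := exists_solution hn hs0 hs1 hΩ hΩb hAq h0 hb (-(b f))
    have h1 : l (f + k) = 0 := by
      refine hwR _ ((mem_RungeSet_iff hs0.le hb W _).2 ⟨f, hf, f + k, ?_, fun h hh => ?_, rfl⟩)
      · rwa [add_sub_cancel_left]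
      · rw [map_add, add_apply, hkf h hh, neg_apply, add_neg_cancel]
    have h2 : l f = 0 := by
      rw [hl, restrictL2_eq_zero_of_mem_besselTest hs0.le hΩ hW hf, inner_zero_right]
    rw [map_add, h2, zero_add, ← hφl k hk, hsymm, hkf φ hφ, neg_apply, neg_eq_zero] at h1
    rw [hsymm, h1]
  have hsolves : SolvesIn s Ω A q W (besselInv n hs0.le φ) := by
    rw [solvesIn_iff hs0.le hb]
    intro k hk
    -- Continuity of `b φ` extends the equation from test functions in `W` to all of `H̃ˢ(W)`.
    have hcl : IsClosed {k : L2 n | b φ k = 0} := isClosed_eq (b φ).continuous continuous_const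
    exact closure_minimal htest hcl hk
  have hout := ae_eq_zero_of_mem_closure hs0.le hΩ hφ
  have hin : ∀ᵐ x, x ∈ Ω → besselInv n hs0.le φ x = 0 := by
    rw [← ae_restrict_iff' hΩ]
    refine hWUCP _ ((mem_Hs_iff hs0.le _).2 ⟨φ, rfl⟩) ?_ hsolves
    rw [ae_restrict_iff' hWo.measurableSet]
    filter_upwards [hout] with x hx hxW
    exact hx fun hxΩ => hW hxW (subset_closure hxΩ)
  have hφ0 : φ = 0 := by
    refine besselInv_injective hs0.le ?_
    rw [map_zero, Lp.eq_zero_iff_ae_eq_zero]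
    filter_upwards [hin, hout] with x h1 h2
    by_cases hx : x ∈ Ω
    · exact h1 hx
    · exact h2 hx
  -- With `φ = 0`, the dual equation says that `w` is orthogonal to every test function in `Ω`.
  refine eq_zero_of_forall_besselTest hs0.le hΩo hΩb w fun k hk => ?_
  rw [← hl, ← hφl k ((besselTest hs0.le Ω).le_topologicalClosure hk), hφ0, map_zero]
  rfl

end FMSE

end

theorem mainTheorem7 (n : ℕ) (hn : 1 ≤ n) (s : ℝ) (hs0 : 0 < s) (hs1 : s < 1)
    (Ω : Set (FMSE.E n)) (hΩo : IsOpen Ω) (hΩb : Bornology.IsBounded Ω)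
    (A : FMSE.E n → FMSE.E n → FMSE.EC n) (q : FMSE.E n → ℝ)
    (hAq : FMSE.P0 s Ω A q) (h0 : FMSE.ZeroNotEigenvalue s Ω A q)
    (W : Set (FMSE.E n)) (hWo : IsOpen W) (hW : W ⊆ (closure Ω)ᶜ)
    (hWUCP : FMSE.WUCP s Ω A q W) :
    FMSE.RAP s Ω A q W :=
  FMSE.rap_of_wucp hn hs0 hs1 hΩo hΩb hAq h0 hWo hW hWUCP
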